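/- Let $k$ be an algebraically closed field of characteristic $0$, let $\mathcal C$ be a fusion category over $k$ (a $k$-linear abelian rigid monoidal category with bilinear $\otimes$, finite-dimensional Hom spaces and simple unit object $\mathbf 1$, in which every object is a finite direct sum of simple objects, with finitely many simple objects up to isomorphism), and let a finite group $G$ act on $\mathcal C$ by $k$-linear tensor autoequivalences $\rho^g$, with isomorphisms of tensor functors $\rho_2^{g,h}:\rho^g\rho^h\cong\rho^{gh}$ and $\rho_0:\mathrm{id}\cong\rho^e$ satisfying the usual associativity and unit conditions. Let $\mathcal C^G$ be the equivariantization: its objects are pairs $(X,\mu)$ with isomorphisms $\mu^g:\rho^gX\to X$ such that $\mu^g\rho^g(\mu^h)=\mu^{gh}(\rho_2^{g,h})_X$ and $\mu^e(\rho_0)_X=\mathrm{id}_X$; its morphisms are the morphisms of $\mathcal C$ commuting with the $\mu^g$; its tensor product is that of $\mathcal C$, with $\rho^g(X\otimes X')\cong\rho^gX\otimes\rho^gX'\xrightarrow{\mu^g\otimes\mu'^g}X\otimes X'$. The category $\operatorname{rep}G$ of finite-dimensional $k$-linear representations of $G$ maps to $\mathcal C^G$ by the tensor functor $(V,\pi)\mapsto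 V\otimes\mathbf 1$, with equivariant structure $\rho^g(V\otimes\mathbf 1)=V\otimes\rho^g\mathbf 1\cong V\otimes\mathbf 1$ given by $\pi(g)$ and $\rho^g\mathbf 1\cong\mathbf 1$. In this way $\mathcal C^G$ is a $\operatorname{rep}G$-bimodule category by left and right tensor product. The group $G$ acts on the finite set $\operatorname{Irr}(\mathcal C)$ of isomorphism classes of simple objects by $Y\mapsto\rho^gY$. For each $G$-orbit in $\operatorname{Irr}(\mathcal C)$ choose a simple object $Y$ whose class lies in the orbit, put $G_Y=\{g\in G:\rho^gY\cong Y\}$, and choose isomorphisms $c^g:\rho^gY\to Y$ for $g\in G_Y$. Define $\alpha_Y:G_Y\times G_Y\to k^\times$ by $$\alpha_Y(g,h)^{-1}\,\mathrm{id}_Y=c^g\,\rho^g(c^h)\,\bigl((\rho_2^{g,h})_Y\bigr)^{-1}(c^{gh})^{-1}.$$ Let $\operatorname{rep}_{\alpha_Y}G_Y$ be the category of $\alpha_Y$-projective representations of $G_Y$: finite-dimensional vector spaces $M$ with operators $\pi(g)$, $g\in G_Y$, such that $\pi(g)\pi(h)=\alpha_Y(g,h)\pi(gh)$ and $\pi(e)=\alpha_Y(e,e)\,\mathrm{id}$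 (that is, $\pi(e)=\mathrm{id}$ if $\alpha_Y$ is normalized), with the linear maps commuting with all $\pi(g)$ as morphisms. It is a $\operatorname{rep}G$-bimodule category by $V\otimes M$ and $M\otimes V$, where $g\in G_Y$ acts by $\pi_V(g)\otimes\pi_M(g)$ and by $\pi_M(g)\otimes\pi_V(g)$. **Theorem.** For all such choices there is an equivalence of $\operatorname{rep}G$-bimodule categories $$\mathcal C^G\;\simeq\;\bigoplus_{Y\in\operatorname{Irr}(\mathcal C)/G}\operatorname{rep}_{\alpha_Y}G_Y .$$ Moreover each $\operatorname{rep}_{\alpha_Y}G_Y$ is an indecomposable $\operatorname{rep}G$-bimodule category: it is nonzero, and it is not equivalent as a $\operatorname{rep}G$-bimodule category to a direct sum of two nonzero ones. -/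

import Mathlib

open CategoryTheory CategoryTheory.Limits CategoryTheory.MonoidalCategory

universe u w v uC

attribute [local instance] Abelian.hasFiniteBiproducts

noncomputable section

namespace EquivFusion

/-! ### Fusion categories and their simple objects -/

/-- A `k`-linear abelian rigid monoidal category with bilinear tensor product is a fusion category
if its Hom spaces are finite-dimensional, the unit object is simple, every object is a finite
direct sum of simple objects, and there are finitely many isomorphism classes of simple objects.
(The ground field is taken algebraically closed of characteristic zero where it matters.) -/
class FusionCategory (k : Type u) [Field k] (C : Type uC) [Category.{v} C] [Abelian C]
    [Linear k C] [MonoidalCategory C] [MonoidalPreadditive C] [MonoidalLinear k C]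
    [RigidCategory C] : Prop where
  finiteDimensional_hom : ∀ X Y : C, FiniteDimensional k (X ⟶ Y)
  simple_unit : Simple (𝟙_ C)
  semisimple : ∀ X : C, ∃ (n : ℕ) (S : Fin n → C),
    (∀ i, Simple (S i)) ∧ Nonempty (X ≅ ⨁ S)
  finite_simples : ∃ (n : ℕ) (S : Fin n → C), ∀ X : C, Simple X → ∃ i, Nonempty (X ≅ S i)

attribute [instance] FusionCategory.finiteDimensional_hom

/-- The simple objects of a category. -/
abbrev SimpleObj (C : Type uC) [Category.{v} C] [HasZeroMorphisms C] : Type uC :=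
  { X : C // Simple X }

instance {C : Type uC} [Category.{v} C] [HasZeroMorphisms C] (Y : SimpleObj C) :
    Simple Y.1 := Y.2

/-- Isomorphism of simple objects, as an equivalence relation. -/
def simpleSetoid (C : Type uC) [Category.{v} C] [HasZeroMorphisms C] : Setoid (SimpleObj C) where
  r X Y := Nonempty (X.1 ≅ Y.1)
  iseqv := ⟨fun _ => ⟨Iso.refl _⟩, fun ⟨e⟩ => ⟨e.symm⟩, fun ⟨e⟩ ⟨f⟩ => ⟨e ≪≫ f⟩⟩

/-- `Irr C`: the set of isomorphism classes of simple objects of `C`. -/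
def Irr (C : Type uC) [Category.{v} C] [HasZeroMorphisms C] : Type uC :=
  Quotient (simpleSetoid C)

/-! ### Actions of a group by tensor autoequivalences -/

/-- An action `ρ : G → Aut_⊗ C` of a group by `k`-linear tensor autoequivalences: `k`-linear
monoidal functors `ρ^g`, and isomorphisms of monoidal functors `ρ₂^{g,h} : ρ^g ρ^h ≅ ρ^{gh}` and
`ρ₀ : id ≅ ρ^e`, satisfying the associativity and unit conditions. (Each `ρ^g` is then
automatically an equivalence, with quasi-inverse `ρ^{g⁻¹}`.) Recall that `F ⋙ F'` is `F' ∘ F`. -/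
structure TensorAction (k : Type u) [Field k] (G : Type w) [Group G] (C : Type uC)
    [Category.{v} C] [Preadditive C] [Linear k C] [MonoidalCategory C] where
  /-- The functors `ρ^g`. -/
  ρ : G → C ⥤ C
  [additive : ∀ g, (ρ g).Additive]
  [linear : ∀ g, (ρ g).Linear k]
  /-- The monoidal structure of `ρ^g`. -/
  [monoidal : ∀ g, (ρ g).Monoidal]
  /-- `ρ₂^{g,h} : ρ^g ρ^h ≅ ρ^{gh}`. -/
  ρ₂ : ∀ g h : G, ρ h ⋙ ρ g ≅ ρ (g * h)
  /-- `ρ₀ : id ≅ ρ^e`. -/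
  ρ₀ : 𝟭 C ≅ ρ 1
  [ρ₂_monoidal : ∀ g h, NatTrans.IsMonoidal (ρ₂ g h).hom]
  [ρ₀_monoidal : NatTrans.IsMonoidal ρ₀.hom]
  assoc : ∀ (a b c : G) (X : C),
    (ρ₂ a b).hom.app ((ρ c).obj X) ≫ (ρ₂ (a * b) c).hom.app X =
      (ρ a).map ((ρ₂ b c).hom.app X) ≫ (ρ₂ a (b * c)).hom.app X ≫
        eqToHom (by rw [mul_assoc])
  mul_unit : ∀ (a : G) (X : C),
    (ρ a).map (ρ₀.hom.app X) ≫ (ρ₂ a 1).hom.app X = eqToHom (by simp [mul_one])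
  unit_mul : ∀ (a : G) (X : C),
    ρ₀.hom.app ((ρ a).obj X) ≫ (ρ₂ 1 a).hom.app X = eqToHom (by simp [one_mul])

namespace TensorAction

attribute [instance] additive linear monoidal ρ₂_monoidal ρ₀_monoidal

variable {k : Type u} [Field k] {G : Type w} [Group G] {C : Type uC}
    [Category.{v} C] [Preadditive C] [Linear k C] [MonoidalCategory C]
    (A : TensorAction k G C)

/-- `ρ^g` as an equivalence of categories. -/
def equivalence (g : G) : C ≌ C :=
  CategoryTheory.Equivalence.mk (A.ρ g) (A.ρ g⁻¹)
    (A.ρ₀ ≪≫ eqToIso (by rw [inv_mul_cancel]) ≪≫ (A.ρ₂ g⁻¹ g).symm)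
    (A.ρ₂ g g⁻¹ ≪≫ eqToIso (by rw [mul_inv_cancel]) ≪≫ A.ρ₀.symm)

instance (g : G) : (A.ρ g).IsEquivalence :=
  inferInstanceAs (A.equivalence g).functor.IsEquivalence

/-- The action of `g` on simple objects, `Y ↦ ρ^g Y`. -/
def simpleMap (g : G) (Y : SimpleObj C) : SimpleObj C :=
  ⟨(A.ρ g).obj Y.1, simple_obj (A.ρ g) Y.1⟩

/-- The action of `G` on `Irr C` induced by `Y ↦ ρ^g Y`. -/
@[reducible]
def irrAction : MulAction G (Irr C) where
  smul g := Quotient.map' (s₁ := simpleSetoid C) (s₂ := simpleSetoid C) (A.simpleMap g)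
    fun _ _ ⟨e⟩ => ⟨(A.ρ g).mapIso e⟩
  one_smul y := by
    induction y using Quotient.inductionOn' with
    | h Y => exact Quotient.sound' (s₁ := simpleSetoid C) ⟨(A.ρ₀.app Y.1).symm⟩
  mul_smul g h y := by
    induction y using Quotient.inductionOn' with
    | h Y => exact Quotient.sound' (s₁ := simpleSetoid C) ⟨((A.ρ₂ g h).app Y.1).symm⟩

/-- The set of orbits `Irr C / G`. -/
def Orbits : Type uC := @MulAction.orbitRel.Quotient G (Irr C) _ A.irrAction

/-- The `G`-orbit of the isomorphism class of a simple object. -/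
def orbit (Y : SimpleObj C) : A.Orbits :=
  Quotient.mk (@MulAction.orbitRel G (Irr C) _ A.irrAction) (Quotient.mk (simpleSetoid C) Y)

/-- The inertia subgroup `G_Y = {g ∈ G | ρ^g Y ≅ Y}`. -/
def inertia (Y : C) : Subgroup G where
  carrier := { g | Nonempty ((A.ρ g).obj Y ≅ Y) }
  one_mem' := ⟨(A.ρ₀.app Y).symm⟩
  mul_mem' := fun {g h} ⟨e⟩ ⟨f⟩ => ⟨((A.ρ₂ g h).app Y).symm ≪≫ (A.ρ g).mapIso f ≪≫ e⟩
  inv_mem' := fun {g} ⟨e⟩ => ⟨(A.ρ g⁻¹).mapIso e.symm ≪≫ ((A.equivalence g).unitIso.app Y).symm⟩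

end TensorAction

/-! ### Bimodule categories -/

open scoped MonoidalLeftAction MonoidalRightAction

section Bimodule

variable (k : Type*) [Field k] (A : Type*) [Category* A] [MonoidalCategory A] [Preadditive A]
  [Linear k A]

/-- `M` is an `A`-bimodule category over `k`: it carries a left and a right action of the
`k`-linear monoidal category `A` (with `k`-bilinear action functors), and natural middle
associativity isomorphisms `(a ⊙ m) ⊙ b ≅ a ⊙ (m ⊙ b)` satisfying the two pentagon and the
two triangle identities. -/
class BimoduleCategory (M : Type*) [Category* M] [Preadditive M] [Linear k M]
    [MonoidalLeftAction A M] [MonoidalRightAction A M] where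
  middle : ∀ (a : A) (m : M) (b : A), (a ⊙ₗ m) ⊙ᵣ b ≅ a ⊙ₗ (m ⊙ᵣ b)
  middle_naturality : ∀ {a a' : A} {m m' : M} {b b' : A} (f : a ⟶ a') (h : m ⟶ m') (g : b ⟶ b'),
    ((f ⊙ₗₘ h) ⊙ᵣₘ g) ≫ (middle a' m' b').hom = (middle a m b).hom ≫ (f ⊙ₗₘ (h ⊙ᵣₘ g))
  pentagon_left : ∀ (a a' : A) (m : M) (b : A),
    (αₗ a a' m).hom ⊵ᵣ b ≫ (middle a (a' ⊙ₗ m) b).hom ≫ a ⊴ₗ (middle a' m b).hom =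
      (middle (a ⊗ a') m b).hom ≫ (αₗ a a' (m ⊙ᵣ b)).hom
  pentagon_right : ∀ (a : A) (m : M) (b b' : A),
    (αᵣ (a ⊙ₗ m) b b').hom ≫ (middle a m b).hom ⊵ᵣ b' ≫ (middle a (m ⊙ᵣ b) b').hom =
      (middle a m (b ⊗ b')).hom ≫ a ⊴ₗ (αᵣ m b b').hom
  triangle_left : ∀ (m : M) (b : A),
    (middle (𝟙_ A) m b).hom ≫ (λₗ (m ⊙ᵣ b)).hom = (λₗ m).hom ⊵ᵣ b
  triangle_right : ∀ (a : A) (m : M),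
    (middle a m (𝟙_ A)).hom ≫ a ⊴ₗ (ρᵣ m).hom = (ρᵣ (a ⊙ₗ m)).hom
  add_left : ∀ {a a' : A} (f f' : a ⟶ a') (m : M), (f + f') ⊵ₗ m = f ⊵ₗ m + f' ⊵ₗ m
  smul_left : ∀ {a a' : A} (r : k) (f : a ⟶ a') (m : M), (r • f) ⊵ₗ m = r • f ⊵ₗ m
  left_add : ∀ (a : A) {m m' : M} (f f' : m ⟶ m'), a ⊴ₗ (f + f') = a ⊴ₗ f + a ⊴ₗ f'
  left_smul : ∀ (a : A) {m m' : M} (r : k) (f : m ⟶ m'), a ⊴ₗ (r • f) = r • a ⊴ₗ f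
  add_right : ∀ {m m' : M} (f f' : m ⟶ m') (b : A), (f + f') ⊵ᵣ b = f ⊵ᵣ b + f' ⊵ᵣ b
  smul_right : ∀ {m m' : M} (r : k) (f : m ⟶ m') (b : A), (r • f) ⊵ᵣ b = r • f ⊵ᵣ b
  right_add : ∀ (m : M) {b b' : A} (f f' : b ⟶ b'), m ⊴ᵣ (f + f') = m ⊴ᵣ f + m ⊴ᵣ f'
  right_smul : ∀ (m : M) {b b' : A} (r : k) (f : b ⟶ b'), m ⊴ᵣ (r • f) = r • m ⊴ᵣ f

open BimoduleCategory Functor.LaxLeftLinear Functor.LaxRightLinear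

/-- An equivalence of `A`-bimodule categories: a `k`-linear equivalence of categories that is a left
and a right `A`-module functor (with invertible structure morphisms `a ⊙ F m ≅ F (a ⊙ m)`
and `F m ⊙ b ≅ F (m ⊙ b)`), compatibly with the middle associativity isomorphisms. -/
structure BimoduleEquivalence (M N : Type*) [Category* M] [Preadditive M] [Linear k M]
    [MonoidalLeftAction A M] [MonoidalRightAction A M] [BimoduleCategory k A M]
    [Category* N] [Preadditive N] [Linear k N]
    [MonoidalLeftAction A N] [MonoidalRightAction A N] [BimoduleCategory k A N] where
  functor : M ⥤ N
  [isEquivalence : functor.IsEquivalence]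
  [additive : functor.Additive]
  [linear : functor.Linear k]
  [leftLinear : functor.LeftLinear A]
  [rightLinear : functor.RightLinear A]
  middle_compat : ∀ (a : A) (m : M) (b : A),
    μₗ functor a m ⊵ᵣ b ≫ μᵣ functor (a ⊙ₗ m) b ≫ functor.map (middle k a m b).hom =
      (middle k a (functor.obj m) b).hom ≫ a ⊴ₗ μᵣ functor m b ≫ μₗ functor a (m ⊙ᵣ b)

end Bimodule

/-! ### Direct sums of bimodule categories

The direct sum of a finite family of `k`-linear categories is its product category; Hom spaces,
actions and all structure morphisms are formed componentwise. -/

section DirectSum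

variable {I : Type*} (M : I → Type*) [∀ i, Category* (M i)]

instance piPreadditive [∀ i, Preadditive (M i)] : Preadditive (∀ i, M i) where
  homGroup X Y := inferInstanceAs (AddCommGroup (∀ i, X i ⟶ Y i))
  add_comp _ _ _ _ _ _ := funext fun _ => Preadditive.add_comp _ _ _ _ _ _
  comp_add _ _ _ _ _ _ := funext fun _ => Preadditive.comp_add _ _ _ _ _ _

instance piLinear (k : Type*) [Field k] [∀ i, Preadditive (M i)] [∀ i, Linear k (M i)] :
    Linear k (∀ i, M i) where
  homModule X Y := inferInstanceAs (Module k (∀ i, X i ⟶ Y i))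
  smul_comp _ _ _ _ _ _ := funext fun _ => Linear.smul_comp _ _ _ _ _ _
  comp_smul _ _ _ _ _ _ := funext fun _ => Linear.comp_smul _ _ _ _ _ _

variable (A : Type*) [Category* A] [MonoidalCategory A]

instance piLeftAction [∀ i, MonoidalLeftAction A (M i)] : MonoidalLeftAction A (∀ i, M i) where
  actionObj a m i := a ⊙ₗ m i
  actionHomLeft f m i := f ⊵ₗ m i
  actionHomRight a _ _ f i := a ⊴ₗ f i
  actionHom f g i := f ⊙ₗₘ g i
  actionAssocIso a b m := Pi.isoMk fun i => αₗ a b (m i)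
  actionUnitIso m := Pi.isoMk fun i => λₗ (m i)
  actionHom_def _ _ := funext fun _ => MonoidalLeftAction.actionHom_def _ _
  actionHomRight_id _ _ := funext fun _ => MonoidalLeftAction.actionHomRight_id _ _
  id_actionHomLeft _ _ := funext fun _ => MonoidalLeftAction.id_actionHomLeft _ _
  actionHom_comp _ _ _ _ := funext fun _ => MonoidalLeftAction.actionHom_comp _ _ _ _
  actionAssocIso_hom_naturality _ _ _ :=
    funext fun _ => MonoidalLeftAction.actionAssocIso_hom_naturality _ _ _
  actionUnitIso_hom_naturality _ :=
    funext fun _ => MonoidalLeftAction.actionUnitIso_hom_naturality _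
  whiskerLeft_actionHomLeft _ _ _ _ _ :=
    funext fun _ => MonoidalLeftAction.whiskerLeft_actionHomLeft _ _ _
  whiskerRight_actionHomLeft _ _ _ :=
    funext fun _ => MonoidalLeftAction.whiskerRight_actionHomLeft _ _ _
  associator_actionHom _ _ _ _ :=
    funext fun _ => MonoidalLeftAction.associator_actionHom _ _ _ _
  leftUnitor_actionHom _ _ := funext fun _ => MonoidalLeftAction.leftUnitor_actionHom _ _
  rightUnitor_actionHom _ _ := funext fun _ => MonoidalLeftAction.rightUnitor_actionHom _ _

instance piRightAction [∀ i, MonoidalRightAction A (M i)] :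
    MonoidalRightAction A (∀ i, M i) where
  actionObj m a i := m i ⊙ᵣ a
  actionHomLeft f a i := f i ⊵ᵣ a
  actionHomRight m _ _ f i := m i ⊴ᵣ f
  actionHom g f i := g i ⊙ᵣₘ f
  actionAssocIso m a b := Pi.isoMk fun i => αᵣ (m i) a b
  actionUnitIso m := Pi.isoMk fun i => ρᵣ (m i)
  actionHom_def _ _ := funext fun _ => MonoidalRightAction.actionHom_def _ _
  actionHomRight_id _ _ := funext fun _ => MonoidalRightAction.actionHomRight_id _ _
  id_actionHomLeft _ _ := funext fun _ => MonoidalRightAction.id_actionHomLeft _ _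
  actionHom_comp _ _ _ _ := funext fun _ => MonoidalRightAction.actionHom_comp _ _ _ _
  actionAssocIso_hom_naturality _ _ _ :=
    funext fun _ => MonoidalRightAction.actionAssocIso_hom_naturality _ _ _
  actionUnitIso_hom_naturality _ :=
    funext fun _ => MonoidalRightAction.actionUnitIso_hom_naturality _
  actionHomRight_whiskerRight _ _ _ :=
    funext fun _ => MonoidalRightAction.actionHomRight_whiskerRight _ _ _
  whiskerRight_actionHomLeft _ _ _ _ _ :=
    funext fun _ => MonoidalRightAction.whiskerRight_actionHomLeft _ _ _
  actionHom_associator _ _ _ _ :=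
    funext fun _ => MonoidalRightAction.actionHom_associator _ _ _ _
  actionHom_leftUnitor _ _ := funext fun _ => MonoidalRightAction.actionHom_leftUnitor _ _
  actionHom_rightUnitor _ _ := funext fun _ => MonoidalRightAction.actionHom_rightUnitor _ _

instance piBimodule (k : Type*) [Field k] [Preadditive A] [Linear k A]
    [∀ i, Preadditive (M i)] [∀ i, Linear k (M i)]
    [∀ i, MonoidalLeftAction A (M i)] [∀ i, MonoidalRightAction A (M i)]
    [∀ i, BimoduleCategory k A (M i)] : BimoduleCategory k A (∀ i, M i) where
  middle a m b := Pi.isoMk fun i => BimoduleCategory.middle k a (m i) b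
  middle_naturality _ _ _ := funext fun _ => BimoduleCategory.middle_naturality _ _ _
  pentagon_left _ _ _ _ := funext fun _ => BimoduleCategory.pentagon_left _ _ _ _
  pentagon_right _ _ _ _ := funext fun _ => BimoduleCategory.pentagon_right _ _ _ _
  triangle_left _ _ := funext fun _ => BimoduleCategory.triangle_left _ _
  triangle_right _ _ := funext fun _ => BimoduleCategory.triangle_right _ _
  add_left _ _ _ := funext fun _ => BimoduleCategory.add_left k _ _ _
  smul_left _ _ _ := funext fun _ => BimoduleCategory.smul_left _ _ _
  left_add _ _ _ _ _ := funext fun _ => BimoduleCategory.left_add k _ _ _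
  left_smul _ _ _ _ _ := funext fun _ => BimoduleCategory.left_smul _ _ _
  add_right _ _ _ := funext fun _ => BimoduleCategory.add_right k _ _ _
  smul_right _ _ _ := funext fun _ => BimoduleCategory.smul_right _ _ _
  right_add _ _ _ _ _ := funext fun _ => BimoduleCategory.right_add k _ _ _
  right_smul _ _ _ _ _ := funext fun _ => BimoduleCategory.right_smul _ _ _

end DirectSum

/-- An `A`-bimodule category is indecomposable if it is nonzero and is not equivalent, as a
bimodule category, to the direct sum of two nonzero bimodule categories. (A category is nonzero if
it has an object that is not a zero object.) -/
def IsIndecomposable (k : Type*) [Field k] (A : Type*) [Category* A] [MonoidalCategory A]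
    [Preadditive A] [Linear k A] (M : Type uC) [Category.{v} M] [Preadditive M] [Linear k M]
    [MonoidalLeftAction A M] [MonoidalRightAction A M] [BimoduleCategory k A M] : Prop :=
  (∃ m : M, ¬ IsZero m) ∧
  ∀ (N : Bool → Type uC) [∀ i, Category.{v} (N i)] [∀ i, Preadditive (N i)]
    [∀ i, Linear k (N i)] [∀ i, MonoidalLeftAction A (N i)] [∀ i, MonoidalRightAction A (N i)]
    [∀ i, BimoduleCategory k A (N i)],
    Nonempty (BimoduleEquivalence k A M (∀ i, N i)) → ∃ i, ∀ n : N i, IsZero n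

/-! ### The equivariantization -/

section Equivariantization

variable {k : Type u} [Field k] {G : Type w} [Group G] {C : Type uC}
    [Category.{v} C] [Preadditive C] [Linear k C] [MonoidalCategory C]

open Functor.LaxMonoidal Functor.OplaxMonoidal

/-- An object `(X, μ)` of the equivariantization `C^G`: an object `X` of `C` and isomorphisms
`μ^g : ρ^g X ≅ X` with `μ^g ρ^g(μ^h) = μ^{gh} (ρ₂^{g,h})_X` and `μ^e (ρ₀)_X = id`. -/
structure Equivariantization (A : TensorAction k G C) where
  X : C
  /-- The isomorphisms `μ^g`. -/
  act : ∀ g : G, (A.ρ g).obj X ≅ X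
  mul : ∀ g h : G, (A.ρ g).map (act h).hom ≫ (act g).hom = (A.ρ₂ g h).hom.app X ≫ (act (g * h)).hom
  unit : A.ρ₀.hom.app X ≫ (act 1).hom = 𝟙 X

namespace Equivariantization

variable {A : TensorAction k G C}

/-- A morphism of equivariant objects: `f μ^g = μ'^g ρ^g(f)` for all `g`. -/
@[ext]
structure Hom (M N : Equivariantization A) where
  hom : M.X ⟶ N.X
  comm : ∀ g : G, (M.act g).hom ≫ hom = (A.ρ g).map hom ≫ (N.act g).hom

lemma Hom.comm_assoc {M N : Equivariantization A} (f : Hom M N) (g : G) {Z : C} (h : N.X ⟶ Z) :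
    (M.act g).hom ≫ f.hom ≫ h = (A.ρ g).map f.hom ≫ (N.act g).hom ≫ h := by
  rw [← Category.assoc, f.comm, Category.assoc]

@[simps]
instance category : Category (Equivariantization A) where
  Hom := Hom
  id M := ⟨𝟙 M.X, by simp⟩
  comp f g := ⟨f.hom ≫ g.hom, fun a => by
    rw [Hom.comm_assoc, Hom.comm, Functor.map_comp, Category.assoc]⟩

@[ext]
lemma hom_ext {M N : Equivariantization A} {f g : M ⟶ N} (h : f.hom = g.hom) : f = g :=
  Hom.ext h

/-- The forgetful functor `C^G → C`. -/
@[simps]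
def forget (A : TensorAction k G C) : Equivariantization A ⥤ C where
  obj M := M.X
  map f := f.hom

instance : (forget A).Faithful where
  map_injective h := hom_ext h

/-- Isomorphisms of equivariant objects. -/
@[simps]
def isoMk {M N : Equivariantization A} (e : M.X ≅ N.X)
    (h : ∀ g : G, (M.act g).hom ≫ e.hom = (A.ρ g).map e.hom ≫ (N.act g).hom) : M ≅ N where
  hom := ⟨e.hom, h⟩
  inv := ⟨e.inv, fun g => by
    rw [← cancel_mono e.hom, Category.assoc, e.inv_hom_id, Category.comp_id, Category.assoc, h,
      ← Functor.map_comp_assoc, e.inv_hom_id, CategoryTheory.Functor.map_id, Category.id_comp]⟩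
  hom_inv_id := hom_ext e.hom_inv_id
  inv_hom_id := hom_ext e.inv_hom_id

section Linear

variable (M N : Equivariantization A)

instance : Zero (M ⟶ N) := ⟨⟨0, by simp⟩⟩
instance : Add (M ⟶ N) := ⟨fun f g => ⟨f.hom + g.hom, fun a => by
  simp [f.comm, g.comm, Functor.map_add]⟩⟩
instance : Neg (M ⟶ N) := ⟨fun f => ⟨-f.hom, fun a => by simp [f.comm, Functor.map_neg]⟩⟩
instance : Sub (M ⟶ N) := ⟨fun f g => ⟨f.hom - g.hom, fun a => by
  simp [f.comm, g.comm, Functor.map_sub]⟩⟩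
instance : SMul k (M ⟶ N) := ⟨fun r f => ⟨r • f.hom, fun a => by
  simp [f.comm, Functor.map_smul]⟩⟩
instance : SMul ℕ (M ⟶ N) := ⟨fun r f => ⟨r • f.hom, fun a => by
  simp [f.comm]⟩⟩
instance : SMul ℤ (M ⟶ N) := ⟨fun r f => ⟨r • f.hom, fun a => by
  simp [f.comm]⟩⟩

lemma hom_injective : Function.Injective (fun f : M ⟶ N => f.hom) := fun _ _ h => hom_ext h

instance : AddCommGroup (M ⟶ N) :=
  (hom_injective M N).addCommGroup _ rfl (fun _ _ => rfl) (fun _ => rfl) (fun _ _ => rfl)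
    (fun _ _ => rfl) (fun _ _ => rfl)

instance : Module k (M ⟶ N) :=
  Function.Injective.module k
    { toFun := fun f : M ⟶ N => f.hom, map_zero' := rfl, map_add' := fun _ _ => rfl }
    (hom_injective M N) (fun _ _ => rfl)

end Linear

instance preadditive : Preadditive (Equivariantization A) where
  add_comp _ _ _ _ _ _ := hom_ext (Preadditive.add_comp _ _ _ _ _ _)
  comp_add _ _ _ _ _ _ := hom_ext (Preadditive.comp_add _ _ _ _ _ _)

instance linear : Linear k (Equivariantization A) where
  smul_comp _ _ _ _ _ _ := hom_ext (Linear.smul_comp _ _ _ _ _ _)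
  comp_smul _ _ _ _ _ _ := hom_ext (Linear.comp_smul _ _ _ _ _ _)

/-- `(X, μ) ⊗ (Y, ν) = (X ⊗ Y, ξ)` with `ξ^g : ρ^g (X ⊗ Y) ≅ ρ^g X ⊗ ρ^g Y ≅ X ⊗ Y`. -/
@[simps]
def tensor (M N : Equivariantization A) : Equivariantization A where
  X := M.X ⊗ N.X
  act g := (Functor.Monoidal.μIso (A.ρ g) M.X N.X).symm ≪≫ (M.act g ⊗ᵢ N.act g)
  mul g h := by
    have key := NatTrans.IsMonoidal.tensor (τ := (A.ρ₂ g h).hom) M.X N.X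
    rw [Functor.LaxMonoidal.comp_μ] at key
    have key2 : δ (A.ρ g) ((A.ρ h).obj M.X) ((A.ρ h).obj N.X) ≫
        ((A.ρ₂ g h).hom.app M.X ⊗ₘ (A.ρ₂ g h).hom.app N.X) =
        (A.ρ g).map (μ (A.ρ h) M.X N.X) ≫ (A.ρ₂ g h).hom.app (M.X ⊗ N.X) ≫
          δ (A.ρ (g * h)) M.X N.X := by
      rw [← cancel_mono (μ (A.ρ (g * h)) M.X N.X), Category.assoc, ← key]
      simp
    simp only [Iso.trans_hom, Iso.symm_hom, Functor.Monoidal.μIso_inv, tensorIso_hom,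
      Functor.map_comp, Category.assoc]
    rw [← Functor.OplaxMonoidal.δ_natural_assoc, tensorHom_comp_tensorHom, M.mul, N.mul,
      ← tensorHom_comp_tensorHom, reassoc_of% key2, ← Functor.map_comp_assoc]
    simp
  unit := by
    have key := NatTrans.IsMonoidal.tensor (τ := A.ρ₀.hom) M.X N.X
    rw [← cancel_mono (δ (A.ρ 1) M.X N.X)] at key
    simp at key
    simp only [Functor.id_obj, Iso.trans_hom, Iso.symm_hom, Functor.Monoidal.μIso_inv,
      tensorIso_hom, reassoc_of% key, tensorHom_comp_tensorHom, M.unit, N.unit]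
    simp

/-- The unit object `(𝟙, ε⁻¹)` of `C^G`, where `ε^g : 𝟙 ≅ ρ^g 𝟙` is the unit isomorphism. -/
@[simps]
def tensorUnit (A : TensorAction k G C) : Equivariantization A where
  X := 𝟙_ C
  act g := (Functor.Monoidal.εIso (A.ρ g)).symm
  mul g h := by
    have key := NatTrans.IsMonoidal.unit (τ := (A.ρ₂ g h).hom)
    rw [Functor.LaxMonoidal.comp_ε] at key
    simp only [Iso.symm_hom, Functor.Monoidal.εIso_inv]
    rw [← cancel_mono (ε (A.ρ (g * h))), Category.assoc, Category.assoc, Functor.Monoidal.η_ε,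
      ← key]
    simp
  unit := by
    have key := NatTrans.IsMonoidal.unit (τ := A.ρ₀.hom)
    rw [← cancel_mono (η (A.ρ 1))] at key
    simpa using key

/-- Tensor product of morphisms. -/
@[simps]
def tensorHom {M M' N N' : Equivariantization A} (f : M ⟶ M') (g : N ⟶ N') :
    tensor M N ⟶ tensor M' N' where
  hom := f.hom ⊗ₘ g.hom
  comm a := by
    change (δ (A.ρ a) M.X N.X ≫ ((M.act a).hom ⊗ₘ (N.act a).hom)) ≫ (f.hom ⊗ₘ g.hom) =
      (A.ρ a).map (f.hom ⊗ₘ g.hom) ≫ δ (A.ρ a) M'.X N'.X ≫ ((M'.act a).hom ⊗ₘ (N'.act a).hom)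
    rw [← Functor.OplaxMonoidal.δ_natural_assoc, Category.assoc, tensorHom_comp_tensorHom,
      tensorHom_comp_tensorHom, f.comm, g.comm]

instance monoidalStruct : MonoidalCategoryStruct (Equivariantization A) where
  tensorObj := tensor
  tensorUnit := tensorUnit A
  tensorHom := tensorHom
  whiskerLeft M _ _ f := tensorHom (𝟙 M) f
  whiskerRight f N := tensorHom f (𝟙 N)
  associator M N P := isoMk (α_ M.X N.X P.X) fun g => by
    change (δ (A.ρ g) (M.X ⊗ N.X) P.X ≫ ((δ (A.ρ g) M.X N.X ≫
        ((M.act g).hom ⊗ₘ (N.act g).hom)) ⊗ₘ (P.act g).hom)) ≫ (α_ M.X N.X P.X).hom =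
      (A.ρ g).map (α_ M.X N.X P.X).hom ≫ δ (A.ρ g) M.X (N.X ⊗ P.X) ≫
        ((M.act g).hom ⊗ₘ (δ (A.ρ g) N.X P.X ≫ ((N.act g).hom ⊗ₘ (P.act g).hom)))
    have h1 : ((δ (A.ρ g) M.X N.X ≫ ((M.act g).hom ⊗ₘ (N.act g).hom)) ⊗ₘ (P.act g).hom) =
        δ (A.ρ g) M.X N.X ▷ _ ≫ (((M.act g).hom ⊗ₘ (N.act g).hom) ⊗ₘ (P.act g).hom) := by
      rw [← tensorHom_id, tensorHom_comp_tensorHom, Category.id_comp]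
    have h2 : ((M.act g).hom ⊗ₘ (δ (A.ρ g) N.X P.X ≫ ((N.act g).hom ⊗ₘ (P.act g).hom))) =
        _ ◁ δ (A.ρ g) N.X P.X ≫ ((M.act g).hom ⊗ₘ ((N.act g).hom ⊗ₘ (P.act g).hom)) := by
      rw [← id_tensorHom, tensorHom_comp_tensorHom, Category.id_comp]
    rw [h1, h2, Category.assoc, Category.assoc, associator_naturality,
      Functor.OplaxMonoidal.associativity_assoc]
  leftUnitor M := isoMk (λ_ M.X) fun g => by
    change (δ (A.ρ g) (𝟙_ C) M.X ≫ (η (A.ρ g) ⊗ₘ (M.act g).hom)) ≫ (λ_ M.X).hom =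
      (A.ρ g).map (λ_ M.X).hom ≫ (M.act g).hom
    rw [← Functor.OplaxMonoidal.left_unitality_hom, MonoidalCategory.tensorHom_def, Category.assoc, Category.assoc,
      leftUnitor_naturality, Category.assoc, Category.assoc]
  rightUnitor M := isoMk (ρ_ M.X) fun g => by
    change (δ (A.ρ g) M.X (𝟙_ C) ≫ ((M.act g).hom ⊗ₘ η (A.ρ g))) ≫ (ρ_ M.X).hom =
      (A.ρ g).map (ρ_ M.X).hom ≫ (M.act g).hom
    rw [← Functor.OplaxMonoidal.right_unitality_hom, tensorHom_def', Category.assoc,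
      Category.assoc, rightUnitor_naturality, Category.assoc, Category.assoc]

/-- The monoidal structure of `C^G`; the associativity and unit isomorphisms are those of `C`. -/
instance monoidal : MonoidalCategory (Equivariantization A) :=
  Monoidal.induced (forget A)
    { μIso := fun _ _ => Iso.refl _
      εIso := Iso.refl _
      whiskerLeft_eq := fun _ _ _ f => by
        change 𝟙 _ ⊗ₘ f.hom = 𝟙 _ ≫ (_ ◁ f.hom) ≫ 𝟙 _
        rw [Category.id_comp, Category.comp_id, id_tensorHom]
      whiskerRight_eq := fun f _ => by
        change f.hom ⊗ₘ 𝟙 _ = 𝟙 _ ≫ (f.hom ▷ _) ≫ 𝟙 _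
        rw [Category.id_comp, Category.comp_id, tensorHom_id]
      tensorHom_eq := fun f g => by
        change f.hom ⊗ₘ g.hom = 𝟙 _ ≫ (f.hom ⊗ₘ g.hom) ≫ 𝟙 _
        rw [Category.id_comp, Category.comp_id]
      associator_eq := fun M N P => by
        change (α_ M.X N.X P.X).hom = (𝟙 _ ≫ (𝟙 _ ⊗ₘ 𝟙 _)) ≫ (α_ M.X N.X P.X).hom ≫
          (𝟙 _ ⊗ₘ 𝟙 _) ≫ 𝟙 _
        simp
      leftUnitor_eq := fun M => by
        change (λ_ M.X).hom = (𝟙 _ ≫ (𝟙 _ ⊗ₘ 𝟙 _)) ≫ (λ_ M.X).hom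
        simp
      rightUnitor_eq := fun M => by
        change (ρ_ M.X).hom = (𝟙 _ ≫ (𝟙 _ ⊗ₘ 𝟙 _)) ≫ (ρ_ M.X).hom
        simp }

section HomLemmas

variable {M M' N N' P : Equivariantization A}

@[simp] lemma tensorObj_X : (M ⊗ N).X = M.X ⊗ N.X := rfl
@[simp] lemma tensorUnit_X' : (𝟙_ (Equivariantization A)).X = 𝟙_ C := rfl
@[simp] lemma tensorHom_hom' (f : M ⟶ M') (g : N ⟶ N') : (f ⊗ₘ g).hom = f.hom ⊗ₘ g.hom := rfl
@[simp] lemma whiskerLeft_hom (f : N ⟶ N') : (M ◁ f).hom = M.X ◁ f.hom := id_tensorHom _ _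
@[simp] lemma whiskerRight_hom (f : M ⟶ M') : (f ▷ N).hom = f.hom ▷ N.X := tensorHom_id _ _
@[simp] lemma associator_hom_hom : (α_ M N P).hom.hom = (α_ M.X N.X P.X).hom := rfl
@[simp] lemma associator_inv_hom : (α_ M N P).inv.hom = (α_ M.X N.X P.X).inv := rfl
@[simp] lemma leftUnitor_hom_hom : (λ_ M).hom.hom = (λ_ M.X).hom := rfl
@[simp] lemma rightUnitor_hom_hom : (ρ_ M).hom.hom = (ρ_ M.X).hom := rfl
@[simp] lemma add_hom (f g : M ⟶ N) : (f + g).hom = f.hom + g.hom := rfl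
@[simp] lemma smul_hom (r : k) (f : M ⟶ N) : (r • f).hom = r • f.hom := rfl
@[simp] lemma zero_hom : (0 : M ⟶ N).hom = 0 := rfl

end HomLemmas

instance [MonoidalPreadditive C] : MonoidalPreadditive (Equivariantization A) where
  whiskerLeft_zero := hom_ext (by simp; rfl)
  zero_whiskerRight := hom_ext (by simp; rfl)
  whiskerLeft_add _ _ := hom_ext (by simp; rfl)
  add_whiskerRight _ _ := hom_ext (by simp; rfl)

instance [MonoidalPreadditive C] [MonoidalLinear k C] :
    MonoidalLinear k (Equivariantization A) where
  whiskerLeft_smul _ _ _ _ _ := hom_ext (by simp; rfl)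
  smul_whiskerRight _ _ _ _ _ := hom_ext (by simp; rfl)

end Equivariantization

end Equivariantization

/-! ### Tensoring an object by a finite-dimensional vector space -/

section Copower

open Module

variable {k : Type u} [Field k] {C : Type uC} [Category.{v} C] [Preadditive C] [Linear k C]

variable (k) in
/-- Data exhibiting an object `T` as `V ⊗ Y`, for a finite-dimensional vector space `V`: a linear
family of morphisms `v ⊗ - : Y ⟶ T`, `v ∈ V`, which on a basis of `V` is the family of inclusions
of a direct sum decomposition of `T` into copies of `Y`. -/
structure Copower (V : Type*) [AddCommGroup V] [Module k V] [Module.Finite k V] (Y T : C) where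
  ins : V →ₗ[k] (Y ⟶ T)
  proj : Fin (finrank k V) → (T ⟶ Y)
  ins_proj : ∀ i j, ins (finBasis k V i) ≫ proj j = if i = j then 𝟙 Y else 0
  total : ∑ i, proj i ≫ ins (finBasis k V i) = 𝟙 T

namespace Copower

variable {V : Type*} [AddCommGroup V] [Module k V] [Module.Finite k V] {Y T : C}

lemma hom_ext (c : Copower k V Y T) {Z : C} {f g : T ⟶ Z}
    (h : ∀ v : V, c.ins v ≫ f = c.ins v ≫ g) : f = g := by
  rw [← Category.id_comp f, ← Category.id_comp g, ← c.total, Preadditive.sum_comp,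
    Preadditive.sum_comp]
  exact Finset.sum_congr rfl fun i _ => by rw [Category.assoc, Category.assoc, h]

/-- The morphism `V ⊗ Y ⟶ Z` induced by a linear family of morphisms `Y ⟶ Z`. -/
def desc (c : Copower k V Y T) {Z : C} (φ : V →ₗ[k] (Y ⟶ Z)) : T ⟶ Z :=
  ∑ i, c.proj i ≫ φ (finBasis k V i)

@[simp]
lemma ins_desc (c : Copower k V Y T) {Z : C} (φ : V →ₗ[k] (Y ⟶ Z)) (v : V) :
    c.ins v ≫ c.desc φ = φ v := by
  suffices h : (Linear.rightComp k Y (c.desc φ)) ∘ₗ c.ins = φ from LinearMap.congr_fun h v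
  refine (finBasis k V).ext fun i => ?_
  simp only [LinearMap.comp_apply, Linear.rightComp_apply, desc, Preadditive.comp_sum]
  rw [Finset.sum_eq_single i]
  · rw [← Category.assoc, c.ins_proj, if_pos rfl, Category.id_comp]
  · intro j _ hj
    rw [← Category.assoc, c.ins_proj, if_neg hj.symm, zero_comp]
  · simp

@[simp]
lemma ins_desc_assoc (c : Copower k V Y T) {Z W : C} (φ : V →ₗ[k] (Y ⟶ Z)) (v : V) (h : Z ⟶ W) :
    c.ins v ≫ c.desc φ ≫ h = φ v ≫ h := by
  rw [← Category.assoc, ins_desc]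

lemma ins_proj' (c : Copower k V Y T) (x : V) (i : Fin (finrank k V)) :
    c.ins x ≫ c.proj i = (finBasis k V).repr x i • 𝟙 Y := by
  conv_lhs => rw [← (finBasis k V).sum_repr x, map_sum, Preadditive.sum_comp]
  rw [Finset.sum_eq_single i]
  · rw [map_smul, Linear.smul_comp, c.ins_proj, if_pos rfl]
  · intro j _ hj
    rw [map_smul, Linear.smul_comp, c.ins_proj, if_neg hj, smul_zero]
  · simp

/-- A `k`-linear functor preserves `V ⊗ Y`. -/
def map (c : Copower k V Y T) {D : Type*} [Category* D] [Preadditive D] [Linear k D] (F : C ⥤ D)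
    [F.Additive] [F.Linear k] : Copower k V (F.obj Y) (F.obj T) where
  ins := F.mapLinearMap k ∘ₗ c.ins
  proj i := F.map (c.proj i)
  ins_proj i j := by
    change F.map _ ≫ F.map _ = _
    rw [← F.map_comp, c.ins_proj]
    split_ifs <;> simp
  total := by
    change ∑ i, F.map _ ≫ F.map _ = _
    simp_rw [← F.map_comp]
    rw [← F.map_sum, c.total, F.map_id]

@[simp]
lemma map_ins (c : Copower k V Y T) {D : Type*} [Category* D] [Preadditive D] [Linear k D]
    (F : C ⥤ D) [F.Additive] [F.Linear k] (v : V) : (c.map F).ins v = F.map (c.ins v) := rfl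

end Copower

variable [HasFiniteBiproducts C]

variable (k) in
/-- The object `V ⊗ Y` of `C`, a direct sum of `dim V` copies of `Y`. -/
def tensorVec (V : Type*) [AddCommGroup V] [Module k V] (Y : C) : C :=
  ⨁ fun _ : Fin (finrank k V) => Y

variable (k) in
/-- The morphisms `v ⊗ - : Y ⟶ V ⊗ Y`. -/
def tensorVecCopower (V : Type*) [AddCommGroup V] [Module k V] [Module.Finite k V] (Y : C) :
    Copower k V Y (tensorVec k V Y) where
  ins := (finBasis k V).constr (M' := Y ⟶ ⨁ fun _ : Fin (finrank k V) => Y) k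
    fun i => biproduct.ι (fun _ : Fin (finrank k V) => Y) i
  proj i := biproduct.π (fun _ : Fin (finrank k V) => Y) i
  ins_proj i j := by
    refine (congrArg (· ≫ biproduct.π (fun _ : Fin (finrank k V) => Y) j)
      ((finBasis k V).constr_basis k _ i)).trans ?_
    split_ifs with h
    · subst h; exact biproduct.ι_π_self _ _
    · exact biproduct.ι_π_ne _ h
  total := by
    refine (Finset.sum_congr rfl fun i _ =>
      congrArg (biproduct.π (fun _ : Fin (finrank k V) => Y) i ≫ ·)
        ((finBasis k V).constr_basis k _ i)).trans ?_
    exact biproduct.total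

end Copower

/-! ### The embedding of `rep G` into the equivariantization -/

section Embedding

variable {k : Type u} [Field k] {G : Type w} [Group G]

namespace RepLin

variable {V W V' W' U : FDRep k G}

/-- The linear map underlying a morphism of representations. -/
def lin (f : V ⟶ W) : V →ₗ[k] W := f.hom.hom.hom

lemma lin_id (x : V) : lin (𝟙 V) x = x := rfl
lemma lin_comp (f : V ⟶ W) (g : W ⟶ U) (x : V) : lin (f ≫ g) x = lin g (lin f x) := rfl
lemma lin_add (f g : V ⟶ W) (x : V) : lin (f + g) x = lin f x + lin g x := rfl
lemma lin_smul (r : k) (f : V ⟶ W) (x : V) : lin (r • f) x = r • lin f x := rfl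
lemma lin_comm (f : V ⟶ W) (g : G) (x : V) : lin f (V.ρ g x) = W.ρ g (lin f x) :=
  LinearMap.congr_fun (congrArg (fun h => h.hom.hom) (f.comm g)) x
lemma ρ_tensor (g : G) (x : V) (y : W) :
    (V ⊗ W).ρ g (TensorProduct.tmul k x y : TensorProduct k V W) =
      (TensorProduct.tmul k (V.ρ g x) (W.ρ g y) : TensorProduct k V W) := rfl
lemma lin_whiskerRight (f : V ⟶ V') (x : V) (y : W) :
    lin (f ▷ W) (TensorProduct.tmul k x y : TensorProduct k V W) =
      (TensorProduct.tmul k (lin f x) y : TensorProduct k V' W) := rfl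
lemma lin_whiskerLeft (f : W ⟶ W') (x : V) (y : W) :
    lin (V ◁ f) (TensorProduct.tmul k x y : TensorProduct k V W) =
      (TensorProduct.tmul k x (lin f y) : TensorProduct k V W') := rfl
lemma lin_associator (x : V) (y : W) (z : U) :
    lin (α_ V W U).hom (TensorProduct.tmul k (TensorProduct.tmul k x y : TensorProduct k V W) z :
      TensorProduct k (TensorProduct k V W) U) =
      (TensorProduct.tmul k x (TensorProduct.tmul k y z) :
        TensorProduct k V (TensorProduct k W U)) := rfl
lemma lin_leftUnitor (r : k) (x : V) :
    lin (λ_ V).hom (TensorProduct.tmul k r x : TensorProduct k k V) = r • x := rfl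
lemma lin_rightUnitor (r : k) (x : V) :
    lin (ρ_ V).hom (TensorProduct.tmul k x r : TensorProduct k V k) = r • x := rfl
lemma ρ_unit (g : G) (r : k) : (𝟙_ (FDRep k G)).ρ g r = r := rfl

end RepLin

open RepLin Functor.LaxMonoidal Functor.OplaxMonoidal

variable {C : Type uC} [Category.{v} C] [Preadditive C] [Linear k C] [MonoidalCategory C]
  [HasFiniteBiproducts C]

variable (C) in
/-- The object `V ⊗ 𝟙` of `C` underlying the image of a representation `V`. -/
abbrev vecUnit (V : FDRep k G) : C := tensorVec k V (𝟙_ C)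

variable (C) in
/-- The morphisms `v ⊗ - : 𝟙 ⟶ V ⊗ 𝟙`. -/
abbrev vecUnitCopower (V : FDRep k G) : Copower k V (𝟙_ C) (vecUnit C V) :=
  tensorVecCopower k V (𝟙_ C)

/-- The morphism `v ⊗ -`, for `v ∈ V`. -/
abbrev vecIns (V : FDRep k G) (x : V) : 𝟙_ C ⟶ vecUnit C V := (vecUnitCopower C V).ins x

/-- The `G`-equivariant structure `ρ^g (V ⊗ 𝟙) = V ⊗ ρ^g 𝟙 ≅ V ⊗ 𝟙` given by `π(g)`: it sends
`ρ^g (v ⊗ -)` to `π(g) v ⊗ -`. -/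
def vecAct (A : TensorAction k G C) (V : FDRep k G) (g : G) :
    (A.ρ g).obj (vecUnit C V) ≅ vecUnit C V where
  hom := ((vecUnitCopower C V).map (A.ρ g)).desc
    (Linear.leftComp k _ (η (A.ρ g)) ∘ₗ (vecUnitCopower C V).ins ∘ₗ V.ρ g)
  inv := (vecUnitCopower C V).desc
    (Linear.leftComp k _ (ε (A.ρ g)) ∘ₗ ((vecUnitCopower C V).map (A.ρ g)).ins ∘ₗ V.ρ g⁻¹)
  hom_inv_id := by
    refine ((vecUnitCopower C V).map (A.ρ g)).hom_ext fun x => ?_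
    rw [Copower.ins_desc_assoc]
    simp only [LinearMap.comp_apply, Linear.leftComp_apply, Category.assoc, Copower.ins_desc]
    simp [← Module.End.mul_apply, ← map_mul]
  inv_hom_id := by
    refine (vecUnitCopower C V).hom_ext fun x => ?_
    rw [Copower.ins_desc_assoc]
    simp only [LinearMap.comp_apply, Linear.leftComp_apply, Category.assoc, Copower.ins_desc]
    simp [← Module.End.mul_apply, ← map_mul]

lemma vecIns_act (A : TensorAction k G C) (V : FDRep k G) (g : G) (x : V) :
    (A.ρ g).map (vecIns V x) ≫ (vecAct A V g).hom = η (A.ρ g) ≫ vecIns V (V.ρ g x) :=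
  ((vecUnitCopower C V).map (A.ρ g)).ins_desc _ x

lemma vecIns_act_assoc (A : TensorAction k G C) (V : FDRep k G) (g : G) (x : V) {Z : C}
    (h : vecUnit C V ⟶ Z) :
    (A.ρ g).map (vecIns V x) ≫ (vecAct A V g).hom ≫ h =
      η (A.ρ g) ≫ vecIns V (V.ρ g x) ≫ h := by
  rw [← Category.assoc, vecIns_act, Category.assoc]

/-- The equivariant object `(V ⊗ 𝟙, π(g) ⊗ id)` attached to a representation `(V, π)`. -/
@[simps]
def embedObj (A : TensorAction k G C) (V : FDRep k G) : Equivariantization A where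
  X := vecUnit C V
  act := vecAct A V
  mul g h := by
    refine (((vecUnitCopower C V).map (A.ρ h)).map (A.ρ g)).hom_ext fun x => ?_
    have hη : (A.ρ g).map (η (A.ρ h)) ≫ η (A.ρ g) =
        (A.ρ₂ g h).hom.app (𝟙_ C) ≫ η (A.ρ (g * h)) :=
      (Equivariantization.tensorUnit A).mul g h
    have hn := (A.ρ₂ g h).hom.naturality (vecIns (C := C) V x)
    simp only [Copower.map_ins]
    rw [← Functor.map_comp_assoc, vecIns_act, Functor.map_comp, Category.assoc, vecIns_act,
      reassoc_of% hη]
    rw [← Category.assoc ((A.ρ g).map _)]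
    erw [hn]
    rw [Category.assoc, vecIns_act, map_mul]
    rfl
  unit := by
    refine (vecUnitCopower C V).hom_ext fun x => ?_
    have hn := A.ρ₀.hom.naturality (vecIns (C := C) V x)
    have hη : A.ρ₀.hom.app (𝟙_ C) ≫ η (A.ρ 1) = 𝟙 (𝟙_ C) :=
      (Equivariantization.tensorUnit A).unit
    rw [← Category.assoc]
    erw [hn]
    rw [Category.assoc, vecIns_act, reassoc_of% hη, map_one, Category.comp_id]
    rfl

/-- The underlying morphism `f ⊗ 𝟙` of the image of a morphism of representations. -/
def vecMap {V W : FDRep k G} (f : V ⟶ W) : vecUnit C V ⟶ vecUnit C W :=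
  (vecUnitCopower C V).desc ((vecUnitCopower C W).ins ∘ₗ lin f)

@[simp]
lemma vecIns_map {V W : FDRep k G} (f : V ⟶ W) (x : V) :
    vecIns V x ≫ vecMap f = vecIns (C := C) W (lin f x) :=
  (vecUnitCopower C V).ins_desc _ x

@[simp]
lemma vecIns_map_assoc {V W : FDRep k G} (f : V ⟶ W) (x : V) {Z : C} (h : vecUnit C W ⟶ Z) :
    vecIns V x ≫ vecMap f ≫ h = vecIns (C := C) W (lin f x) ≫ h := by
  rw [← Category.assoc, vecIns_map]

lemma vecMap_id (V : FDRep k G) : vecMap (𝟙 V) = 𝟙 (vecUnit C V) := by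
  refine (vecUnitCopower C V).hom_ext fun x => ?_
  rw [vecIns_map, lin_id, Category.comp_id]

lemma vecMap_add {V W : FDRep k G} (f g : V ⟶ W) :
    vecMap (C := C) (f + g) = vecMap f + vecMap g := by
  refine (vecUnitCopower C V).hom_ext fun x => ?_
  rw [Preadditive.comp_add, vecIns_map, vecIns_map, vecIns_map, lin_add]
  exact LinearMap.map_add (vecUnitCopower C W).ins _ _

lemma vecMap_smul {V W : FDRep k G} (r : k) (f : V ⟶ W) :
    vecMap (C := C) (r • f) = r • vecMap f := by
  refine (vecUnitCopower C V).hom_ext fun x => ?_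
  rw [Linear.comp_smul, vecIns_map, vecIns_map, lin_smul]
  exact LinearMap.map_smul (vecUnitCopower C W).ins _ _

/-- The embedding `rep G ⥤ C^G`, `(V, π) ↦ (V ⊗ 𝟙, π(g) ⊗ id)`. -/
@[simps]
def embed (A : TensorAction k G C) : FDRep k G ⥤ Equivariantization A where
  obj := embedObj A
  map {V W} f :=
    { hom := vecMap f
      comm := fun g => by
        refine ((vecUnitCopower C V).map (A.ρ g)).hom_ext fun x => ?_
        change (A.ρ g).map (vecIns V x) ≫ (vecAct A V g).hom ≫ vecMap f =
          (A.ρ g).map (vecIns V x) ≫ (A.ρ g).map (vecMap f) ≫ (vecAct A W g).hom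
        rw [vecIns_act_assoc, vecIns_map, ← Functor.map_comp_assoc, vecIns_map, vecIns_act,
          lin_comm] }
  map_id V := Equivariantization.hom_ext <| (vecUnitCopower C V).hom_ext fun x => by
    change vecIns V x ≫ vecMap (𝟙 V) = vecIns V x ≫ 𝟙 _
    rw [vecIns_map, lin_id, Category.comp_id]
  map_comp {V W U} f g := Equivariantization.hom_ext <| (vecUnitCopower C V).hom_ext fun x => by
    change vecIns V x ≫ vecMap (f ≫ g) = vecIns V x ≫ vecMap f ≫ vecMap g
    rw [vecIns_map, vecIns_map_assoc, vecIns_map, lin_comp]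

variable [MonoidalPreadditive C] [MonoidalLinear k C]

section Ext

variable {U V W : FDRep k G} {Z : C}

lemma ext_tensor {f g : vecUnit C V ⊗ vecUnit C W ⟶ Z}
    (h : ∀ (x : V) (y : W), (vecIns V x ⊗ₘ vecIns W y) ≫ f = (vecIns V x ⊗ₘ vecIns W y) ≫ g) :
    f = g := by
  refine ((vecUnitCopower C V).map (tensorRight (vecUnit C W))).hom_ext fun x => ?_
  refine ((vecUnitCopower C W).map (tensorLeft (𝟙_ C))).hom_ext fun y => ?_
  have := h x y
  rw [MonoidalCategory.tensorHom_def', Category.assoc, Category.assoc] at this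
  exact this

lemma ext_tensor₃ {f g : (vecUnit C U ⊗ vecUnit C V) ⊗ vecUnit C W ⟶ Z}
    (h : ∀ (x : U) (y : V) (z : W), ((vecIns U x ⊗ₘ vecIns V y) ⊗ₘ vecIns W z) ≫ f =
      ((vecIns U x ⊗ₘ vecIns V y) ⊗ₘ vecIns W z) ≫ g) :
    f = g := by
  refine (((vecUnitCopower C U).map (tensorRight (vecUnit C V))).map
    (tensorRight (vecUnit C W))).hom_ext fun x => ?_
  refine (((vecUnitCopower C V).map (tensorLeft (𝟙_ C))).map
    (tensorRight (vecUnit C W))).hom_ext fun y => ?_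
  refine ((vecUnitCopower C W).map (tensorLeft (𝟙_ C ⊗ 𝟙_ C))).hom_ext fun z => ?_
  have := h x y z
  rw [MonoidalCategory.tensorHom_def' (vecIns U x ⊗ₘ vecIns V y),
    MonoidalCategory.tensorHom_def' (vecIns U x), comp_whiskerRight] at this
  simp only [Category.assoc] at this
  exact this

end Ext

/-- The morphism `(V ⊗ 𝟙) ⊗ (W ⊗ 𝟙) ⟶ (V ⊗ W) ⊗ 𝟙` sending `(v ⊗ -) ⊗ (w ⊗ -)` to
`(v ⊗ w) ⊗ -`. -/
def vecTensorHom (V W : FDRep k G) : vecUnit C V ⊗ vecUnit C W ⟶ vecUnit C (V ⊗ W) :=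
  ∑ i, ∑ j, ((vecUnitCopower C V).proj i ⊗ₘ (vecUnitCopower C W).proj j) ≫ (λ_ (𝟙_ C)).hom ≫
    vecIns (V ⊗ W) (TensorProduct.tmul k (Module.finBasis k V i) (Module.finBasis k W j) :
      TensorProduct k V W)

lemma vecIns_tensor (V W : FDRep k G) (x : V) (y : W) :
    (vecIns V x ⊗ₘ vecIns W y) ≫ vecTensorHom (C := C) V W =
      (λ_ (𝟙_ C)).hom ≫ vecIns (V ⊗ W) (TensorProduct.tmul k x y : TensorProduct k V W) := by
  have h : ∀ i j, (vecIns V x ⊗ₘ vecIns W y) ≫ ((vecUnitCopower C V).proj i ⊗ₘ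
      (vecUnitCopower C W).proj j) ≫ (λ_ (𝟙_ C)).hom ≫
      vecIns (V ⊗ W) (TensorProduct.tmul k (Module.finBasis k V i) (Module.finBasis k W j) :
        TensorProduct k V W) =
      (λ_ (𝟙_ C)).hom ≫ (vecUnitCopower C (V ⊗ W)).ins
        (TensorProduct.tmul k ((Module.finBasis k V).repr x i • Module.finBasis k V i)
          ((Module.finBasis k W).repr y j • Module.finBasis k W j) :
        TensorProduct k V W) := by
    intro i j
    rw [tensorHom_comp_tensorHom_assoc, Copower.ins_proj', Copower.ins_proj',
      TensorProduct.smul_tmul_smul]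
    erw [map_smul (vecUnitCopower C (V ⊗ W)).ins]
    rw [MonoidalCategory.tensorHom_def, MonoidalLinear.smul_whiskerRight,
      MonoidalLinear.whiskerLeft_smul]
    simp [smul_smul, mul_comm]
  simp_rw [vecTensorHom, Preadditive.comp_sum, h]
  simp_rw [← Preadditive.comp_sum, ← map_sum]
  congr 2
  conv_rhs => rw [← (Module.finBasis k V).sum_repr x, ← (Module.finBasis k W).sum_repr y]
  rw [TensorProduct.sum_tmul]
  simp_rw [TensorProduct.tmul_sum]

lemma vecIns_tensor_assoc (V W : FDRep k G) (x : V) (y : W) {Z : C}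
    (h : vecUnit C (V ⊗ W) ⟶ Z) :
    (vecIns V x ⊗ₘ vecIns W y) ≫ vecTensorHom (C := C) V W ≫ h =
      (λ_ (𝟙_ C)).hom ≫ vecIns (V ⊗ W) (TensorProduct.tmul k x y : TensorProduct k V W) ≫ h := by
  rw [← Category.assoc, vecIns_tensor, Category.assoc]

/-- The isomorphism `(V ⊗ 𝟙) ⊗ (W ⊗ 𝟙) ≅ (V ⊗ W) ⊗ 𝟙`. -/
@[simps hom]
def vecTensor (V W : FDRep k G) : vecUnit C V ⊗ vecUnit C W ≅ vecUnit C (V ⊗ W) where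
  hom := vecTensorHom V W
  inv := (vecUnitCopower C (V ⊗ W)).desc (TensorProduct.lift (LinearMap.mk₂ k
    (fun (x : V) (y : W) => (λ_ (𝟙_ C)).inv ≫ (vecIns V x ⊗ₘ vecIns W y))
    (fun x x' y => by simp [MonoidalPreadditive.add_tensor])
    (fun r x y => by simp [MonoidalCategory.tensorHom_def])
    (fun x y y' => by simp [MonoidalPreadditive.tensor_add])
    (fun r x y => by simp [MonoidalCategory.tensorHom_def])))
  hom_inv_id := by
    refine ext_tensor fun x y => ?_
    rw [vecIns_tensor_assoc]
    refine (congrArg ((λ_ (𝟙_ C)).hom ≫ ·) ((vecUnitCopower C (V ⊗ W)).ins_desc _ _)).trans ?_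
    refine (congrArg ((λ_ (𝟙_ C)).hom ≫ ·) (TensorProduct.lift.tmul _ _)).trans ?_
    simp
  inv_hom_id := by
    refine (vecUnitCopower C (V ⊗ W)).hom_ext fun z => ?_
    rw [Copower.ins_desc_assoc, Category.comp_id]
    refine TensorProduct.induction_on (R := k) (M := V) (N := W)
      (motive := fun z => TensorProduct.lift _ z ≫ vecTensorHom V W =
        (vecUnitCopower C (V ⊗ W)).ins z) z ?_ (fun x y => ?_) fun z z' h h' => ?_
    · rw [map_zero, zero_comp]
      exact (map_zero (vecUnitCopower C (V ⊗ W)).ins).symm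
    · refine (congrArg (· ≫ vecTensorHom V W) (TensorProduct.lift.tmul _ _)).trans ?_
      simp [vecIns_tensor]
    · rw [map_add, Preadditive.add_comp, h, h']
      exact (map_add (vecUnitCopower C (V ⊗ W)).ins z z').symm

/-- The isomorphism `𝟙 ≅ k ⊗ 𝟙`. -/
@[simps hom]
def vecUnitIso : 𝟙_ C ≅ vecUnit C (𝟙_ (FDRep k G)) where
  hom := vecIns (𝟙_ (FDRep k G)) (1 : k)
  inv := (vecUnitCopower C (𝟙_ (FDRep k G))).desc (LinearMap.toSpanSingleton k _ (𝟙 (𝟙_ C)))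
  hom_inv_id := by
    refine ((vecUnitCopower C (𝟙_ (FDRep k G))).ins_desc _ (1 : k)).trans ?_
    exact one_smul k _
  inv_hom_id := by
    refine (vecUnitCopower C (𝟙_ (FDRep k G))).hom_ext fun r => ?_
    rw [Copower.ins_desc_assoc, Category.comp_id]
    change (r • 𝟙 (𝟙_ C)) ≫ (vecUnitCopower C (𝟙_ (FDRep k G))).ins (1 : k) = _
    rw [Linear.smul_comp, Category.id_comp]
    refine ((vecUnitCopower C (𝟙_ (FDRep k G))).ins.map_smul r (1 : k)).symm.trans ?_
    exact congrArg _ (mul_one (r : k))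

lemma ext_map_tensor {V W : FDRep k G} {Z : C} (F : C ⥤ C) [F.Additive] [F.Linear k]
    {f g : F.obj (vecUnit C V ⊗ vecUnit C W) ⟶ Z}
    (h : ∀ (x : V) (y : W), F.map (vecIns V x ⊗ₘ vecIns W y) ≫ f =
      F.map (vecIns V x ⊗ₘ vecIns W y) ≫ g) : f = g := by
  refine (((vecUnitCopower C V).map (tensorRight (vecUnit C W))).map F).hom_ext fun x => ?_
  refine (((vecUnitCopower C W).map (tensorLeft (𝟙_ C))).map F).hom_ext fun y => ?_
  have := h x y
  rw [MonoidalCategory.tensorHom_def', Functor.map_comp, Category.assoc, Category.assoc] at this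
  exact this

/-- The isomorphism `(V ⊗ 𝟙) ⊗ (W ⊗ 𝟙) ≅ (V ⊗ W) ⊗ 𝟙` in `C^G`. -/
def embedTensor (A : TensorAction k G C) (V W : FDRep k G) :
    embedObj A V ⊗ embedObj A W ≅ embedObj A (V ⊗ W) :=
  Equivariantization.isoMk (vecTensor V W) fun g => by
    refine ext_map_tensor (A.ρ g) fun x y => ?_
    have hη : (δ (A.ρ g) (𝟙_ C) (𝟙_ C) ≫ (η (A.ρ g) ⊗ₘ η (A.ρ g))) ≫ (λ_ (𝟙_ C)).hom =
        (A.ρ g).map (λ_ (𝟙_ C)).hom ≫ η (A.ρ g) :=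
      (λ_ (Equivariantization.tensorUnit A)).hom.comm g
    change (A.ρ g).map (vecIns V x ⊗ₘ vecIns W y) ≫ (δ (A.ρ g) (vecUnit C V) (vecUnit C W) ≫
        ((vecAct A V g).hom ⊗ₘ (vecAct A W g).hom)) ≫ vecTensorHom V W =
      (A.ρ g).map (vecIns V x ⊗ₘ vecIns W y) ≫ (A.ρ g).map (vecTensorHom V W) ≫
        (vecAct A (V ⊗ W) g).hom
    rw [← Functor.map_comp_assoc, vecIns_tensor, Functor.map_comp]
    simp only [Category.assoc] at hη ⊢
    rw [vecIns_act, ← reassoc_of% hη, ← Functor.OplaxMonoidal.δ_natural_assoc,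
      tensorHom_comp_tensorHom_assoc, vecIns_act, vecIns_act, ← tensorHom_comp_tensorHom_assoc,
      vecIns_tensor]
    rfl

/-- The isomorphism `𝟙 ≅ k ⊗ 𝟙` in `C^G`. -/
def embedUnit (A : TensorAction k G C) :
    𝟙_ (Equivariantization A) ≅ embedObj A (𝟙_ (FDRep k G)) :=
  Equivariantization.isoMk vecUnitIso fun g => by
    change η (A.ρ g) ≫ vecIns (𝟙_ (FDRep k G)) (1 : k) =
      (A.ρ g).map (vecIns (𝟙_ (FDRep k G)) (1 : k)) ≫ (vecAct A (𝟙_ (FDRep k G)) g).hom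
    rw [vecIns_act]
    rfl

lemma vecTensorHom_natural {V V' W W' : FDRep k G} (f : V ⟶ V') (g : W ⟶ W') :
    (vecMap f ⊗ₘ vecMap g) ≫ vecTensorHom (C := C) V' W' =
      vecTensorHom V W ≫ vecMap (f ⊗ₘ g) := by
  refine ext_tensor fun x y => ?_
  rw [tensorHom_comp_tensorHom_assoc, vecIns_map, vecIns_map, vecIns_tensor, vecIns_tensor_assoc,
    vecIns_map, MonoidalCategory.tensorHom_def, lin_comp, lin_whiskerRight, lin_whiskerLeft]

lemma vecTensorHom_assoc (U V W : FDRep k G) :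
    vecTensorHom U V ▷ vecUnit C W ≫ vecTensorHom (U ⊗ V) W ≫ vecMap (α_ U V W).hom =
      (α_ _ _ _).hom ≫ vecUnit C U ◁ vecTensorHom V W ≫ vecTensorHom U (V ⊗ W) := by
  refine ext_tensor₃ fun x y z => ?_
  rw [associator_naturality_assoc, ← tensorHom_id, ← id_tensorHom,
    tensorHom_comp_tensorHom_assoc, tensorHom_comp_tensorHom_assoc, vecIns_tensor, vecIns_tensor,
    Category.comp_id, Category.comp_id]
  have h1 : ((λ_ (𝟙_ C)).hom ≫ vecIns (U ⊗ V) (TensorProduct.tmul k x y : TensorProduct k U V))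
      ⊗ₘ vecIns (C := C) W z = (λ_ (𝟙_ C)).hom ▷ 𝟙_ C ≫
        (vecIns (U ⊗ V) (TensorProduct.tmul k x y : TensorProduct k U V) ⊗ₘ vecIns W z) := by
    rw [← tensorHom_id, tensorHom_comp_tensorHom, Category.id_comp]
  have h2 : vecIns (C := C) U x ⊗ₘ
      ((λ_ (𝟙_ C)).hom ≫ vecIns (V ⊗ W) (TensorProduct.tmul k y z : TensorProduct k V W)) =
      𝟙_ C ◁ (λ_ (𝟙_ C)).hom ≫
        (vecIns U x ⊗ₘ vecIns (V ⊗ W) (TensorProduct.tmul k y z : TensorProduct k V W)) := by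
    rw [← id_tensorHom, tensorHom_comp_tensorHom, Category.id_comp]
  rw [h1, h2, Category.assoc, Category.assoc, vecIns_tensor_assoc, vecIns_tensor, vecIns_map]
  rw [show lin (α_ U V W).hom _ = _ from lin_associator x y z]
  simp only [← Category.assoc]
  congr 2
  monoidal

lemma vecTensorHom_left_unit (V : FDRep k G) :
    (λ_ (vecUnit C V)).hom = vecIns (𝟙_ (FDRep k G)) (1 : k) ▷ vecUnit C V ≫
      vecTensorHom (𝟙_ (FDRep k G)) V ≫ vecMap (λ_ V).hom := by
  refine ((vecUnitCopower C V).map (tensorLeft (𝟙_ C))).hom_ext fun x => ?_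
  change 𝟙_ C ◁ vecIns V x ≫ (λ_ (vecUnit C V)).hom = 𝟙_ C ◁ vecIns V x ≫ _
  rw [← Category.assoc (𝟙_ C ◁ vecIns V x), ← MonoidalCategory.tensorHom_def',
    vecIns_tensor_assoc, vecIns_map, leftUnitor_naturality]
  rw [show lin (λ_ V).hom _ = _ from lin_leftUnitor 1 x, one_smul]

lemma vecTensorHom_right_unit (V : FDRep k G) :
    (ρ_ (vecUnit C V)).hom = vecUnit C V ◁ vecIns (𝟙_ (FDRep k G)) (1 : k) ≫
      vecTensorHom V (𝟙_ (FDRep k G)) ≫ vecMap (ρ_ V).hom := by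
  refine ((vecUnitCopower C V).map (tensorRight (𝟙_ C))).hom_ext fun x => ?_
  change vecIns V x ▷ 𝟙_ C ≫ (ρ_ (vecUnit C V)).hom = vecIns V x ▷ 𝟙_ C ≫ _
  rw [← Category.assoc (vecIns V x ▷ 𝟙_ C), ← MonoidalCategory.tensorHom_def,
    vecIns_tensor_assoc, vecIns_map, rightUnitor_naturality]
  rw [show lin (ρ_ V).hom _ = _ from lin_rightUnitor 1 x, one_smul, unitors_equal]

/-- The monoidal structure of the embedding `rep G ⥤ C^G`. -/
instance embedMonoidal (A : TensorAction k G C) : (embed A).Monoidal :=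
  Functor.CoreMonoidal.toMonoidal
    { εIso := embedUnit A
      μIso := embedTensor A
      μIso_hom_natural_left := fun {V V'} f W => Equivariantization.hom_ext <| by
        have h := vecTensorHom_natural (C := C) f (𝟙 W)
        rw [vecMap_id, tensorHom_id f W] at h
        exact h
      μIso_hom_natural_right := fun {W W'} V f => Equivariantization.hom_ext <| by
        have h := vecTensorHom_natural (C := C) (𝟙 V) f
        rw [vecMap_id, id_tensorHom V f] at h
        exact h
      associativity := fun U V W => Equivariantization.hom_ext <| by
        have h := vecTensorHom_assoc (C := C) U V W
        rw [← tensorHom_id, ← id_tensorHom] at h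
        exact h
      left_unitality := fun V => Equivariantization.hom_ext <| by
        have h := vecTensorHom_left_unit (C := C) V
        rw [← tensorHom_id] at h
        exact h
      right_unitality := fun V => Equivariantization.hom_ext <| by
        have h := vecTensorHom_right_unit (C := C) V
        rw [← id_tensorHom] at h
        exact h }

instance embedAdditive (A : TensorAction k G C) : (embed A).Additive where
  map_add := Equivariantization.hom_ext (vecMap_add _ _)

instance embedLinear (A : TensorAction k G C) : (embed A).Linear k where
  map_smul f r := Equivariantization.hom_ext (vecMap_smul r f)

end Embedding

/-! ### Bimodule categories from monoidal functors -/

section OfFunctor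

open Functor.LaxMonoidal Functor.OplaxMonoidal Functor.Monoidal

variable {A : Type*} [Category* A] [MonoidalCategory A] {D : Type*} [Category* D]
  [MonoidalCategory D] (F : A ⥤ D) [F.Monoidal]

/-- The left action `a ⊙ d = F a ⊗ d` given by a monoidal functor `F`. -/
@[reducible]
def leftActionOfFunctor : MonoidalLeftAction A D where
  actionObj a d := F.obj a ⊗ d
  actionHomLeft f d := F.map f ▷ d
  actionHomRight a _ _ f := F.obj a ◁ f
  actionHom f g := F.map f ⊗ₘ g
  actionAssocIso a b d := whiskerRightIso (μIso F a b).symm d ≪≫ α_ _ _ _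
  actionUnitIso d := whiskerRightIso (εIso F).symm d ≪≫ λ_ d
  actionHom_def _ _ := MonoidalCategory.tensorHom_def _ _
  actionHomRight_id _ _ := by simp
  id_actionHomLeft _ _ := by simp
  actionHom_comp _ _ _ _ := by simp
  actionAssocIso_hom_naturality {c c' c'' c''' d d'} f g h := by
    change (F.map (f ⊗ₘ g) ⊗ₘ h) ≫ δ F c' c''' ▷ d' ≫ (α_ _ _ _).hom =
      (δ F c c'' ▷ d ≫ (α_ _ _ _).hom) ≫ (F.map f ⊗ₘ (F.map g ⊗ₘ h))
    rw [Category.assoc, ← associator_naturality, ← tensorHom_id, ← tensorHom_id,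
      tensorHom_comp_tensorHom_assoc, tensorHom_comp_tensorHom_assoc, δ_natural, Category.comp_id,
      Category.id_comp]
  actionUnitIso_hom_naturality {d d'} f := by
    change (η F ▷ d ≫ (λ_ d).hom) ≫ f = F.obj (𝟙_ A) ◁ f ≫ η F ▷ d' ≫ (λ_ d').hom
    rw [whisker_exchange_assoc, Category.assoc, leftUnitor_naturality]
  whiskerLeft_actionHomLeft c {c' c''} f d := by
    change F.map (c ◁ f) ▷ d = (δ F c c' ▷ d ≫ (α_ _ _ _).hom) ≫ F.obj c ◁ F.map f ▷ d ≫
      (α_ _ _ _).inv ≫ μ F c c'' ▷ d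
    rw [Functor.Monoidal.map_whiskerLeft]
    simp only [MonoidalCategory.whiskerLeft_comp, comp_whiskerRight, Category.assoc,
      whisker_assoc]
  whiskerRight_actionHomLeft {c c'} c'' f d := by
    change F.map (f ▷ c'') ▷ d = (δ F c c'' ▷ d ≫ (α_ _ _ _).hom) ≫ F.map f ▷ (F.obj c'' ⊗ d) ≫
      (α_ _ _ _).inv ≫ μ F c' c'' ▷ d
    rw [Functor.Monoidal.map_whiskerRight]
    simp only [MonoidalCategory.whiskerLeft_comp, comp_whiskerRight, Category.assoc,
      whiskerRight_tensor, Iso.hom_inv_id_assoc, Iso.inv_hom_id_assoc]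
  associator_actionHom a b c d := by
    change F.map (α_ a b c).hom ▷ d ≫ (δ F a (b ⊗ c) ▷ d ≫ (α_ _ _ _).hom) ≫
      F.obj a ◁ (δ F b c ▷ d ≫ (α_ _ _ _).hom) =
      (δ F (a ⊗ b) c ▷ d ≫ (α_ _ _ _).hom) ≫ δ F a b ▷ (F.obj c ⊗ d) ≫ (α_ _ _ _).hom
    have h := congrArg (fun t => t ▷ d) (Functor.OplaxMonoidal.associativity (F := F) a b c)
    simp only [comp_whiskerRight] at h
    simp only [Category.assoc, MonoidalCategory.whiskerLeft_comp, whiskerRight_tensor]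
    rw [← pentagon, ← associator_naturality_middle_assoc, ← reassoc_of% h]
    simp
  leftUnitor_actionHom c d := by
    change F.map (λ_ c).hom ▷ d = (δ F (𝟙_ A) c ▷ d ≫ (α_ _ _ _).hom) ≫ η F ▷ (F.obj c ⊗ d) ≫
      (λ_ _).hom
    rw [Functor.Monoidal.map_leftUnitor]
    simp only [MonoidalCategory.whiskerLeft_comp, comp_whiskerRight, Category.assoc,
      leftUnitor_whiskerRight, whiskerRight_tensor, Iso.hom_inv_id_assoc, Iso.inv_hom_id_assoc]
  rightUnitor_actionHom c d := by
    change F.map (ρ_ c).hom ▷ d = (δ F c (𝟙_ A) ▷ d ≫ (α_ _ _ _).hom) ≫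
      F.obj c ◁ (η F ▷ d ≫ (λ_ _).hom)
    rw [Functor.Monoidal.map_rightUnitor]
    simp only [MonoidalCategory.whiskerLeft_comp, comp_whiskerRight, Category.assoc,
      whisker_assoc, ← triangle, Iso.hom_inv_id_assoc, Iso.inv_hom_id_assoc]

/-- The right action `d ⊙ a = d ⊗ F a` given by a monoidal functor `F`. -/
@[reducible]
def rightActionOfFunctor : MonoidalRightAction A D where
  actionObj d a := d ⊗ F.obj a
  actionHomLeft f a := f ▷ F.obj a
  actionHomRight d _ _ f := d ◁ F.map f
  actionHom f g := f ⊗ₘ F.map g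
  actionAssocIso d a b := whiskerLeftIso d (μIso F a b).symm ≪≫ (α_ _ _ _).symm
  actionUnitIso d := whiskerLeftIso d (εIso F).symm ≪≫ ρ_ d
  actionHom_def _ _ := MonoidalCategory.tensorHom_def _ _
  actionHomRight_id _ _ := by simp
  id_actionHomLeft _ _ := by simp
  actionHom_comp _ _ _ _ := by simp
  actionAssocIso_hom_naturality {c c' d₁ d₂ d₃ d₄} h f g := by
    change (h ⊗ₘ F.map (f ⊗ₘ g)) ≫ c' ◁ δ F d₂ d₄ ≫ (α_ _ _ _).inv =
      (c ◁ δ F d₁ d₃ ≫ (α_ _ _ _).inv) ≫ ((h ⊗ₘ F.map f) ⊗ₘ F.map g)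
    rw [Category.assoc, ← associator_inv_naturality, ← id_tensorHom, ← id_tensorHom,
      tensorHom_comp_tensorHom_assoc, tensorHom_comp_tensorHom_assoc, δ_natural, Category.comp_id,
      Category.id_comp]
  actionUnitIso_hom_naturality {d d'} f := by
    change (d ◁ η F ≫ (ρ_ d).hom) ≫ f = f ▷ F.obj (𝟙_ A) ≫ d' ◁ η F ≫ (ρ_ d').hom
    rw [← whisker_exchange_assoc, Category.assoc, rightUnitor_naturality]
  actionHomRight_whiskerRight {c c'} f c'' d := by
    change d ◁ F.map (f ▷ c'') = (d ◁ δ F c c'' ≫ (α_ _ _ _).inv) ≫ (d ◁ F.map f) ▷ F.obj c'' ≫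
      (α_ _ _ _).hom ≫ d ◁ μ F c' c''
    rw [Functor.Monoidal.map_whiskerRight]
    simp only [MonoidalCategory.whiskerLeft_comp, comp_whiskerRight, Category.assoc,
      whisker_assoc, Iso.hom_inv_id_assoc, Iso.inv_hom_id_assoc]
  whiskerRight_actionHomLeft c {c' c''} f d := by
    change d ◁ F.map (c ◁ f) = (d ◁ δ F c c' ≫ (α_ _ _ _).inv) ≫ (d ⊗ F.obj c) ◁ F.map f ≫
      (α_ _ _ _).hom ≫ d ◁ μ F c c''
    rw [Functor.Monoidal.map_whiskerLeft]
    simp only [MonoidalCategory.whiskerLeft_comp, comp_whiskerRight, Category.assoc,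
      tensor_whiskerLeft, Iso.hom_inv_id_assoc, Iso.inv_hom_id_assoc]
  actionHom_associator a b c d := by
    change d ◁ F.map (α_ a b c).hom ≫ (d ◁ δ F a (b ⊗ c) ≫ (α_ _ _ _).inv) ≫
      (d ⊗ F.obj a) ◁ δ F b c ≫ (α_ _ _ _).inv =
      (d ◁ δ F (a ⊗ b) c ≫ (α_ _ _ _).inv) ≫ (d ◁ δ F a b ≫ (α_ _ _ _).inv) ▷ F.obj c
    have h := congrArg (fun t => d ◁ t) (Functor.OplaxMonoidal.associativity (F := F) a b c)
    simp only [MonoidalCategory.whiskerLeft_comp] at h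
    simp only [Category.assoc, comp_whiskerRight, tensor_whiskerLeft]
    rw [Iso.inv_hom_id_assoc, ← reassoc_of% h]
    simp
  actionHom_leftUnitor c d := by
    change d ◁ F.map (λ_ c).hom = (d ◁ δ F (𝟙_ A) c ≫ (α_ _ _ _).inv) ≫
      (d ◁ η F ≫ (ρ_ _).hom) ▷ F.obj c
    rw [Functor.Monoidal.map_leftUnitor]
    simp only [MonoidalCategory.whiskerLeft_comp, comp_whiskerRight, Category.assoc,
      whisker_assoc, ← MonoidalCategory.triangle, Iso.inv_hom_id_assoc]
  actionHom_rightUnitor c d := by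
    change d ◁ F.map (ρ_ c).hom = (d ◁ δ F c (𝟙_ A) ≫ (α_ _ _ _).inv) ≫
      (d ⊗ F.obj c) ◁ η F ≫ (ρ_ _).hom
    rw [Functor.Monoidal.map_rightUnitor]
    simp only [MonoidalCategory.whiskerLeft_comp, comp_whiskerRight, Category.assoc,
      tensor_whiskerLeft, MonoidalCategory.whiskerLeft_rightUnitor, Iso.hom_inv_id_assoc, Iso.inv_hom_id_assoc]

/-- The bimodule category `(a, d, b) ↦ F a ⊗ d ⊗ F b` given by a `k`-linear monoidal functor `F`;
the middle associativity isomorphism is the associator. -/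
@[reducible]
def bimoduleOfFunctor (k : Type*) [Field k] [Preadditive A] [Linear k A] [Preadditive D]
    [Linear k D] [MonoidalPreadditive D] [MonoidalLinear k D] [F.Additive] [F.Linear k] :
    letI := leftActionOfFunctor F
    letI := rightActionOfFunctor F
    BimoduleCategory k A D :=
  letI := leftActionOfFunctor F
  letI := rightActionOfFunctor F
  { middle := fun a d b => α_ (F.obj a) d (F.obj b)
    middle_naturality := fun f h g => associator_naturality _ _ _
    pentagon_left := fun a a' m b => by
      change ((δ F a a' ▷ m) ≫ (α_ _ _ _).hom) ▷ F.obj b ≫ (α_ _ _ _).hom ≫ _ ◁ (α_ _ _ _).hom =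
        (α_ _ _ _).hom ≫ δ F a a' ▷ (m ⊗ F.obj b) ≫ (α_ _ _ _).hom
      simp
    pentagon_right := fun a m b b' => by
      change ((F.obj a ⊗ m) ◁ δ F b b' ≫ (α_ _ _ _).inv) ≫ (α_ _ _ _).hom ▷ F.obj b' ≫
        (α_ _ _ _).hom = (α_ _ _ _).hom ≫ F.obj a ◁ (m ◁ δ F b b' ≫ (α_ _ _ _).inv)
      simp
    triangle_left := fun m b => by
      change (α_ _ _ _).hom ≫ η F ▷ (m ⊗ F.obj b) ≫ (λ_ _).hom =
        (η F ▷ m ≫ (λ_ _).hom) ▷ F.obj b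
      simp
    triangle_right := fun a m => by
      change (α_ _ _ _).hom ≫ F.obj a ◁ (m ◁ η F ≫ (ρ_ _).hom) =
        (F.obj a ⊗ m) ◁ η F ≫ (ρ_ _).hom
      simp
    add_left := fun f f' m => by
      change F.map (f + f') ▷ m = F.map f ▷ m + F.map f' ▷ m
      simp
    smul_left := fun r f m => by
      change F.map (r • f) ▷ m = r • F.map f ▷ m
      simp
    left_add := fun a _ _ f f' => MonoidalPreadditive.whiskerLeft_add f f'
    left_smul := fun a _ _ r f => MonoidalLinear.whiskerLeft_smul _ r f
    add_right := fun f f' b => MonoidalPreadditive.add_whiskerRight f f'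
    smul_right := fun r f b => MonoidalLinear.smul_whiskerRight r f _
    right_add := fun m _ _ f f' => by
      change m ◁ F.map (f + f') = m ◁ F.map f + m ◁ F.map f'
      simp
    right_smul := fun m _ _ r f => by
      change m ◁ F.map (r • f) = r • m ◁ F.map f
      simp }

end OfFunctor

/-! ### `C^G` as a `rep G`-bimodule category -/

section EquivariantizationBimodule

variable {k : Type u} [Field k] {G : Type w} [Group G] {C : Type uC} [Category.{v} C]
  [Preadditive C] [Linear k C] [MonoidalCategory C] [HasFiniteBiproducts C]
  [MonoidalPreadditive C] [MonoidalLinear k C] (A : TensorAction k G C)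

/-- `rep G` acts on `C^G` on the left by tensor product with `V ⊗ 𝟙`. -/
instance Equivariantization.leftAction : MonoidalLeftAction (FDRep k G) (Equivariantization A) :=
  leftActionOfFunctor (embed A)

/-- `rep G` acts on `C^G` on the right by tensor product with `V ⊗ 𝟙`. -/
instance Equivariantization.rightAction :
    MonoidalRightAction (FDRep k G) (Equivariantization A) :=
  rightActionOfFunctor (embed A)

/-- The `rep G`-bimodule category `C^G`. -/
instance Equivariantization.bimodule :
    BimoduleCategory k (FDRep k G) (Equivariantization A) :=
  bimoduleOfFunctor (embed A) k

end EquivariantizationBimodule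

/-! ### Projective representations -/

section Projective

/-- A finite-dimensional `α`-projective representation `(V, π)` of a group `H`, for a function
`α : H × H → kˣ`: linear maps `π(g) : V → V` with `π(g) π(h) = α(g,h) π(gh)` and
`π(e) = α(e,e) id`. (The maps `π(g)` are then invertible. For invertible `π(e)` the second condition
follows from the first one, and it reads `π(e) = id` if `α` is normalized.)
Recall that `f ≫ f'` is `f' ∘ f`. -/
structure ProjRep (k : Type u) [Field k] {H : Type w} [Group H] (α : H → H → kˣ) where
  /-- The underlying finite-dimensional vector space. -/
  V : FGModuleCat.{u} k
  /-- The operators `π(g)`. -/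
  π : H → (V ⟶ V)
  π_one : π 1 = (α 1 1 : k) • 𝟙 V
  π_mul : ∀ g h : H, π h ≫ π g = (α g h : k) • π (g * h)

namespace ProjRep

variable {k : Type u} [Field k]

section Basic

variable {H : Type w} [Group H] {α : H → H → kˣ}

/-- A morphism of projective representations: a linear map `f` with `f π(g) = π'(g) f`. -/
@[ext]
structure Hom (M N : ProjRep k α) where
  hom : M.V ⟶ N.V
  comm : ∀ g : H, M.π g ≫ hom = hom ≫ N.π g

@[simps]
instance category : Category (ProjRep k α) where
  Hom := Hom
  id M := ⟨𝟙 M.V, by simp⟩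
  comp f g := ⟨f.hom ≫ g.hom, fun a => by
    rw [← Category.assoc, f.comm, Category.assoc, g.comm, Category.assoc]⟩

@[ext]
lemma hom_ext {M N : ProjRep k α} {f g : M ⟶ N} (h : f.hom = g.hom) : f = g := Hom.ext h

/-- Isomorphisms of projective representations. -/
@[simps]
def isoMk {M N : ProjRep k α} (e : M.V ≅ N.V) (h : ∀ g : H, M.π g ≫ e.hom = e.hom ≫ N.π g) :
    M ≅ N where
  hom := ⟨e.hom, h⟩
  inv := ⟨e.inv, fun g => by
    rw [← cancel_mono e.hom, Category.assoc, Category.assoc, h, e.inv_hom_id, Category.comp_id,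
      e.inv_hom_id_assoc]⟩
  hom_inv_id := hom_ext e.hom_inv_id
  inv_hom_id := hom_ext e.inv_hom_id

section Linear

variable (M N : ProjRep k α)

instance : Zero (M ⟶ N) := ⟨⟨0, by simp⟩⟩
instance : Add (M ⟶ N) := ⟨fun f g => ⟨f.hom + g.hom, fun a => by simp [f.comm, g.comm]⟩⟩
instance : Neg (M ⟶ N) := ⟨fun f => ⟨-f.hom, fun a => by simp [f.comm]⟩⟩
instance : Sub (M ⟶ N) := ⟨fun f g => ⟨f.hom - g.hom, fun a => by simp [f.comm, g.comm]⟩⟩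
instance : SMul k (M ⟶ N) := ⟨fun r f => ⟨r • f.hom, fun a => by simp [f.comm]⟩⟩
instance : SMul ℕ (M ⟶ N) := ⟨fun r f => ⟨r • f.hom, fun a => by simp [f.comm]⟩⟩
instance : SMul ℤ (M ⟶ N) := ⟨fun r f => ⟨r • f.hom, fun a => by simp [f.comm]⟩⟩

lemma hom_injective : Function.Injective (fun f : M ⟶ N => f.hom) := fun _ _ h => hom_ext h

instance : AddCommGroup (M ⟶ N) :=
  (hom_injective M N).addCommGroup _ rfl (fun _ _ => rfl) (fun _ => rfl) (fun _ _ => rfl)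
    (fun _ _ => rfl) (fun _ _ => rfl)

instance : Module k (M ⟶ N) :=
  Function.Injective.module k
    { toFun := fun f : M ⟶ N => f.hom, map_zero' := rfl, map_add' := fun _ _ => rfl }
    (hom_injective M N) (fun _ _ => rfl)

end Linear

instance preadditive : Preadditive (ProjRep k α) where
  add_comp _ _ _ _ _ _ := hom_ext (Preadditive.add_comp _ _ _ _ _ _)
  comp_add _ _ _ _ _ _ := hom_ext (Preadditive.comp_add _ _ _ _ _ _)

instance linear : Linear k (ProjRep k α) where
  smul_comp _ _ _ _ _ _ := hom_ext (Linear.smul_comp _ _ _ _ _ _)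
  comp_smul _ _ _ _ _ _ := hom_ext (Linear.comp_smul _ _ _ _ _ _)

end Basic

/-! #### The bimodule structure -/

section Coherence

variable {D : Type*} [Category* D] [MonoidalCategory D] (U V W X : D)

/-! Coherence identities, written with tensor products of morphisms only. -/

lemma coh_def {V W M N : D} (f : V ⟶ W) (g : M ⟶ N) :
    f ⊗ₘ g = (f ⊗ₘ 𝟙 M) ≫ (𝟙 W ⊗ₘ g) := by simp [MonoidalCategory.tensorHom_def]
lemma coh_left_unit {M N : D} (f : M ⟶ N) :
    (𝟙 (𝟙_ D) ⊗ₘ f) ≫ (λ_ N).hom = (λ_ M).hom ≫ f := by simp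
lemma coh_right_unit {M N : D} (f : M ⟶ N) :
    (f ⊗ₘ 𝟙 (𝟙_ D)) ≫ (ρ_ N).hom = (ρ_ M).hom ≫ f := by simp
lemma coh_wl {V W : D} (f : V ⟶ W) :
    (U ◁ f) ⊗ₘ 𝟙 X = (α_ _ _ _).hom ≫ (𝟙 U ⊗ₘ (f ⊗ₘ 𝟙 X)) ≫ (α_ _ _ _).inv := by simp
lemma coh_wr {V W : D} (f : V ⟶ W) :
    (f ▷ U) ⊗ₘ 𝟙 X = (α_ _ _ _).hom ≫ (f ⊗ₘ 𝟙 (U ⊗ X)) ≫ (α_ _ _ _).inv := by simp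
lemma coh_pent :
    ((α_ U V W).hom ⊗ₘ 𝟙 X) ≫ (α_ _ _ _).hom ≫ (𝟙 U ⊗ₘ (α_ _ _ _).hom) =
      (α_ _ _ _).hom ≫ (α_ _ _ _).hom := by simp
lemma coh_lu : (λ_ V).hom ⊗ₘ 𝟙 X = (α_ _ _ _).hom ≫ (λ_ (V ⊗ X)).hom := by simp
lemma coh_ru : (ρ_ V).hom ⊗ₘ 𝟙 X = (α_ _ _ _).hom ≫ (𝟙 V ⊗ₘ (λ_ X).hom) := by simp
lemma coh_wr' {V W : D} (f : V ⟶ W) :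
    𝟙 X ⊗ₘ (f ▷ U) = (α_ _ _ _).inv ≫ ((𝟙 X ⊗ₘ f) ⊗ₘ 𝟙 U) ≫ (α_ _ _ _).hom := by simp
lemma coh_wl' {V W : D} (f : V ⟶ W) :
    𝟙 X ⊗ₘ (U ◁ f) = (α_ _ _ _).inv ≫ (𝟙 (X ⊗ U) ⊗ₘ f) ≫ (α_ _ _ _).hom := by simp
lemma coh_pent' :
    (𝟙 X ⊗ₘ (α_ U V W).hom) ≫ (α_ _ _ _).inv ≫ (α_ _ _ _).inv =
      (α_ _ _ _).inv ≫ ((α_ _ _ _).inv ⊗ₘ 𝟙 W) := by simp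
lemma coh_lu' : 𝟙 X ⊗ₘ (λ_ V).hom = (α_ _ _ _).inv ≫ ((ρ_ X).hom ⊗ₘ 𝟙 V) := by simp
lemma coh_ru' : 𝟙 X ⊗ₘ (ρ_ V).hom = (α_ _ _ _).inv ≫ (ρ_ (X ⊗ V)).hom := by simp
lemma coh_mid_right :
    (α_ (U ⊗ X) V W).inv ≫ ((α_ U X V).hom ⊗ₘ 𝟙 W) ≫ (α_ _ _ _).hom =
      (α_ _ _ _).hom ≫ (𝟙 U ⊗ₘ (α_ _ _ _).inv) := by simp
lemma coh_mid_lu : (α_ _ _ _).hom ≫ (λ_ (X ⊗ V)).hom = (λ_ X).hom ⊗ₘ 𝟙 V := by simp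
lemma coh_mid_ru : (α_ _ _ _).hom ≫ (𝟙 V ⊗ₘ (ρ_ X).hom) = (ρ_ (V ⊗ X)).hom := by simp

variable [Preadditive D] [MonoidalPreadditive D] {k : Type*} [Field k] [Linear k D]
  [MonoidalLinear k D]

lemma coh_add_left {V W : D} (f f' : V ⟶ W) : (f + f') ⊗ₘ 𝟙 X = f ⊗ₘ 𝟙 X + f' ⊗ₘ 𝟙 X := by
  simp [MonoidalPreadditive.add_tensor]
lemma coh_smul_left {V W : D} (r : k) (f : V ⟶ W) : (r • f) ⊗ₘ 𝟙 X = r • (f ⊗ₘ 𝟙 X) := by simp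
lemma coh_add_right {V W : D} (f f' : V ⟶ W) : 𝟙 X ⊗ₘ (f + f') = 𝟙 X ⊗ₘ f + 𝟙 X ⊗ₘ f' := by
  simp [MonoidalPreadditive.tensor_add]
lemma coh_smul_right {V W : D} (r : k) (f : V ⟶ W) : 𝟙 X ⊗ₘ (r • f) = r • (𝟙 X ⊗ₘ f) := by simp

end Coherence

variable {G : Type w} [Group G] {H : Subgroup G} {α : H → H → kˣ}

/-- The tensor product `V ⊗ M` of a representation of `G`, restricted to the subgroup `H`, with a
projective representation of `H`; the operators are `π_V(g) ⊗ π_M(g)`. -/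
@[simps]
def tensorLeft (V : FDRep k G) (M : ProjRep k α) : ProjRep k α where
  V := V.V ⊗ M.V
  π g := Action.ρ V (g : G) ⊗ₘ M.π g
  π_one := by
    rw [M.π_one, OneMemClass.coe_one, map_one, MonoidalCategory.tensorHom_def,
      MonoidalLinear.whiskerLeft_smul]
    simp [End.one_def]
  π_mul g h := by
    rw [tensorHom_comp_tensorHom, M.π_mul, ← End.mul_def, ← map_mul, Subgroup.coe_mul,
      MonoidalCategory.tensorHom_def, MonoidalLinear.whiskerLeft_smul, Linear.comp_smul,
      ← MonoidalCategory.tensorHom_def]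

/-- The tensor product `M ⊗ V` of a projective representation of the subgroup `H` with a
representation of `G`, restricted to `H`; the operators are `π_M(g) ⊗ π_V(g)`. -/
@[simps]
def tensorRight (M : ProjRep k α) (V : FDRep k G) : ProjRep k α where
  V := M.V ⊗ V.V
  π g := M.π g ⊗ₘ Action.ρ V (g : G)
  π_one := by
    rw [M.π_one, OneMemClass.coe_one, map_one, MonoidalCategory.tensorHom_def,
      MonoidalLinear.smul_whiskerRight]
    simp [End.one_def]
  π_mul g h := by
    rw [tensorHom_comp_tensorHom, M.π_mul, ← End.mul_def, ← map_mul, Subgroup.coe_mul,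
      MonoidalCategory.tensorHom_def, MonoidalLinear.smul_whiskerRight, Linear.smul_comp,
      ← MonoidalCategory.tensorHom_def]

/-- Tensor product of morphisms. -/
@[simps]
def tensorHomLeft {V W : FDRep k G} (f : V ⟶ W) {M N : ProjRep k α} (h : M ⟶ N) :
    tensorLeft V M ⟶ tensorLeft W N where
  hom := f.hom ⊗ₘ h.hom
  comm g := by
    change (Action.ρ V (g : G) ⊗ₘ M.π g) ≫ (f.hom ⊗ₘ h.hom) =
      (f.hom ⊗ₘ h.hom) ≫ (Action.ρ W (g : G) ⊗ₘ N.π g)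
    rw [tensorHom_comp_tensorHom, tensorHom_comp_tensorHom, h.comm, f.comm]

/-- Tensor product of morphisms. -/
@[simps]
def tensorHomRight {M N : ProjRep k α} (h : M ⟶ N) {V W : FDRep k G} (f : V ⟶ W) :
    tensorRight M V ⟶ tensorRight N W where
  hom := h.hom ⊗ₘ f.hom
  comm g := by
    change (M.π g ⊗ₘ Action.ρ V (g : G)) ≫ (h.hom ⊗ₘ f.hom) =
      (h.hom ⊗ₘ f.hom) ≫ (N.π g ⊗ₘ Action.ρ W (g : G))
    rw [tensorHom_comp_tensorHom, tensorHom_comp_tensorHom, h.comm, f.comm]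

/-- `rep G` acts on the left on projective representations of a subgroup by tensor product; the
associativity and unit isomorphisms are those of vector spaces. -/
instance leftAction : MonoidalLeftAction (FDRep k G) (ProjRep k α) where
  actionObj V M := tensorLeft V M
  actionHomLeft f M := tensorHomLeft f (𝟙 M)
  actionHomRight V _ _ f := tensorHomLeft (𝟙 V) f
  actionHom f g := tensorHomLeft f g
  actionAssocIso V W M := isoMk (α_ V.V W.V M.V) fun g => associator_naturality _ _ _
  actionUnitIso M := isoMk (λ_ M.V) fun g => coh_left_unit (M.π g)
  actionHom_def f g := hom_ext (coh_def f.hom g.hom)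
  actionHomRight_id V M := hom_ext (id_tensorHom_id V.V M.V)
  id_actionHomLeft V M := hom_ext (id_tensorHom_id V.V M.V)
  actionHom_comp f g f' g' := hom_ext (tensorHom_comp_tensorHom f.hom f'.hom g.hom g'.hom).symm
  actionAssocIso_hom_naturality f g h := hom_ext (associator_naturality f.hom g.hom h.hom)
  actionUnitIso_hom_naturality f := hom_ext (coh_left_unit f.hom).symm
  whiskerLeft_actionHomLeft U _ _ f M := hom_ext (coh_wl U.V M.V f.hom)
  whiskerRight_actionHomLeft U f M := hom_ext (coh_wr U.V M.V f.hom)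
  associator_actionHom U V W M := hom_ext ((congrArg (fun t =>
    (t ⊗ₘ 𝟙 M.V) ≫ (α_ U.V (V.V ⊗ W.V) M.V).hom ≫ (𝟙 U.V ⊗ₘ (α_ V.V W.V M.V).hom))
    (Action.associator_hom_hom U V W)).trans (coh_pent U.V V.V W.V M.V))
  leftUnitor_actionHom V M := hom_ext
    ((congrArg (fun t => t ⊗ₘ 𝟙 M.V) (Action.leftUnitor_hom_hom V)).trans (coh_lu V.V M.V))
  rightUnitor_actionHom V M := hom_ext
    ((congrArg (fun t => t ⊗ₘ 𝟙 M.V) (Action.rightUnitor_hom_hom V)).trans (coh_ru V.V M.V))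

/-- `rep G` acts on the right on projective representations of a subgroup by tensor product. -/
instance rightAction : MonoidalRightAction (FDRep k G) (ProjRep k α) where
  actionObj M V := tensorRight M V
  actionHomLeft f V := tensorHomRight f (𝟙 V)
  actionHomRight M _ _ f := tensorHomRight (𝟙 M) f
  actionHom f g := tensorHomRight f g
  actionAssocIso M V W := isoMk (α_ M.V V.V W.V).symm fun g => associator_inv_naturality _ _ _
  actionUnitIso M := isoMk (ρ_ M.V) fun g => coh_right_unit (M.π g)
  actionHom_def f g := hom_ext (coh_def f.hom g.hom)
  actionHomRight_id V M := hom_ext (id_tensorHom_id M.V V.V)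
  id_actionHomLeft V M := hom_ext (id_tensorHom_id M.V V.V)
  actionHom_comp f g f' g' := hom_ext (tensorHom_comp_tensorHom f.hom f'.hom g.hom g'.hom).symm
  actionAssocIso_hom_naturality f g h := hom_ext (by
    exact associator_inv_naturality f.hom g.hom h.hom)
  actionUnitIso_hom_naturality f := hom_ext (coh_right_unit f.hom).symm
  actionHomRight_whiskerRight f U M := hom_ext (coh_wr' U.V M.V f.hom)
  whiskerRight_actionHomLeft U _ _ f M := hom_ext (coh_wl' U.V M.V f.hom)
  actionHom_associator U V W M := hom_ext ((congrArg (fun t =>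
    (𝟙 M.V ⊗ₘ t) ≫ (α_ M.V U.V (V.V ⊗ W.V)).inv ≫ (α_ (M.V ⊗ U.V) V.V W.V).inv)
    (Action.associator_hom_hom U V W)).trans (coh_pent' U.V V.V W.V M.V))
  actionHom_leftUnitor V M := hom_ext
    ((congrArg (fun t => 𝟙 M.V ⊗ₘ t) (Action.leftUnitor_hom_hom V)).trans (coh_lu' V.V M.V))
  actionHom_rightUnitor V M := hom_ext
    ((congrArg (fun t => 𝟙 M.V ⊗ₘ t) (Action.rightUnitor_hom_hom V)).trans (coh_ru' V.V M.V))

/-- The `rep G`-bimodule category `rep_α H` for a subgroup `H` of `G`. -/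
instance bimodule : BimoduleCategory k (FDRep k G) (ProjRep k α) where
  middle V M W := isoMk (α_ V.V M.V W.V) fun g => associator_naturality _ _ _
  middle_naturality f h g := hom_ext (associator_naturality f.hom h.hom g.hom)
  pentagon_left U V M W := hom_ext (coh_pent U.V V.V M.V W.V)
  pentagon_right U M V W := hom_ext (coh_mid_right U.V V.V W.V M.V)
  triangle_left M V := hom_ext (coh_mid_lu V.V M.V)
  triangle_right V M := hom_ext (coh_mid_ru V.V M.V)
  add_left f f' M := hom_ext (coh_add_left M.V f.hom f'.hom)
  smul_left r f M := hom_ext (coh_smul_left M.V r f.hom)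
  left_add V _ _ f f' := hom_ext (coh_add_right V.V f.hom f'.hom)
  left_smul V _ _ r f := hom_ext (coh_smul_right V.V r f.hom)
  add_right f f' V := hom_ext (coh_add_left V.V f.hom f'.hom)
  smul_right r f V := hom_ext (coh_smul_left V.V r f.hom)
  right_add M _ _ f f' := hom_ext (coh_add_right M.V f.hom f'.hom)
  right_smul M _ _ r f := hom_ext (coh_smul_right M.V r f.hom)

end ProjRep

end Projective

/-! ### The factor set of a simple object -/

section FactorSet

variable {k : Type u} [Field k] [IsAlgClosed k] {G : Type w} [Group G] {C : Type uC}
  [Category.{v} C] [Abelian C] [Linear k C] [MonoidalCategory C] [MonoidalPreadditive C]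
  [MonoidalLinear k C] [RigidCategory C] [FusionCategory k C]

/-- Schur's lemma: an automorphism of a simple object is a nonzero scalar. -/
lemma exists_scalar (Y : C) [Simple Y] (e : Y ≅ Y) : ∃ r : kˣ, e.hom = (r : k) • 𝟙 Y := by
  obtain ⟨r, hr⟩ := endomorphism_simple_eq_smul_id k e.hom
  refine ⟨Units.mk0 r fun h => ?_, hr.symm⟩
  have h0 : e.hom = 0 := by rw [← hr, h, zero_smul]
  refine id_nonzero Y ?_
  rw [← e.hom_inv_id, h0, zero_comp]

variable (k) in
/-- The scalar `r` with `e = r • id`, for an automorphism `e` of a simple object. -/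
def scalar (Y : C) [Simple Y] (e : Y ≅ Y) : kˣ := (exists_scalar (k := k) Y e).choose

lemma scalar_spec (Y : C) [Simple Y] (e : Y ≅ Y) : e.hom = (scalar k Y e : k) • 𝟙 Y :=
  (exists_scalar (k := k) Y e).choose_spec

/-- The factor set `α̃_Y` of a simple object `Y` attached to isomorphisms `c^g : ρ^g Y ≅ Y`,
`g ∈ G_Y`, defined by `α̃_Y(g,h)⁻¹ id_Y = c^g ρ^g(c^h) ((ρ₂^{g,h})_Y)⁻¹ (c^{gh})⁻¹`. -/
def factorSet (A : TensorAction k G C) (Y : C) [Simple Y]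
    (c : ∀ g : A.inertia Y, (A.ρ g).obj Y ≅ Y) (g h : A.inertia Y) : kˣ :=
  (scalar k Y ((c (g * h)).symm ≪≫ ((A.ρ₂ g h).app Y).symm ≪≫ (A.ρ g).mapIso (c h) ≪≫ c g))⁻¹

end FactorSet

end EquivFusion

end

set_option linter.unusedSectionVars false

noncomputable section

namespace EquivFusion

open scoped MonoidalLeftAction MonoidalRightAction

/-! ### Linear algebra of projective representations -/

namespace ProjRep

variable {k : Type u} [Field k] {H : Type w} [Group H] {α : H → H → kˣ}

/-- The operator `π(g)` as a linear map. -/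
def op (M : ProjRep k α) (g : H) : M.V →ₗ[k] M.V := (M.π g).hom.hom

/-- The linear map underlying a morphism. -/
def lin {M N : ProjRep k α} (f : M ⟶ N) : M.V →ₗ[k] N.V := f.hom.hom.hom

lemma op_one (M : ProjRep k α) (x : M.V) : M.op 1 x = (α 1 1 : k) • x :=
  LinearMap.congr_fun (congrArg (fun f => f.hom.hom) M.π_one) x

lemma op_mul (M : ProjRep k α) (g h : H) (x : M.V) :
    M.op g (M.op h x) = (α g h : k) • M.op (g * h) x :=
  LinearMap.congr_fun (congrArg (fun f => f.hom.hom) (M.π_mul g h)) x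

lemma lin_op {M N : ProjRep k α} (f : M ⟶ N) (g : H) (x : M.V) :
    lin f (M.op g x) = N.op g (lin f x) :=
  LinearMap.congr_fun (congrArg (fun f => f.hom.hom) (f.comm g)) x

lemma lin_id (M : ProjRep k α) (x : M.V) : lin (𝟙 M) x = x := rfl

lemma lin_comp {M N P : ProjRep k α} (f : M ⟶ N) (g : N ⟶ P) (x : M.V) :
    lin (f ≫ g) x = lin g (lin f x) := rfl

lemma lin_smul {M N : ProjRep k α} (r : k) (f : M ⟶ N) (x : M.V) :
    lin (r • f) x = r • lin f x := rfl

lemma lin_zero {M N : ProjRep k α} (x : M.V) : lin (0 : M ⟶ N) x = 0 := rfl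

lemma lin_ext {M N : ProjRep k α} {f g : M ⟶ N} (h : ∀ x : M.V, lin f x = lin g x) : f = g :=
  hom_ext (FGModuleCat.hom_ext (LinearMap.ext h))

/-- A linear map commuting with the operators as a morphism. -/
def ofLin {M N : ProjRep k α} (φ : M.V →ₗ[k] N.V)
    (h : ∀ (g : H) (x : M.V), φ (M.op g x) = N.op g (φ x)) : M ⟶ N where
  hom := FGModuleCat.ofHom φ
  comm g := FGModuleCat.hom_ext (LinearMap.ext (h g))

@[simp] lemma lin_ofLin {M N : ProjRep k α} (φ : M.V →ₗ[k] N.V)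
    (h : ∀ (g : H) (x : M.V), φ (M.op g x) = N.op g (φ x)) (x : M.V) :
    lin (ofLin φ h) x = φ x := rfl

/-- A projective representation from linear operators; the condition on the unit element follows
from the injectivity of its operator. -/
def ofOp (V : Type u) [AddCommGroup V] [Module k V] [Module.Finite k V] (π : H → V →ₗ[k] V)
    (h1 : Function.Injective (π 1)) (hmul : ∀ g h x, π g (π h x) = (α g h : k) • π (g * h) x) :
    ProjRep k α where
  V := FGModuleCat.of k V
  π g := FGModuleCat.ofHom (π g)
  π_one := FGModuleCat.hom_ext (LinearMap.ext fun x => h1 (by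
    change π 1 (π 1 x) = π 1 ((α 1 1 : k) • x)
    rw [hmul, mul_one, map_smul]))
  π_mul g h := FGModuleCat.hom_ext (LinearMap.ext fun x => hmul g h x)

/-- The inverse of `π(g)`. -/
def opInv (M : ProjRep k α) (g : H) : M.V →ₗ[k] M.V :=
  ((α g g⁻¹ * α 1 1 : kˣ)⁻¹ : kˣ) • M.op g⁻¹

/-- The scalar in `opInv` comes from `π(g) π(g⁻¹) = α(g, g⁻¹) π(1) = α(g, g⁻¹) α(1, 1)`. -/
lemma op_opInv (M : ProjRep k α) (g : H) (x : M.V) : M.op g (M.opInv g x) = x := by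
  simp only [opInv, LinearMap.smul_apply, Units.smul_def, map_smul, op_mul, mul_inv_cancel, op_one,
    smul_smul]
  rw [← Units.val_mul, ← Units.val_mul, inv_mul_cancel, Units.val_one, one_smul]

lemma op_injective (M : ProjRep k α) (g : H) : Function.Injective (M.op g) := by
  have hs : Function.Surjective (M.op g) := fun x => ⟨_, M.op_opInv g x⟩
  exact LinearMap.injective_iff_surjective.mpr hs

lemma opInv_op (M : ProjRep k α) (g : H) (x : M.V) : M.opInv g (M.op g x) = x :=
  M.op_injective g (M.op_opInv g _)

lemma opInv_eq_iff (M : ProjRep k α) (g : H) (x y : M.V) : M.opInv g x = y ↔ x = M.op g y :=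
  ⟨fun h => by rw [← h, op_opInv], fun h => by rw [h, opInv_op]⟩

/-- Because `M` and `N` have the same factor set, the scalars from the two sides cancel: conjugation
is an honest action of `H` on linear maps `M → N`. This lets the average over `H` be reindexed. -/
lemma op_opInv_mul (M N : ProjRep k α) (φ : M.V →ₗ[k] N.V) (g h : H) (x : M.V) :
    N.op (g * h) (φ (M.opInv (g * h) (M.op g x))) = N.op g (N.op h (φ (M.opInv h x))) := by
  have key : M.opInv (g * h) (M.op g x) = (α g h : k) • M.opInv h x := by
    rw [opInv_eq_iff, map_smul, ← op_mul, op_opInv]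
  rw [key, map_smul, map_smul, op_mul]

/-- The average `∑ h, π(h) φ π(h)⁻¹` of a linear map. -/
def avg [Fintype H] {M N : ProjRep k α} (φ : M.V →ₗ[k] N.V) : M ⟶ N :=
  ofLin (∑ h, N.op h ∘ₗ φ ∘ₗ M.opInv h) fun g x => by
    simp only [LinearMap.sum_apply, LinearMap.comp_apply, map_sum, ← op_opInv_mul]
    exact (Equiv.sum_comp (Equiv.mulLeft g)
      fun h => N.op h (φ (M.opInv h (M.op g x)))).symm

lemma lin_avg [Fintype H] {M N : ProjRep k α} (φ : M.V →ₗ[k] N.V) (x : M.V) :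
    lin (avg φ) x = ∑ h, N.op h (φ (M.opInv h x)) := by
  simp [avg]

/-- If conjugates of `ψ ∘ φ` by elements other than `1` vanish, then the composite of the averages
of `φ` and `ψ` is `|H| • (ψ ∘ φ)`. -/
lemma avg_comp_avg [Fintype H] {M N : ProjRep k α} (φ : M.V →ₗ[k] N.V) (ψ : N.V →ₗ[k] M.V)
    (h1 : ∀ x, ψ (φ x) = x) (h : ∀ g : H, g ≠ 1 → ∀ x, ψ (N.opInv g (φ x)) = 0) :
    avg φ ≫ avg ψ = (Fintype.card H : k) • 𝟙 M := by
  -- Only the summand at `1` survives, and `π(1)` is a scalar, hence commutes with `φ`.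
  have key : ∀ x, lin (avg ψ) (φ x) = x := fun x => by
    rw [lin_avg, Finset.sum_eq_single 1]
    · have : N.opInv 1 (φ x) = φ (M.opInv 1 x) := by
        rw [opInv_eq_iff, op_one, ← map_smul, ← op_one, op_opInv]
      rw [this, h1, op_opInv]
    · intro g _ hg
      rw [h g hg, map_zero]
    · simp
  refine lin_ext fun x => ?_
  rw [lin_comp, lin_avg φ, map_sum, lin_smul, lin_id]
  -- The average of `ψ` commutes with the operators, so it sends each of the `|H|` summands `π(h) φ
  -- π(h)⁻¹ x` back to `x`.
  simp only [lin_op, key, op_opInv]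
  simp [Nat.cast_smul_eq_nsmul]

lemma isZero_iff (M : ProjRep k α) : IsZero M ↔ ∀ x : M.V, x = 0 := by
  rw [IsZero.iff_id_eq_zero]
  refine ⟨fun h x => ?_, fun h => lin_ext fun x => ?_⟩
  · rw [← lin_id M x, h, lin_zero]
  · rw [h (lin (𝟙 M) x), lin_zero]

/-- Isomorphisms from bijective morphisms. -/
def isoOfLin {M N : ProjRep k α} (f : M ⟶ N) (φ : N.V →ₗ[k] M.V) (h : ∀ x, φ (lin f x) = x)
    (h' : ∀ x, lin f (φ x) = x) : M ≅ N where
  hom := f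
  inv := ofLin φ fun g x => by
    conv_lhs => rw [← h' x, ← lin_op, h]
  hom_inv_id := lin_ext h
  inv_hom_id := lin_ext h'

end ProjRep

/-! ### The multiplicity functor `Hom(Y, -)` -/

section Multiplicity

open Functor.LaxMonoidal Functor.OplaxMonoidal

variable {k : Type u} [Field k] [IsAlgClosed k] {G : Type w} [Group G] {C : Type uC}
  [Category.{v} C] [Abelian C] [Linear k C] [MonoidalCategory C] [MonoidalPreadditive C]
  [MonoidalLinear k C] [RigidCategory C] [FusionCategory k C]
  (A : TensorAction k G C) (Y : C) [Simple Y] (c : ∀ g : A.inertia Y, (A.ρ g).obj Y ≅ Y)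

/-- The defining equation of the factor set, inverted: this is the shape in which the isomorphisms
`c` occur when two of the operators `f ↦ μ^g ρ^g(f) (c^g)⁻¹` are composed. -/
lemma factorSet_spec (g h : A.inertia Y) :
    (c g).inv ≫ (A.ρ g).map (c h).inv ≫ (A.ρ₂ g h).hom.app Y =
      (factorSet A Y c g h : k) • (c (g * h)).inv := by
  have h1 := scalar_spec (k := k) Y
    ((c (g * h)).symm ≪≫ ((A.ρ₂ g h).app Y).symm ≪≫ (A.ρ g).mapIso (c h) ≪≫ c g)
  rw [factorSet]
  set r := scalar k Y
    ((c (g * h)).symm ≪≫ ((A.ρ₂ g h).app Y).symm ≪≫ (A.ρ g).mapIso (c h) ≪≫ c g)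
  have h2 : (c (g * h)).inv ≫ (A.ρ₂ g h).inv.app Y ≫ (A.ρ g).map (c h).hom ≫ (c g).hom =
      (r : k) • 𝟙 Y := h1
  have h3 := congrArg (fun t => t ≫ (c g).inv ≫ (A.ρ g).map (c h).inv ≫ (A.ρ₂ g h).hom.app Y) h2
  simp only [Category.assoc, Iso.hom_inv_id_assoc, Linear.smul_comp, Category.id_comp] at h3
  rw [← Functor.map_comp_assoc, Iso.hom_inv_id, CategoryTheory.Functor.map_id] at h3
  erw [Category.id_comp, Iso.inv_hom_id_app, Category.comp_id] at h3
  rw [h3, smul_smul, ← Units.val_mul, inv_mul_cancel, Units.val_one, one_smul]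

variable {A}

/-- The operators `f ↦ μ^g ρ^g(f) (c^g)⁻¹` on `Hom(Y, X)`. -/
def opHom (M : Equivariantization A) (g : A.inertia Y) : (Y ⟶ M.X) →ₗ[k] (Y ⟶ M.X) where
  toFun f := (c g).inv ≫ (A.ρ g).map f ≫ (M.act g).hom
  map_add' f f' := by simp
  map_smul' r f := by simp

lemma opHom_apply (M : Equivariantization A) (g : A.inertia Y) (f : Y ⟶ M.X) :
    opHom Y c M g f = (c g).inv ≫ (A.ρ g).map f ≫ (M.act g).hom := rfl

lemma opHom_injective (M : Equivariantization A) (g : A.inertia Y) :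
    Function.Injective (opHom Y c M g) := fun f f' h => by
  rw [opHom_apply, opHom_apply, cancel_epi, cancel_mono] at h
  exact (A.ρ g).map_injective h

/-- Multiplicativity of `μ` and naturality of `ρ₂` turn the double action on `f` into `μ^{gh}
ρ^{gh}(f)`. What remains on the side of `Y` is exactly `factorSet_spec`. -/
lemma opHom_mul (M : Equivariantization A) (g h : A.inertia Y) (f : Y ⟶ M.X) :
    opHom Y c M g (opHom Y c M h f) = (factorSet A Y c g h : k) • opHom Y c M (g * h) f := by
  simp only [opHom_apply]
  have hn : (A.ρ g).map ((A.ρ h).map f) ≫ (A.ρ₂ g h).hom.app M.X =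
    (A.ρ₂ g h).hom.app Y ≫ (A.ρ (g * h)).map f := (A.ρ₂ g h).hom.naturality f
  rw [Functor.map_comp, Functor.map_comp, Category.assoc, Category.assoc, M.mul, reassoc_of% hn]
  have hs := congrArg (· ≫ (A.ρ (g * h)).map f ≫ (M.act (g * h)).hom) (factorSet_spec A Y c g h)
  simp only [Category.assoc, Linear.smul_comp] at hs
  exact hs

-- Morphisms of `C` live in universe `v`, but the spaces of projective representations in that of
-- `k`. Finite dimension over `k` bridges the gap.
variable (k) in
lemma small_hom (X X' : C) [Module.Finite k (X ⟶ X')] : Small.{u} (X ⟶ X') :=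
  Module.Finite.small.{u} k _

variable (k) in
/-- A model of `Hom(X, X')` in the universe of the ground field. -/
def HomModel (X X' : C) : Type u :=
  letI := small_hom k X X'
  Shrink.{u} (X ⟶ X')

instance (X X' : C) : AddCommGroup (HomModel k X X') :=
  letI := small_hom k X X'
  inferInstanceAs (AddCommGroup (Shrink.{u} (X ⟶ X')))

instance (X X' : C) : Module k (HomModel k X X') :=
  letI := small_hom k X X'
  inferInstanceAs (Module k (Shrink.{u} (X ⟶ X')))

variable (k) in
/-- The identification of `HomModel k X X'` with `Hom(X, X')`. -/
def homModelEquiv (X X' : C) : HomModel k X X' ≃ₗ[k] (X ⟶ X') :=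
  letI := small_hom k X X'
  Shrink.linearEquiv k (X ⟶ X')

instance (X X' : C) : Module.Finite k (HomModel k X X') :=
  have : Module.Finite k (X ⟶ X') := FusionCategory.finiteDimensional_hom X X'
  Module.Finite.equiv (homModelEquiv k X X').symm

/-- The projective representation of `G_Y` on `Hom(Y, X)`, for an equivariant object `(X, μ)`. -/
def homRep (M : Equivariantization A) : ProjRep k (factorSet A Y c) :=
  ProjRep.ofOp (HomModel k Y M.X)
    (fun g => (homModelEquiv k Y M.X).symm.toLinearMap ∘ₗ opHom Y c M g ∘ₗ
      (homModelEquiv k Y M.X).toLinearMap)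
    ((homModelEquiv k Y M.X).symm.injective.comp
      ((opHom_injective Y c M 1).comp (homModelEquiv k Y M.X).injective))
    fun g h x => by simp [opHom_mul]

/-- The identification of the space of `homRep` with `Hom(Y, X)`. -/
def homEquiv (M : Equivariantization A) : (homRep Y c M).V ≃ₗ[k] (Y ⟶ M.X) :=
  homModelEquiv k Y M.X

lemma homEquiv_op (M : Equivariantization A) (g : A.inertia Y) (x : (homRep Y c M).V) :
    homEquiv Y c M ((homRep Y c M).op g x) = opHom Y c M g (homEquiv Y c M x) :=
  (homModelEquiv k Y M.X).apply_symm_apply _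

lemma op_homEquiv_symm (M : Equivariantization A) (g : A.inertia Y) (f : Y ⟶ M.X) :
    (homRep Y c M).op g ((homEquiv Y c M).symm f) = (homEquiv Y c M).symm (opHom Y c M g f) := by
  rw [LinearEquiv.eq_symm_apply, homEquiv_op, LinearEquiv.apply_symm_apply]

lemma opHom_comp {M N : Equivariantization A} (φ : M ⟶ N) (g : A.inertia Y) (f : Y ⟶ M.X) :
    opHom Y c N g (f ≫ φ.hom) = opHom Y c M g f ≫ φ.hom := by
  simp [opHom_apply, φ.comm]

/-- The action of morphisms on `Hom(Y, -)`. -/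
def homRepMap {M N : Equivariantization A} (φ : M ⟶ N) : homRep Y c M ⟶ homRep Y c N :=
  ProjRep.ofLin ((homEquiv Y c N).symm.toLinearMap ∘ₗ Linear.rightComp k Y φ.hom ∘ₗ
    (homEquiv Y c M).toLinearMap) fun g x => by
      simp [homEquiv_op, op_homEquiv_symm, opHom_comp]

lemma lin_homRepMap {M N : Equivariantization A} (φ : M ⟶ N) (f : Y ⟶ M.X) :
    ProjRep.lin (homRepMap Y c φ) ((homEquiv Y c M).symm f) =
      (homEquiv Y c N).symm (f ≫ φ.hom) := by
  simp [homRepMap]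

/-- Morphisms out of `homRep` are determined by their values on morphisms `Y ⟶ X`. -/
lemma homRep_ext {M : Equivariantization A} {N : ProjRep k (factorSet A Y c)}
    {f f' : homRep Y c M ⟶ N} (h : ∀ y : Y ⟶ M.X, ProjRep.lin f ((homEquiv Y c M).symm y) =
      ProjRep.lin f' ((homEquiv Y c M).symm y)) : f = f' :=
  ProjRep.lin_ext fun x => by simpa using h (homEquiv Y c M x)

/-- The functor `C^G ⥤ rep_{α_Y} G_Y`, `(X, μ) ↦ Hom(Y, X)`. -/
def homFunctor : Equivariantization A ⥤ ProjRep k (factorSet A Y c) where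
  obj := homRep Y c
  map := homRepMap Y c
  map_id M := homRep_ext Y c fun y => by
    rw [lin_homRepMap, ProjRep.lin_id, Equivariantization.category_id_hom, Category.comp_id]
  map_comp φ ψ := homRep_ext Y c fun y => by
    rw [lin_homRepMap, ProjRep.lin_comp, lin_homRepMap, lin_homRepMap,
      Equivariantization.category_comp_hom, Category.assoc]

instance : (homFunctor Y c).Additive where
  map_add {M N f g} := homRep_ext Y c fun y => by
    change ProjRep.lin (homRepMap Y c (f + g)) _ = ProjRep.lin (homRepMap Y c f) _ +
      ProjRep.lin (homRepMap Y c g) _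
    simp only [lin_homRepMap]
    rw [← map_add, ← Preadditive.comp_add]
    rfl

instance : (homFunctor Y c).Linear k where
  map_smul {M N} f r := homRep_ext Y c fun y => by
    change ProjRep.lin (homRepMap Y c (r • f)) _ = r • ProjRep.lin (homRepMap Y c f) _
    simp only [lin_homRepMap]
    rw [← map_smul, ← Linear.comp_smul]
    rfl

end Multiplicity

/-! ### Projective representations: tensor products on elements -/

namespace ProjRep

variable {k : Type u} [Field k] {G : Type w} [Group G] {H : Subgroup G} {α : H → H → kˣ}

/-- Pure tensors in `V ⊗ M`. -/
def tmulLeft {V : FDRep k G} {M : ProjRep k α} (v : V) (m : M.V) : (tensorLeft V M).V :=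
  (TensorProduct.tmul k v m : TensorProduct k V M.V)

/-- Pure tensors in `M ⊗ V`. -/
def tmulRight {V : FDRep k G} {M : ProjRep k α} (m : M.V) (v : V) : (tensorRight M V).V :=
  (TensorProduct.tmul k m v : TensorProduct k M.V V)

lemma op_tmulLeft {V : FDRep k G} {M : ProjRep k α} (g : H) (v : V) (m : M.V) :
    (tensorLeft V M).op g (tmulLeft v m) = tmulLeft (V.ρ g v) (M.op g m) := rfl

lemma op_tmulRight {V : FDRep k G} {M : ProjRep k α} (g : H) (m : M.V) (v : V) :
    (tensorRight M V).op g (tmulRight m v) = tmulRight (M.op g m) (V.ρ g v) := rfl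

/-- Linear maps out of `V ⊗ M`. -/
def liftLeft {V : FDRep k G} {M : ProjRep k α} {N : Type*} [AddCommGroup N] [Module k N]
    (φ : V →ₗ[k] M.V →ₗ[k] N) : (tensorLeft V M).V →ₗ[k] N :=
  (TensorProduct.lift φ : TensorProduct k V M.V →ₗ[k] N)

/-- Linear maps out of `M ⊗ V`. -/
def liftRight {V : FDRep k G} {M : ProjRep k α} {N : Type*} [AddCommGroup N] [Module k N]
    (φ : M.V →ₗ[k] V →ₗ[k] N) : (tensorRight M V).V →ₗ[k] N :=
  (TensorProduct.lift φ : TensorProduct k M.V V →ₗ[k] N)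

@[simp] lemma liftLeft_tmul {V : FDRep k G} {M : ProjRep k α} {N : Type*} [AddCommGroup N]
    [Module k N] (φ : V →ₗ[k] M.V →ₗ[k] N) (v : V) (m : M.V) :
    liftLeft φ (tmulLeft v m) = φ v m := TensorProduct.lift.tmul v m

@[simp] lemma liftRight_tmul {V : FDRep k G} {M : ProjRep k α} {N : Type*} [AddCommGroup N]
    [Module k N] (φ : M.V →ₗ[k] V →ₗ[k] N) (m : M.V) (v : V) :
    liftRight φ (tmulRight m v) = φ m v := TensorProduct.lift.tmul m v

lemma tensorLeft_ext {V : FDRep k G} {M : ProjRep k α} {N : Type*} [AddCommGroup N] [Module k N]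
    {φ ψ : (tensorLeft V M).V →ₗ[k] N} (h : ∀ v m, φ (tmulLeft v m) = ψ (tmulLeft v m)) :
    φ = ψ :=
  TensorProduct.ext' (M := V) (N := M.V) h

lemma tensorRight_ext {V : FDRep k G} {M : ProjRep k α} {N : Type*} [AddCommGroup N]
    [Module k N] {φ ψ : (tensorRight M V).V →ₗ[k] N}
    (h : ∀ m v, φ (tmulRight m v) = ψ (tmulRight m v)) : φ = ψ :=
  TensorProduct.ext' (M := M.V) (N := V) h

end ProjRep

/-! ### `Hom(Y, -)` as a bimodule functor -/

section Lineator

open Functor.LaxMonoidal Functor.OplaxMonoidal ProjRep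

variable {k : Type u} [Field k] [IsAlgClosed k] {G : Type w} [Group G] {C : Type uC}
  [Category.{v} C] [Abelian C] [Linear k C] [MonoidalCategory C] [MonoidalPreadditive C]
  [MonoidalLinear k C] [RigidCategory C] [FusionCategory k C]
  {A : TensorAction k G C} (Y : C) [Simple Y] (c : ∀ g : A.inertia Y, (A.ρ g).obj Y ≅ Y)

/-- The pairing `V × Hom(Y, X) → Hom(Y, (V ⊗ 𝟙) ⊗ X)`. -/
def pairLeft (V : FDRep k G) (M : Equivariantization A) :
    V →ₗ[k] (Y ⟶ M.X) →ₗ[k] (Y ⟶ (embedObj A V ⊗ M).X) :=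
  (LinearMap.mk₂ k (fun v y => (λ_ Y).inv ≫ (vecIns V v ⊗ₘ y))
    (fun x x' y => by simp [MonoidalPreadditive.add_tensor])
    (fun r x y => by simp [MonoidalCategory.tensorHom_def])
    (fun x y y' => by simp [MonoidalPreadditive.tensor_add])
    (fun r x y => by simp [MonoidalCategory.tensorHom_def]) :
    V →ₗ[k] (Y ⟶ M.X) →ₗ[k] (Y ⟶ vecUnit C V ⊗ M.X))

/-- The pairing `Hom(Y, X) × V → Hom(Y, X ⊗ (V ⊗ 𝟙))`. -/
def pairRight (M : Equivariantization A) (V : FDRep k G) :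
    (Y ⟶ M.X) →ₗ[k] V →ₗ[k] (Y ⟶ (M ⊗ embedObj A V).X) :=
  (LinearMap.mk₂ k (fun y v => (ρ_ Y).inv ≫ (y ⊗ₘ vecIns V v))
    (fun x x' y => by simp [MonoidalPreadditive.add_tensor])
    (fun r x y => by simp [MonoidalCategory.tensorHom_def])
    (fun x y y' => by simp [MonoidalPreadditive.tensor_add])
    (fun r x y => by simp [MonoidalCategory.tensorHom_def]) :
    (Y ⟶ M.X) →ₗ[k] V →ₗ[k] (Y ⟶ M.X ⊗ vecUnit C V))

lemma pairLeft_apply (V : FDRep k G) (M : Equivariantization A) (v : V) (y : Y ⟶ M.X) :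
    pairLeft Y V M v y = ((λ_ Y).inv ≫ (vecIns V v ⊗ₘ y) : Y ⟶ vecUnit C V ⊗ M.X) := rfl

lemma pairRight_apply (V : FDRep k G) (M : Equivariantization A) (y : Y ⟶ M.X) (v : V) :
    pairRight Y M V y v = ((ρ_ Y).inv ≫ (y ⊗ₘ vecIns V v) : Y ⟶ M.X ⊗ vecUnit C V) := rfl

/-- The equivariant structure of `V ⊗ 𝟙` contributes `π(g) v` together with the counit of `ρ^g`.
Left unitality of `ρ^g` absorbs that counit, leaving the operator on the factor `y`. Equivariance of
the pairing means that the lineators are morphisms of projective representations. -/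
lemma opHom_pairLeft (V : FDRep k G) (M : Equivariantization A) (g : A.inertia Y) (v : V)
    (y : Y ⟶ M.X) :
    opHom Y c (embedObj A V ⊗ M) g (pairLeft Y V M v y) =
      pairLeft Y V M (V.ρ g v) (opHom Y c M g y) := by
  change (c g).inv ≫ (A.ρ g).map ((λ_ Y).inv ≫ (vecIns V v ⊗ₘ y)) ≫
    δ (A.ρ g) (vecUnit C V) M.X ≫ ((vecAct A V g).hom ⊗ₘ (M.act g).hom) =
    (λ_ Y).inv ≫ (vecIns V (V.ρ g v) ⊗ₘ ((c g).inv ≫ (A.ρ g).map y ≫ (M.act g).hom))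
  have h := Functor.OplaxMonoidal.left_unitality (A.ρ g) Y
  rw [Functor.map_comp, Category.assoc, ← Functor.OplaxMonoidal.δ_natural_assoc,
    tensorHom_comp_tensorHom, vecIns_act, MonoidalCategory.tensorHom_def, comp_whiskerRight,
    Category.assoc, ← reassoc_of% h, ← MonoidalCategory.tensorHom_def, leftUnitor_inv_naturality_assoc,
    ← id_tensorHom, tensorHom_comp_tensorHom, Category.id_comp]

lemma opHom_pairRight (V : FDRep k G) (M : Equivariantization A) (g : A.inertia Y) (v : V)
    (y : Y ⟶ M.X) :
    opHom Y c (M ⊗ embedObj A V) g (pairRight Y M V y v) =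
      pairRight Y M V (opHom Y c M g y) (V.ρ g v) := by
  change (c g).inv ≫ (A.ρ g).map ((ρ_ Y).inv ≫ (y ⊗ₘ vecIns V v)) ≫
    δ (A.ρ g) M.X (vecUnit C V) ≫ ((M.act g).hom ⊗ₘ (vecAct A V g).hom) =
    (ρ_ Y).inv ≫ (((c g).inv ≫ (A.ρ g).map y ≫ (M.act g).hom) ⊗ₘ vecIns V (V.ρ g v))
  have h := Functor.OplaxMonoidal.right_unitality (A.ρ g) Y
  rw [Functor.map_comp, Category.assoc, ← Functor.OplaxMonoidal.δ_natural_assoc,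
    tensorHom_comp_tensorHom, vecIns_act, tensorHom_def', MonoidalCategory.whiskerLeft_comp,
    Category.assoc, ← reassoc_of% h, ← tensorHom_def', rightUnitor_inv_naturality_assoc,
    ← tensorHom_id, tensorHom_comp_tensorHom, Category.id_comp]

/-- The structure morphism `V ⊗ Hom(Y, X) ⟶ Hom(Y, (V ⊗ 𝟙) ⊗ X)`. -/
def lineatorLeft (V : FDRep k G) (M : Equivariantization A) :
    tensorLeft V (homRep Y c M) ⟶ homRep Y c (embedObj A V ⊗ M) :=
  ofLin ((homEquiv Y c (embedObj A V ⊗ M)).symm.toLinearMap ∘ₗ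
    liftLeft ((pairLeft Y V M).compl₂ (homEquiv Y c M).toLinearMap)) fun g x => by
    -- Commutation with the operators is an equality of two linear maps out of `V ⊗ Hom(Y, X)`, so
    -- pure tensors suffice.
    refine LinearMap.congr_fun (f := (_ ∘ₗ _) ∘ₗ (tensorLeft V (homRep Y c M)).op g)
      (g := (homRep Y c (embedObj A V ⊗ M)).op g ∘ₗ _ ∘ₗ _) (tensorLeft_ext fun v m => ?_) x
    simp only [LinearMap.comp_apply, op_tmulLeft, liftLeft_tmul, LinearMap.compl₂_apply,
      LinearEquiv.coe_coe, homEquiv_op, op_homEquiv_symm, opHom_pairLeft]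
    rfl

/-- The structure morphism `Hom(Y, X) ⊗ V ⟶ Hom(Y, X ⊗ (V ⊗ 𝟙))`. -/
def lineatorRight (M : Equivariantization A) (V : FDRep k G) :
    tensorRight (homRep Y c M) V ⟶ homRep Y c (M ⊗ embedObj A V) :=
  ofLin ((homEquiv Y c (M ⊗ embedObj A V)).symm.toLinearMap ∘ₗ
    liftRight ((pairRight Y M V) ∘ₗ (homEquiv Y c M).toLinearMap)) fun g x => by
    refine LinearMap.congr_fun (f := (_ ∘ₗ _) ∘ₗ (tensorRight (homRep Y c M) V).op g)
      (g := (homRep Y c (M ⊗ embedObj A V)).op g ∘ₗ _ ∘ₗ _) (tensorRight_ext fun v m => ?_) x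
    simp only [LinearMap.comp_apply, op_tmulRight, liftRight_tmul,
      LinearEquiv.coe_coe, homEquiv_op, op_homEquiv_symm, opHom_pairRight]
    rfl

lemma lin_lineatorLeft (V : FDRep k G) (M : Equivariantization A) (v : V) (y : Y ⟶ M.X) :
    lin (lineatorLeft Y c V M) (tmulLeft v ((homEquiv Y c M).symm y)) =
      (homEquiv Y c (embedObj A V ⊗ M)).symm (pairLeft Y V M v y) := by
  change (homEquiv Y c _).symm (pairLeft Y V M v (homEquiv Y c M ((homEquiv Y c M).symm y))) = _
  rw [LinearEquiv.apply_symm_apply]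

lemma lin_lineatorRight (V : FDRep k G) (M : Equivariantization A) (v : V) (y : Y ⟶ M.X) :
    lin (lineatorRight Y c M V) (tmulRight ((homEquiv Y c M).symm y) v) =
      (homEquiv Y c (M ⊗ embedObj A V)).symm (pairRight Y M V y v) := by
  change (homEquiv Y c _).symm (pairRight Y M V (homEquiv Y c M ((homEquiv Y c M).symm y)) v) = _
  rw [LinearEquiv.apply_symm_apply]

lemma tensorLeft_homRep_ext {V : FDRep k G} {M : Equivariantization A}
    {N : ProjRep k (factorSet A Y c)} {f f' : tensorLeft V (homRep Y c M) ⟶ N}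
    (h : ∀ (v : V) (y : Y ⟶ M.X), lin f (tmulLeft v ((homEquiv Y c M).symm y)) =
      lin f' (tmulLeft v ((homEquiv Y c M).symm y))) : f = f' :=
  lin_ext <| LinearMap.congr_fun <| tensorLeft_ext fun v m => by
    simpa using h v (homEquiv Y c M m)

lemma tensorRight_homRep_ext {V : FDRep k G} {M : Equivariantization A}
    {N : ProjRep k (factorSet A Y c)} {f f' : tensorRight (homRep Y c M) V ⟶ N}
    (h : ∀ (v : V) (y : Y ⟶ M.X), lin f (tmulRight ((homEquiv Y c M).symm y) v) =
      lin f' (tmulRight ((homEquiv Y c M).symm y) v)) : f = f' :=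
  lin_ext <| LinearMap.congr_fun <| tensorRight_ext fun m v => by
    simpa using h v (homEquiv Y c M m)

/-- The inverse of `lineatorLeft` on elements. -/
def unpairLeft (V : FDRep k G) (M : Equivariantization A) :
    (Y ⟶ (embedObj A V ⊗ M).X) →ₗ[k] (tensorLeft V (homRep Y c M)).V :=
  ∑ i, (TensorProduct.mk k V (homRep Y c M).V (Module.finBasis k V i)) ∘ₗ
    (homEquiv Y c M).symm.toLinearMap ∘ₗ
      Linear.rightComp k Y ((vecUnitCopower C V).proj i ▷ M.X ≫ (λ_ M.X).hom)

/-- The inverse of `lineatorRight` on elements. -/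
def unpairRight (M : Equivariantization A) (V : FDRep k G) :
    (Y ⟶ (M ⊗ embedObj A V).X) →ₗ[k] (tensorRight (homRep Y c M) V).V :=
  ∑ i, ((TensorProduct.mk k (homRep Y c M).V V).flip (Module.finBasis k V i)) ∘ₗ
    (homEquiv Y c M).symm.toLinearMap ∘ₗ
      Linear.rightComp k Y (M.X ◁ (vecUnitCopower C V).proj i ≫ (ρ_ M.X).hom)

lemma unpairLeft_apply (V : FDRep k G) (M : Equivariantization A)
    (y : Y ⟶ (embedObj A V ⊗ M).X) : unpairLeft Y c V M y =
      ∑ i, tmulLeft (Module.finBasis k V i)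
        ((homEquiv Y c M).symm (y ≫ (vecUnitCopower C V).proj i ▷ M.X ≫ (λ_ M.X).hom)) := by
  rw [unpairLeft]
  erw [LinearMap.sum_apply]
  rfl

lemma unpairRight_apply (M : Equivariantization A) (V : FDRep k G)
    (y : Y ⟶ (M ⊗ embedObj A V).X) : unpairRight Y c M V y =
      ∑ i, tmulRight ((homEquiv Y c M).symm
        (y ≫ M.X ◁ (vecUnitCopower C V).proj i ≫ (ρ_ M.X).hom)) (Module.finBasis k V i) := by
  rw [unpairRight]
  erw [LinearMap.sum_apply]
  rfl

lemma tmulLeft_smul_basis (V : FDRep k G) (M : Equivariantization A) (v : V)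
    (m : (homRep Y c M).V) :
    ∑ i, tmulLeft (V := V) (Module.finBasis k V i) ((Module.finBasis k V).repr v i • m) =
      tmulLeft v m := by
  conv_rhs => rw [← (Module.finBasis k V).sum_repr v]
  refine Eq.trans ?_ (TensorProduct.sum_tmul _ _ _).symm
  exact Finset.sum_congr rfl fun i _ => (TensorProduct.smul_tmul _ _ _).symm

lemma tmulRight_smul_basis (V : FDRep k G) (M : Equivariantization A) (v : V)
    (m : (homRep Y c M).V) :
    ∑ i, tmulRight (V := V) ((Module.finBasis k V).repr v i • m) (Module.finBasis k V i) =
      tmulRight m v := by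
  conv_rhs => rw [← (Module.finBasis k V).sum_repr v]
  refine Eq.trans ?_ (TensorProduct.tmul_sum _ _ _).symm
  exact Finset.sum_congr rfl fun i _ => TensorProduct.smul_tmul _ _ _

/-- The `i`-th projection of `V ⊗ 𝟙` reads off the `i`-th coordinate of `v`. Summing over the basis,
unpairing after pairing is the identity. -/
lemma pairLeft_proj (V : FDRep k G) (M : Equivariantization A) (v : V) (y : Y ⟶ M.X)
    (i : Fin (Module.finrank k V)) :
    pairLeft Y V M v y ≫ (vecUnitCopower C V).proj i ▷ M.X ≫ (λ_ M.X).hom =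
      (Module.finBasis k V).repr v i • y := by
  change ((λ_ Y).inv ≫ (vecIns V v ⊗ₘ y)) ≫ (vecUnitCopower C V).proj i ▷ M.X ≫ (λ_ M.X).hom = _
  rw [Category.assoc, ← tensorHom_id, tensorHom_comp_tensorHom_assoc, Copower.ins_proj',
    Category.comp_id, MonoidalCategory.tensorHom_def, MonoidalLinear.smul_whiskerRight]
  simp

lemma pairRight_proj (V : FDRep k G) (M : Equivariantization A) (v : V) (y : Y ⟶ M.X)
    (i : Fin (Module.finrank k V)) :
    pairRight Y M V y v ≫ M.X ◁ (vecUnitCopower C V).proj i ≫ (ρ_ M.X).hom =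
      (Module.finBasis k V).repr v i • y := by
  change ((ρ_ Y).inv ≫ (y ⊗ₘ vecIns V v)) ≫ M.X ◁ (vecUnitCopower C V).proj i ≫ (ρ_ M.X).hom = _
  rw [Category.assoc, ← id_tensorHom, tensorHom_comp_tensorHom_assoc, Copower.ins_proj',
    Category.comp_id, tensorHom_def', MonoidalLinear.whiskerLeft_smul]
  simp

/-- The other composite: it comes from the decomposition of the identity of `V ⊗ 𝟙` into its copies
of `𝟙`, tensored with `X`. -/
lemma sum_pairLeft (V : FDRep k G) (M : Equivariantization A) (y : Y ⟶ vecUnit C V ⊗ M.X) :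
    ∑ i, pairLeft Y V M (Module.finBasis k V i)
      (y ≫ (vecUnitCopower C V).proj i ▷ M.X ≫ (λ_ M.X).hom) = y := by
  have h : ∀ i, pairLeft Y V M (Module.finBasis k V i)
      (y ≫ (vecUnitCopower C V).proj i ▷ M.X ≫ (λ_ M.X).hom) =
      y ≫ ((vecUnitCopower C V).proj i ≫ vecIns V (Module.finBasis k V i)) ▷ M.X := fun i => by
    rw [pairLeft_apply, tensorHom_def']
    simp
    rfl
  have e : ∑ i, y ≫ ((vecUnitCopower C V).proj i ≫ vecIns V (Module.finBasis k V i)) ▷ M.X =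
      y := by
    rw [← Preadditive.comp_sum, ← sum_whiskerRight, (vecUnitCopower C V).total, id_whiskerRight,
      Category.comp_id]
  exact (Finset.sum_congr rfl fun i _ => h i).trans e

lemma sum_pairRight (V : FDRep k G) (M : Equivariantization A) (y : Y ⟶ M.X ⊗ vecUnit C V) :
    ∑ i, pairRight Y M V (y ≫ M.X ◁ (vecUnitCopower C V).proj i ≫ (ρ_ M.X).hom)
      (Module.finBasis k V i) = y := by
  have h : ∀ i, pairRight Y M V (y ≫ M.X ◁ (vecUnitCopower C V).proj i ≫ (ρ_ M.X).hom)
      (Module.finBasis k V i) =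
      y ≫ M.X ◁ ((vecUnitCopower C V).proj i ≫ vecIns V (Module.finBasis k V i)) := fun i => by
    rw [pairRight_apply, MonoidalCategory.tensorHom_def]
    simp
    rfl
  have e : ∑ i, y ≫ M.X ◁ ((vecUnitCopower C V).proj i ≫ vecIns V (Module.finBasis k V i)) =
      y := by
    rw [← Preadditive.comp_sum, ← whiskerLeft_sum, (vecUnitCopower C V).total,
      MonoidalCategory.whiskerLeft_id, Category.comp_id]
  exact (Finset.sum_congr rfl fun i _ => h i).trans e

/-- The structure isomorphism `V ⊗ Hom(Y, X) ≅ Hom(Y, (V ⊗ 𝟙) ⊗ X)`. -/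
def lineatorLeftIso (V : FDRep k G) (M : Equivariantization A) :
    tensorLeft V (homRep Y c M) ≅ homRep Y c (embedObj A V ⊗ M) :=
  isoOfLin (lineatorLeft Y c V M)
    (unpairLeft Y c V M ∘ₗ (homEquiv Y c (embedObj A V ⊗ M)).toLinearMap)
    (LinearMap.congr_fun (g := LinearMap.id) <|
      tensorLeft_ext (φ := (_ ∘ₗ _) ∘ₗ lin (lineatorLeft Y c V M)) fun v m => by
      obtain ⟨y, rfl⟩ := (homEquiv Y c M).symm.surjective m
      rw [LinearMap.comp_apply, lin_lineatorLeft, LinearMap.comp_apply, LinearEquiv.coe_coe,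
        LinearEquiv.apply_symm_apply, unpairLeft_apply]
      simp only [pairLeft_proj, map_smul]
      exact tmulLeft_smul_basis Y c V M v _)
    fun x => by
      obtain ⟨y, rfl⟩ := (homEquiv Y c _).symm.surjective x
      rw [LinearMap.comp_apply, LinearEquiv.coe_coe, LinearEquiv.apply_symm_apply,
        unpairLeft_apply, map_sum]
      simp only [lin_lineatorLeft]
      rw [← map_sum]
      exact congrArg _ (sum_pairLeft Y V M y)

/-- The structure isomorphism `Hom(Y, X) ⊗ V ≅ Hom(Y, X ⊗ (V ⊗ 𝟙))`. -/
def lineatorRightIso (M : Equivariantization A) (V : FDRep k G) :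
    tensorRight (homRep Y c M) V ≅ homRep Y c (M ⊗ embedObj A V) :=
  isoOfLin (lineatorRight Y c M V)
    (unpairRight Y c M V ∘ₗ (homEquiv Y c (M ⊗ embedObj A V)).toLinearMap)
    (LinearMap.congr_fun (g := LinearMap.id) <|
      tensorRight_ext (φ := (_ ∘ₗ _) ∘ₗ lin (lineatorRight Y c M V)) fun m v => by
      obtain ⟨y, rfl⟩ := (homEquiv Y c M).symm.surjective m
      rw [LinearMap.comp_apply, lin_lineatorRight, LinearMap.comp_apply, LinearEquiv.coe_coe,
        LinearEquiv.apply_symm_apply, unpairRight_apply]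
      simp only [pairRight_proj, map_smul]
      exact tmulRight_smul_basis Y c V M v _)
    fun x => by
      obtain ⟨y, rfl⟩ := (homEquiv Y c _).symm.surjective x
      rw [LinearMap.comp_apply, LinearEquiv.coe_coe, LinearEquiv.apply_symm_apply,
        unpairRight_apply, map_sum]
      simp only [lin_lineatorRight]
      rw [← map_sum]
      exact congrArg _ (sum_pairRight Y V M y)

end Lineator

/-! ### Module functors from invertible structure morphisms, and functors into products. -/

section LinearOfIso

open Functor

variable {D D' : Type*} [Category* D] [Category* D'] {B : Type*} [Category* B]
  [MonoidalCategory B]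

/-- A left linear structure from invertible structure morphisms. -/
@[reducible]
def leftLinearOfIso [MonoidalLeftAction B D] [MonoidalLeftAction B D'] (F : D ⥤ D')
    (μ : ∀ (b : B) (d : D), b ⊙ₗ F.obj d ≅ F.obj (b ⊙ₗ d))
    (nl : ∀ {b b' : B} (f : b ⟶ b') (d : D),
      f ⊵ₗ F.obj d ≫ (μ b' d).hom = (μ b d).hom ≫ F.map (f ⊵ₗ d))
    (nr : ∀ (b : B) {d d' : D} (f : d ⟶ d'),
      b ⊴ₗ F.map f ≫ (μ b d').hom = (μ b d).hom ≫ F.map (b ⊴ₗ f))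
    (as : ∀ (b b' : B) (d : D), (μ (b ⊗ b') d).hom ≫ F.map (αₗ _ _ _).hom =
      (αₗ b b' (F.obj d)).hom ≫ b ⊴ₗ (μ b' d).hom ≫ (μ b (b' ⊙ₗ d)).hom)
    (un : ∀ d : D, (λₗ (F.obj d)).hom = (μ (𝟙_ B) d).hom ≫ F.map (λₗ d).hom) :
    F.LeftLinear B where
  μₗ b d := (μ b d).hom
  μₗ_naturality_left := nl
  μₗ_naturality_right := nr
  μₗ_associativity := as
  μₗ_unitality := un
  δₗ b d := (μ b d).inv
  δₗ_naturality_left f d := by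
    rw [Iso.eq_inv_comp, ← reassoc_of% nl, Iso.hom_inv_id, Category.comp_id]
  δₗ_naturality_right b _ _ f := by
    rw [Iso.eq_inv_comp, ← reassoc_of% nr, Iso.hom_inv_id, Category.comp_id]
  δₗ_associativity b b' d := by
    rw [Iso.inv_comp_eq, reassoc_of% as, Iso.hom_inv_id_assoc,
      ← MonoidalLeftAction.actionHomRight_comp, Iso.hom_inv_id,
      MonoidalLeftAction.actionHomRight_id, Category.comp_id]
  δₗ_unitality_inv d := by
    rw [← cancel_epi (λₗ[B] (F.obj d)).hom, Iso.hom_inv_id, un, Category.assoc,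
      ← Functor.map_comp_assoc, Iso.hom_inv_id, CategoryTheory.Functor.map_id, Category.id_comp,
      Iso.hom_inv_id]
  μₗ_comp_δₗ b d := (μ b d).hom_inv_id
  δₗ_comp_μₗ b d := (μ b d).inv_hom_id

/-- A right linear structure from invertible structure morphisms. -/
@[reducible]
def rightLinearOfIso [MonoidalRightAction B D] [MonoidalRightAction B D'] (F : D ⥤ D')
    (μ : ∀ (d : D) (b : B), F.obj d ⊙ᵣ b ≅ F.obj (d ⊙ᵣ b))
    (nr : ∀ (d : D) {b b' : B} (f : b ⟶ b'),
      F.obj d ⊴ᵣ f ≫ (μ d b').hom = (μ d b).hom ≫ F.map (d ⊴ᵣ f))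
    (nl : ∀ {d d' : D} (f : d ⟶ d') (b : B),
      F.map f ⊵ᵣ b ≫ (μ d' b).hom = (μ d b).hom ≫ F.map (f ⊵ᵣ b))
    (as : ∀ (d : D) (b b' : B), (μ d (b ⊗ b')).hom ≫ F.map (αᵣ _ _ _).hom =
      (αᵣ (F.obj d) b b').hom ≫ (μ d b).hom ⊵ᵣ b' ≫ (μ (d ⊙ᵣ b) b').hom)
    (un : ∀ d : D, (ρᵣ (F.obj d)).hom = (μ d (𝟙_ B)).hom ≫ F.map (ρᵣ d).hom) :
    F.RightLinear B where
  μᵣ d b := (μ d b).hom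
  μᵣ_naturality_left := nl
  μᵣ_naturality_right := nr
  μᵣ_associativity := as
  μᵣ_unitality := un
  δᵣ d b := (μ d b).inv
  δᵣ_naturality_left f d := by
    rw [Iso.eq_inv_comp, ← reassoc_of% nl, Iso.hom_inv_id, Category.comp_id]
  δᵣ_naturality_right b _ _ f := by
    rw [Iso.eq_inv_comp, ← reassoc_of% nr, Iso.hom_inv_id, Category.comp_id]
  δᵣ_associativity d b b' := by
    rw [Iso.inv_comp_eq, reassoc_of% as, Iso.hom_inv_id_assoc,
      ← MonoidalRightAction.comp_actionHomLeft, Iso.hom_inv_id,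
      MonoidalRightAction.id_actionHomLeft, Category.comp_id]
  δᵣ_unitality_inv d := by
    rw [← cancel_epi (ρᵣ[B] (F.obj d)).hom, Iso.hom_inv_id, un, Category.assoc,
      ← Functor.map_comp_assoc, Iso.hom_inv_id, CategoryTheory.Functor.map_id, Category.id_comp,
      Iso.hom_inv_id]
  μᵣ_comp_δᵣ d b := (μ d b).hom_inv_id
  δᵣ_comp_μᵣ d b := (μ d b).inv_hom_id

variable {I : Type*} {N : I → Type*} [∀ i, Category* (N i)]

instance piLeftLinear [MonoidalLeftAction B D] [∀ i, MonoidalLeftAction B (N i)]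
    (F : ∀ i, D ⥤ N i) [∀ i, (F i).LeftLinear B] : (Functor.pi' F).LeftLinear B :=
  leftLinearOfIso _ (fun b d => Pi.isoMk fun i => LeftLinear.μₗIso (F i) b d)
    (fun f d => funext fun i => LaxLeftLinear.μₗ_naturality_left (F i) f d)
    (fun b _ _ f => funext fun i => LaxLeftLinear.μₗ_naturality_right (F i) b f)
    (fun b b' d => funext fun i => LaxLeftLinear.μₗ_associativity (F i) b b' d)
    (fun d => funext fun i => LaxLeftLinear.μₗ_unitality (F i) d)

instance piRightLinear [MonoidalRightAction B D] [∀ i, MonoidalRightAction B (N i)]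
    (F : ∀ i, D ⥤ N i) [∀ i, (F i).RightLinear B] : (Functor.pi' F).RightLinear B :=
  rightLinearOfIso _ (fun d b => Pi.isoMk fun i => RightLinear.μᵣIso (F i) d b)
    (fun d _ _ f => funext fun i => LaxRightLinear.μᵣ_naturality_right (F i) d f)
    (fun f b => funext fun i => LaxRightLinear.μᵣ_naturality_left (F i) f b)
    (fun d b b' => funext fun i => LaxRightLinear.μᵣ_associativity (F i) d b b')
    (fun d => funext fun i => LaxRightLinear.μᵣ_unitality (F i) d)

end LinearOfIso

/-! ### Coherence of the structure morphisms of `Hom(Y, -)`. -/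

section BimoduleFunctor

open Functor.LaxMonoidal Functor.OplaxMonoidal ProjRep

variable {k : Type u} [Field k] [IsAlgClosed k] {G : Type w} [Group G] {C : Type uC}
  [Category.{v} C] [Abelian C] [Linear k C] [MonoidalCategory C] [MonoidalPreadditive C]
  [MonoidalLinear k C] [RigidCategory C] [FusionCategory k C]
  {A : TensorAction k G C} (Y : C) [Simple Y] (c : ∀ g : A.inertia Y, (A.ρ g).obj Y ≅ Y)

/-- The module associators of `C^G` are built from the inverse of the monoidal structure morphism of
`rep G ⥤ C^G`, so its value on pure tensors is what the pentagon needs. -/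
lemma vecIns_tensor_inv (V W : FDRep k G) (x : V) (y : W) :
    vecIns (V ⊗ W) (TensorProduct.tmul k x y : TensorProduct k V W) ≫ (vecTensor (C := C) V W).inv =
      (λ_ (𝟙_ C)).inv ≫ (vecIns V x ⊗ₘ vecIns W y) := by
  rw [Iso.comp_inv_eq, Category.assoc, vecTensor_hom, vecIns_tensor, Iso.inv_hom_id_assoc]

lemma vecIns_unit_inv (r : k) :
    vecIns (𝟙_ (FDRep k G)) r ≫ (vecUnitIso (C := C)).inv = r • 𝟙 (𝟙_ C) :=
  (vecUnitCopower C (𝟙_ (FDRep k G))).ins_desc _ r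

/-- This and the lemmas up to `pair_middle` are the naturality, pentagon, triangle and middle
conditions for the pairings, as equations between morphisms of `C` out of `Y`. Transported along
`homEquiv`, they become the module functor axioms. -/
lemma pairLeft_whiskerRight {V V' : FDRep k G} (f : V ⟶ V') (M : Equivariantization A) (v : V)
    (y : Y ⟶ M.X) :
    pairLeft Y V' M (RepLin.lin f v) y = pairLeft Y V M v y ≫ ((embed A).map f ▷ M).hom := by
  change (λ_ Y).inv ≫ (vecIns V' (RepLin.lin f v) ⊗ₘ y) =
    ((λ_ Y).inv ≫ (vecIns V v ⊗ₘ y)) ≫ (vecMap f ⊗ₘ 𝟙 M.X)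
  rw [Category.assoc, tensorHom_comp_tensorHom, vecIns_map, Category.comp_id]

lemma pairLeft_whiskerLeft (V : FDRep k G) {M M' : Equivariantization A} (f : M ⟶ M') (v : V)
    (y : Y ⟶ M.X) :
    pairLeft Y V M' v (y ≫ f.hom) = pairLeft Y V M v y ≫ (embedObj A V ◁ f).hom := by
  change (λ_ Y).inv ≫ (vecIns V v ⊗ₘ y ≫ f.hom) =
    ((λ_ Y).inv ≫ (vecIns V v ⊗ₘ y)) ≫ (𝟙 (vecUnit C V) ⊗ₘ f.hom)
  rw [Category.assoc, tensorHom_comp_tensorHom, Category.comp_id]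

lemma pairRight_whiskerRight {M M' : Equivariantization A} (f : M ⟶ M') (V : FDRep k G) (v : V)
    (y : Y ⟶ M.X) :
    pairRight Y M' V (y ≫ f.hom) v = pairRight Y M V y v ≫ (f ▷ embedObj A V).hom := by
  change (ρ_ Y).inv ≫ (y ≫ f.hom ⊗ₘ vecIns V v) =
    ((ρ_ Y).inv ≫ (y ⊗ₘ vecIns V v)) ≫ (f.hom ⊗ₘ 𝟙 (vecUnit C V))
  rw [Category.assoc, tensorHom_comp_tensorHom, Category.comp_id]

lemma pairRight_whiskerLeft (M : Equivariantization A) {V V' : FDRep k G} (f : V ⟶ V') (v : V)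
    (y : Y ⟶ M.X) :
    pairRight Y M V' y (RepLin.lin f v) = pairRight Y M V y v ≫ (M ◁ (embed A).map f).hom := by
  change (ρ_ Y).inv ≫ (y ⊗ₘ vecIns V' (RepLin.lin f v)) =
    ((ρ_ Y).inv ≫ (y ⊗ₘ vecIns V v)) ≫ (𝟙 M.X ⊗ₘ vecMap f)
  rw [Category.assoc, tensorHom_comp_tensorHom, vecIns_map, Category.comp_id]

lemma pairLeft_tensor (V V' : FDRep k G) (M : Equivariantization A) (v : V) (v' : V')
    (y : Y ⟶ M.X) :
    pairLeft Y (V ⊗ V') M (TensorProduct.tmul k v v' : TensorProduct k V V') y ≫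
      (αₗ V V' M).hom.hom = pairLeft Y V (V' ⊙ₗ M) v (pairLeft Y V' M v' y) := by
  change ((λ_ Y).inv ≫ (vecIns (V ⊗ V') (TensorProduct.tmul k v v' : TensorProduct k V V') ⊗ₘ y)) ≫
    ((vecTensor V V').inv ⊗ₘ 𝟙 M.X) ≫ (α_ _ _ _).hom =
    (λ_ Y).inv ≫ (vecIns V v ⊗ₘ ((λ_ Y).inv ≫ (vecIns V' v' ⊗ₘ y)))
  rw [Category.assoc, tensorHom_comp_tensorHom_assoc, vecIns_tensor_inv, Category.comp_id]
  simp [MonoidalCategory.tensorHom_def]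

lemma pairRight_tensor (M : Equivariantization A) (V V' : FDRep k G) (v : V) (v' : V')
    (y : Y ⟶ M.X) :
    pairRight Y M (V ⊗ V') y (TensorProduct.tmul k v v' : TensorProduct k V V') ≫
      (αᵣ M V V').hom.hom = pairRight Y (M ⊙ᵣ V) V' (pairRight Y M V y v) v' := by
  change ((ρ_ Y).inv ≫ (y ⊗ₘ vecIns (V ⊗ V') (TensorProduct.tmul k v v' : TensorProduct k V V'))) ≫
    (𝟙 M.X ⊗ₘ (vecTensor V V').inv) ≫ (α_ _ _ _).inv =
    (ρ_ Y).inv ≫ (((ρ_ Y).inv ≫ (y ⊗ₘ vecIns V v)) ⊗ₘ vecIns V' v')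
  rw [Category.assoc, tensorHom_comp_tensorHom_assoc, vecIns_tensor_inv, Category.comp_id]
  simp [MonoidalCategory.tensorHom_def]

lemma pairLeft_unit (M : Equivariantization A) (r : k) (y : Y ⟶ M.X) :
    pairLeft Y (𝟙_ (FDRep k G)) M r y ≫ (λₗ[FDRep k G] M).hom.hom = r • y := by
  change ((λ_ Y).inv ≫ (vecIns (𝟙_ (FDRep k G)) r ⊗ₘ y)) ≫
    (vecUnitIso.inv ⊗ₘ 𝟙 M.X) ≫ (λ_ M.X).hom = _
  rw [Category.assoc, tensorHom_comp_tensorHom_assoc, vecIns_unit_inv, Category.comp_id]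
  simp [MonoidalCategory.tensorHom_def]

lemma pairRight_unit (M : Equivariantization A) (r : k) (y : Y ⟶ M.X) :
    pairRight Y M (𝟙_ (FDRep k G)) y r ≫ (ρᵣ[FDRep k G] M).hom.hom = r • y := by
  change ((ρ_ Y).inv ≫ (y ⊗ₘ vecIns (𝟙_ (FDRep k G)) r)) ≫
    (𝟙 M.X ⊗ₘ vecUnitIso.inv) ≫ (ρ_ M.X).hom = _
  rw [Category.assoc, tensorHom_comp_tensorHom_assoc, vecIns_unit_inv, Category.comp_id]
  simp [tensorHom_def']

/-- The middle isomorphism of `C^G` is the associator of `C`, so this is its naturality combined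
with the coherence of the unitors. -/
lemma pair_middle (V : FDRep k G) (M : Equivariantization A) (W : FDRep k G) (v : V) (w : W)
    (y : Y ⟶ M.X) :
    pairRight Y (V ⊙ₗ M) W (pairLeft Y V M v y) w ≫ (BimoduleCategory.middle k V M W).hom.hom =
      pairLeft Y V (M ⊙ᵣ W) v (pairRight Y M W y w) := by
  change ((ρ_ Y).inv ≫ (((λ_ Y).inv ≫ (vecIns V v ⊗ₘ y)) ⊗ₘ vecIns W w)) ≫ (α_ _ _ _).hom =
    (λ_ Y).inv ≫ (vecIns V v ⊗ₘ ((ρ_ Y).inv ≫ (y ⊗ₘ vecIns W w)))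
  simp [MonoidalCategory.tensorHom_def]

/-- A morphism out of `(V ⊗ V') ⊗ Hom(Y, X)` is determined by its values on pure tensors. -/
lemma tensorLeft_tensor_homRep_ext {V V' : FDRep k G} {M : Equivariantization A}
    {N : ProjRep k (factorSet A Y c)} {f f' : tensorLeft (V ⊗ V') (homRep Y c M) ⟶ N}
    (h : ∀ (v : V) (v' : V') (y : Y ⟶ M.X),
      lin f (tmulLeft (V := V ⊗ V') (TensorProduct.tmul k v v' : TensorProduct k V V')
        ((homEquiv Y c M).symm y)) =
      lin f' (tmulLeft (V := V ⊗ V') (TensorProduct.tmul k v v' : TensorProduct k V V')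
        ((homEquiv Y c M).symm y))) : f = f' :=
  lin_ext <| LinearMap.congr_fun <| TensorProduct.ext_threefold (M := V) (N := V')
    (P := (homRep Y c M).V) fun v v' m => by
      obtain ⟨y, rfl⟩ := (homEquiv Y c M).symm.surjective m
      exact h v v' y

/-- A morphism out of `Hom(Y, X) ⊗ (V ⊗ V')` is determined by its values on pure tensors. -/
lemma tensorRight_tensor_homRep_ext {V V' : FDRep k G} {M : Equivariantization A}
    {N : ProjRep k (factorSet A Y c)} {f f' : tensorRight (homRep Y c M) (V ⊗ V') ⟶ N}
    (h : ∀ (v : V) (v' : V') (y : Y ⟶ M.X),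
      lin f (tmulRight (V := V ⊗ V') ((homEquiv Y c M).symm y)
        (TensorProduct.tmul k v v' : TensorProduct k V V')) =
      lin f' (tmulRight (V := V ⊗ V') ((homEquiv Y c M).symm y)
        (TensorProduct.tmul k v v' : TensorProduct k V V'))) : f = f' :=
  lin_ext <| LinearMap.congr_fun <| TensorProduct.ext <| LinearMap.ext fun m =>
    TensorProduct.ext' (M := V) (N := V') fun v v' => by
      obtain ⟨y, rfl⟩ := (homEquiv Y c M).symm.surjective m
      exact h v v' y

lemma lin_actionUnitLeft {M : ProjRep k (factorSet A Y c)} (r : k) (m : M.V) :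
    lin (λₗ[FDRep k G] M).hom (tmulLeft (V := 𝟙_ (FDRep k G)) r m) = r • m := rfl

lemma lin_actionUnitRight {M : ProjRep k (factorSet A Y c)} (r : k) (m : M.V) :
    lin (ρᵣ[FDRep k G] M).hom (tmulRight (V := 𝟙_ (FDRep k G)) m r) = r • m := rfl

lemma lineatorLeft_unit (M : Equivariantization A) :
    (λₗ[FDRep k G] (homRep Y c M)).hom =
      lineatorLeft Y c (𝟙_ (FDRep k G)) M ≫ homRepMap Y c (λₗ[FDRep k G] M).hom := by
  refine tensorLeft_homRep_ext Y c fun r y => ?_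
  rw [lin_comp, lin_lineatorLeft]
  refine (lin_actionUnitLeft Y c r _).trans ?_
  refine Eq.trans ?_ (lin_homRepMap Y c (λₗ[FDRep k G] M).hom _).symm
  exact ((homEquiv Y c M).symm.map_smul (r : k) y).symm.trans
    (congrArg (homEquiv Y c M).symm (pairLeft_unit Y M r y)).symm

lemma lineatorRight_unit (M : Equivariantization A) :
    (ρᵣ[FDRep k G] (homRep Y c M)).hom =
      lineatorRight Y c M (𝟙_ (FDRep k G)) ≫ homRepMap Y c (ρᵣ[FDRep k G] M).hom := by
  refine tensorRight_homRep_ext Y c fun r y => ?_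
  rw [lin_comp, lin_lineatorRight]
  refine (lin_actionUnitRight Y c r _).trans ?_
  refine Eq.trans ?_ (lin_homRepMap Y c (ρᵣ[FDRep k G] M).hom _).symm
  exact ((homEquiv Y c M).symm.map_smul (r : k) y).symm.trans
    (congrArg (homEquiv Y c M).symm (pairRight_unit Y M r y)).symm

lemma lin_actionAssocLeft {M : ProjRep k (factorSet A Y c)} {V V' : FDRep k G} (v : V) (v' : V')
    (m : M.V) :
    lin (αₗ V V' M).hom (tmulLeft (V := V ⊗ V') (TensorProduct.tmul k v v' : TensorProduct k V V')
      m) = tmulLeft (M := V' ⊙ₗ M) v (tmulLeft v' m) := rfl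

lemma lin_actionAssocRight {M : ProjRep k (factorSet A Y c)} {V V' : FDRep k G} (v : V) (v' : V')
    (m : M.V) :
    lin (αᵣ M V V').hom (tmulRight (V := V ⊗ V') m
      (TensorProduct.tmul k v v' : TensorProduct k V V')) =
      tmulRight (M := M ⊙ᵣ V) (tmulRight m v) v' := rfl

lemma lin_actionHomRight {M N : ProjRep k (factorSet A Y c)} {V : FDRep k G} (f : M ⟶ N) (v : V)
    (m : M.V) : lin (V ⊴ₗ f) (tmulLeft v m) = tmulLeft v (lin f m) := rfl

lemma lin_actionHomLeft {M N : ProjRep k (factorSet A Y c)} {V : FDRep k G} (f : M ⟶ N) (v : V)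
    (m : M.V) : lin (f ⊵ᵣ V) (tmulRight m v) = tmulRight (lin f m) v := rfl

lemma lineatorLeft_assoc (V V' : FDRep k G) (M : Equivariantization A) :
    lineatorLeft Y c (V ⊗ V') M ≫ homRepMap Y c (αₗ V V' M).hom =
      (αₗ V V' (homRep Y c M)).hom ≫ V ⊴ₗ lineatorLeft Y c V' M ≫
        lineatorLeft Y c V (V' ⊙ₗ M) := by
  refine tensorLeft_tensor_homRep_ext Y c fun v v' y => ?_
  rw [lin_comp, lin_lineatorLeft]
  refine (lin_homRepMap Y c (αₗ V V' M).hom _).trans ?_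
  refine (congrArg _ (pairLeft_tensor Y V V' M v v' y)).trans ?_
  refine (lin_lineatorLeft Y c V (V' ⊙ₗ M) v (pairLeft Y V' M v' y)).symm.trans ?_
  refine congrArg (lin (lineatorLeft Y c V (V' ⊙ₗ M))) (?_ : _ =
    lin (V ⊴ₗ lineatorLeft Y c V' M) (lin (αₗ V V' (homRep Y c M)).hom _))
  rw [lin_actionAssocLeft]
  refine Eq.trans ?_ (lin_actionHomRight Y c (lineatorLeft Y c V' M) v _).symm
  rw [lin_lineatorLeft]
  rfl

lemma lineatorRight_assoc (M : Equivariantization A) (V V' : FDRep k G) :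
    lineatorRight Y c M (V ⊗ V') ≫ homRepMap Y c (αᵣ M V V').hom =
      (αᵣ (homRep Y c M) V V').hom ≫ lineatorRight Y c M V ⊵ᵣ V' ≫
        lineatorRight Y c (M ⊙ᵣ V) V' := by
  refine tensorRight_tensor_homRep_ext Y c fun v v' y => ?_
  rw [lin_comp, lin_lineatorRight]
  refine (lin_homRepMap Y c (αᵣ M V V').hom _).trans ?_
  refine (congrArg _ (pairRight_tensor Y M V V' v v' y)).trans ?_
  refine (lin_lineatorRight Y c V' (M ⊙ᵣ V) v' (pairRight Y M V y v)).symm.trans ?_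
  refine congrArg (lin (lineatorRight Y c (M ⊙ᵣ V) V')) (?_ : _ =
    lin (lineatorRight Y c M V ⊵ᵣ V') (lin (αᵣ (homRep Y c M) V V').hom _))
  rw [lin_actionAssocRight]
  refine Eq.trans ?_ (lin_actionHomLeft Y c (lineatorRight Y c M V) v' _).symm
  rw [lin_lineatorRight]
  rfl

instance homFunctorLeftLinear : (homFunctor Y c).LeftLinear (FDRep k G) :=
  leftLinearOfIso _ (lineatorLeftIso Y c)
    (fun {V V'} f M => tensorLeft_homRep_ext Y c fun v y =>
      (lin_lineatorLeft Y c V' M (RepLin.lin f v) y).trans <|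
      (congrArg _ (pairLeft_whiskerRight Y f M v y)).trans <|
      (lin_homRepMap Y c ((embed A).map f ▷ M) (pairLeft Y V M v y)).symm.trans <|
      (congrArg _ (lin_lineatorLeft Y c V M v y)).symm)
    (fun V {M M'} f => tensorLeft_homRep_ext Y c fun v y =>
      (congrArg (fun t => lin (lineatorLeft Y c V M') (tmulLeft v t))
        (lin_homRepMap Y c f y)).trans <|
      (lin_lineatorLeft Y c V M' v (y ≫ f.hom)).trans <|
      (congrArg _ (pairLeft_whiskerLeft Y V f v y)).trans <|
      (lin_homRepMap Y c (embedObj A V ◁ f) (pairLeft Y V M v y)).symm.trans <|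
      (congrArg _ (lin_lineatorLeft Y c V M v y)).symm)
    (lineatorLeft_assoc Y c)
    (lineatorLeft_unit Y c)

instance homFunctorRightLinear : (homFunctor Y c).RightLinear (FDRep k G) :=
  rightLinearOfIso _ (lineatorRightIso Y c)
    (fun M {V V'} f => tensorRight_homRep_ext Y c fun v y =>
      (lin_lineatorRight Y c V' M (RepLin.lin f v) y).trans <|
      (congrArg _ (pairRight_whiskerLeft Y M f v y)).trans <|
      (lin_homRepMap Y c (M ◁ (embed A).map f) (pairRight Y M V y v)).symm.trans <|
      (congrArg _ (lin_lineatorRight Y c V M v y)).symm)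
    (fun {M M'} f V => tensorRight_homRep_ext Y c fun v y =>
      (congrArg (fun t => lin (lineatorRight Y c M' V) (tmulRight t v))
        (lin_homRepMap Y c f y)).trans <|
      (lin_lineatorRight Y c V M' v (y ≫ f.hom)).trans <|
      (congrArg _ (pairRight_whiskerRight Y f V v y)).trans <|
      (lin_homRepMap Y c (f ▷ embedObj A V) (pairRight Y M V y v)).symm.trans <|
      (congrArg _ (lin_lineatorRight Y c V M v y)).symm)
    (lineatorRight_assoc Y c)
    (lineatorRight_unit Y c)

/-- The left and right structure morphisms of `Hom(Y, -)` are compatible. -/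
lemma homFunctor_middle (V : FDRep k G) (M : Equivariantization A) (W : FDRep k G) :
    (lineatorLeft Y c V M) ⊵ᵣ W ≫ lineatorRight Y c (V ⊙ₗ M) W ≫
        (homFunctor Y c).map (BimoduleCategory.middle k V M W).hom =
      (BimoduleCategory.middle k V (homRep Y c M) W).hom ≫
        V ⊴ₗ lineatorRight Y c M W ≫ lineatorLeft Y c V (M ⊙ᵣ W) :=
  lin_ext <| LinearMap.congr_fun <| TensorProduct.ext_threefold (M := V) (N := (homRep Y c M).V)
    (P := W) fun v m w => by
      obtain ⟨y, rfl⟩ := (homEquiv Y c M).symm.surjective m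
      have h1 : lin (lineatorRight Y c (V ⊙ₗ M) W)
          (tmulRight (lin (lineatorLeft Y c V M) (tmulLeft v ((homEquiv Y c M).symm y))) w) =
          (homEquiv Y c _).symm (pairRight Y (V ⊙ₗ M) W (pairLeft Y V M v y) w) := by
        rw [lin_lineatorLeft]
        exact lin_lineatorRight Y c W (V ⊙ₗ M) w _
      have h2 : lin (lineatorLeft Y c V (M ⊙ᵣ W))
          (tmulLeft v (lin (lineatorRight Y c M W) (tmulRight ((homEquiv Y c M).symm y) w))) =
          (homEquiv Y c _).symm (pairLeft Y V (M ⊙ᵣ W) v (pairRight Y M W y w)) := by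
        rw [lin_lineatorRight]
        exact lin_lineatorLeft Y c V (M ⊙ᵣ W) v _
      exact (congrArg _ h1).trans <| (lin_homRepMap Y c _ _).trans <|
        (congrArg _ (pair_middle Y V M W v w y)).trans h2.symm

end BimoduleFunctor

/-! ### Semisimplicity -/

section Semisimple

variable (k : Type u) [Field k] {C : Type uC} [Category.{v} C] [Abelian C] [Linear k C]
  [MonoidalCategory C] [MonoidalPreadditive C] [MonoidalLinear k C] [RigidCategory C]

/-- Every object is a direct sum of simple objects. -/
lemma exists_simple_decomposition [FusionCategory k C] (X : C) :
    ∃ (n : ℕ) (S : Fin n → C) (ι : ∀ i, S i ⟶ X) (π : ∀ i, X ⟶ S i),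
      (∀ i, Simple (S i)) ∧ ∑ i, π i ≫ ι i = 𝟙 X := by
  obtain ⟨n, S, hS, ⟨e⟩⟩ := FusionCategory.semisimple (k := k) X
  refine ⟨n, S, fun i => biproduct.ι S i ≫ e.inv, fun i => e.hom ≫ biproduct.π S i, hS, ?_⟩
  have h : ∀ i, (e.hom ≫ biproduct.π S i) ≫ biproduct.ι S i ≫ e.inv =
      e.hom ≫ (biproduct.π S i ≫ biproduct.ι S i) ≫ e.inv := fun i => by simp
  simp_rw [h]
  rw [← Preadditive.comp_sum, ← Preadditive.sum_comp, biproduct.total, Category.id_comp,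
    Iso.hom_inv_id]

/-- Morphisms agreeing on all simple subobjects are equal. -/
lemma hom_ext_simple [FusionCategory k C] {X Z : C} {f g : X ⟶ Z}
    (h : ∀ (S : C) [Simple S] (t : S ⟶ X), t ≫ f = t ≫ g) : f = g := by
  obtain ⟨n, S, ι, π, hS, hsum⟩ := exists_simple_decomposition k X
  rw [← Category.id_comp f, ← Category.id_comp g, ← hsum, Preadditive.sum_comp,
    Preadditive.sum_comp]
  refine Finset.sum_congr rfl fun i _ => ?_
  have := hS i
  rw [Category.assoc, Category.assoc, h]

/-- Schur's lemma: a morphism between isomorphic simple objects is a multiple of an isomorphism. -/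
lemma exists_smul_iso [IsAlgClosed k] [FusionCategory k C] {S T : C} [Simple S] (e : S ≅ T) (f : S ⟶ T) :
    ∃ r : k, f = r • e.hom := by
  obtain ⟨r, hr⟩ := endomorphism_simple_eq_smul_id k (f ≫ e.inv)
  refine ⟨r, ?_⟩
  rw [← Category.comp_id f, ← e.inv_hom_id, ← Category.assoc, ← hr, Linear.smul_comp,
    Category.id_comp]

/-- Schur's lemma: a morphism between non-isomorphic simple objects vanishes. -/
lemma eq_zero_of_isEmpty_iso {S T : C} [Simple S] [Simple T] (h : IsEmpty (S ≅ T)) (f : S ⟶ T) :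
    f = 0 := by
  by_contra hf
  have := isIso_of_hom_simple hf
  exact h.elim (asIso f)

variable (C) in
lemma finite_irr [FusionCategory k C] : Finite (Irr C) := by
  obtain ⟨n, S, hS⟩ := FusionCategory.finite_simples (k := k) (C := C)
  choose i hi using fun T : SimpleObj C => hS T.1 T.2
  have hinj : Function.Injective (fun x : Irr C => i x.out) := fun x x' h => by
    rw [← Quotient.out_eq x, ← Quotient.out_eq x']
    obtain ⟨e⟩ := hi x.out
    obtain ⟨e'⟩ := hi x'.out
    refine Quotient.sound (s := simpleSetoid C) ⟨e ≪≫ eqToIso (congrArg S h) ≪≫ e'.symm⟩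
  exact Finite.of_injective _ hinj

variable {k} in
/-- For pairwise non-isomorphic simple objects `Y j`, a family of linear maps
`Hom(Y j, X) → Hom(Y j, Z)` is induced by a morphism `X ⟶ Z` that vanishes on the other isotypic
components. -/
lemma exists_hom_of_family [IsAlgClosed k] [FusionCategory k C] {J : Type*} (Y : J → C) [∀ j, Simple (Y j)]
    (hY : ∀ i j, Nonempty (Y i ≅ Y j) → i = j) (X Z : C)
    (ψ : ∀ j, (Y j ⟶ X) →ₗ[k] (Y j ⟶ Z)) :
    ∃ f : X ⟶ Z, (∀ j (y : Y j ⟶ X), y ≫ f = ψ j y) ∧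
      ∀ (S : C) [Simple S], (∀ j, IsEmpty (S ≅ Y j)) → ∀ t : S ⟶ X, t ≫ f = 0 := by
  obtain ⟨n, S, ι, π, hS, hsum⟩ := exists_simple_decomposition k X
  have key : ∀ i, ∃ f : S i ⟶ Z, (∀ j (a : Y j ⟶ S i), a ≫ f = ψ j (a ≫ ι i)) ∧
      ∀ (T : C) [Simple T], (∀ j, IsEmpty (T ≅ Y j)) → ∀ t : T ⟶ S i, t ≫ f = 0 := by
    intro i
    have := hS i
    -- It suffices to define `f` on each simple summand `S i`. If `e : Y j ≅ S i`, the value is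
    -- forced to be `e⁻¹` followed by `ψ j (e ≫ ι i)`; every `Y j ⟶ S i` is a multiple of `e`, so
    -- linearity of `ψ j` does the rest. The index `j` is unique, and all other simple objects in
    -- question have no nonzero morphism to `S i`. If there is no such `j`, zero works.
    by_cases h : ∃ j, Nonempty (Y j ≅ S i)
    · obtain ⟨j, ⟨e⟩⟩ := h
      refine ⟨e.inv ≫ ψ j (e.hom ≫ ι i), fun j' a => ?_, fun T _ hT t => ?_⟩
      · by_cases hjj : j' = j
        · subst hjj
          obtain ⟨r, rfl⟩ := exists_smul_iso k e a
          simp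
        · rw [eq_zero_of_isEmpty_iso ⟨fun e' => hjj (hY _ _ ⟨e' ≪≫ e.symm⟩)⟩ a]
          simp
      · rw [eq_zero_of_isEmpty_iso ⟨fun e' => (hT j).elim (e' ≪≫ e.symm)⟩ t, zero_comp]
    · refine ⟨0, fun j a => ?_, fun T _ _ t => comp_zero⟩
      rw [eq_zero_of_isEmpty_iso ⟨fun e => h ⟨j, ⟨e⟩⟩⟩ a]
      simp
  choose f hf hf' using key
  refine ⟨∑ i, π i ≫ f i, fun j y => ?_, fun T _ hT t => ?_⟩
  · conv_rhs => rw [← Category.comp_id y, ← hsum, Preadditive.comp_sum, map_sum]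
    rw [Preadditive.comp_sum]
    exact Finset.sum_congr rfl fun i _ => by rw [← Category.assoc, hf, Category.assoc]
  · rw [Preadditive.comp_sum]
    exact Finset.sum_eq_zero fun i _ => by rw [← Category.assoc, hf' i T hT]

end Semisimple

/-! ### Orbits of simple objects -/

section Orbits

variable {k : Type u} [Field k] {G : Type w} [Group G] {C : Type uC}
  [Category.{v} C] [Preadditive C] [Linear k C] [MonoidalCategory C] (A : TensorAction k G C)

lemma orbit_eq_iff (S T : SimpleObj C) :
    A.orbit S = A.orbit T ↔ ∃ g : G, Nonempty ((A.ρ g).obj T.1 ≅ S.1) := by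
  let := A.irrAction
  constructor
  · intro h
    obtain ⟨g, hg⟩ := Quotient.exact (s := MulAction.orbitRel G (Irr C)) h
    exact ⟨g, Quotient.exact (s := simpleSetoid C) hg⟩
  · rintro ⟨g, hg⟩
    exact Quotient.sound (s := MulAction.orbitRel G (Irr C))
      ⟨g, Quotient.sound (s := simpleSetoid C) hg⟩

end Orbits

/-! ### Averaging morphisms and splitting idempotents in the equivariantization -/

namespace Equivariantization

variable {k : Type u} [Field k] {G : Type w} [Group G] {C : Type uC}
  [Category.{v} C] [Preadditive C] [Linear k C] [MonoidalCategory C] {A : TensorAction k G C}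

lemma act_inv_mul (M : Equivariantization A) (h g : G) :
    (A.ρ h).map (M.act g).inv ≫ (A.ρ₂ h g).hom.app M.X = (M.act h).hom ≫ (M.act (h * g)).inv := by
  rw [Iso.eq_comp_inv, Category.assoc, ← M.mul, ← Functor.map_comp_assoc, Iso.inv_hom_id,
    CategoryTheory.Functor.map_id, Category.id_comp]

/-- The average `∑ g, μ'^g ρ^g(f) (μ^g)⁻¹` of a morphism. -/
def avgHom [Fintype G] {M N : Equivariantization A} (f : M.X ⟶ N.X) : M ⟶ N where
  hom := ∑ g, (M.act g).inv ≫ (A.ρ g).map f ≫ (N.act g).hom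
  comm h := by
    rw [Functor.map_sum, Preadditive.sum_comp, Preadditive.comp_sum]
    -- Applying `ρ^h` and `μ^h` turns the conjugate by `g` into the conjugate by `h * g`, so the
    -- summands are only permuted.
    refine (Equiv.sum_comp (Equiv.mulLeft h) fun g =>
      (M.act h).hom ≫ (M.act g).inv ≫ (A.ρ g).map f ≫ (N.act g).hom).symm.trans ?_
    refine Finset.sum_congr rfl fun g _ => ?_
    have hn : (A.ρ h).map ((A.ρ g).map f) ≫ (A.ρ₂ h g).hom.app N.X =
      (A.ρ₂ h g).hom.app M.X ≫ (A.ρ (h * g)).map f := (A.ρ₂ h g).hom.naturality f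
    rw [Equiv.coe_mulLeft, Functor.map_comp, Functor.map_comp, Category.assoc, Category.assoc,
      N.mul, reassoc_of% hn, reassoc_of% act_inv_mul]

/-- An equivariant idempotent `p` is split in `C` as `e ≫ i`, and the image receives the compressed
structure `ρ^g(i) ≫ μ^g ≫ e`. Since `p` commutes with `μ^g`, compression loses nothing: the
structure is invertible, satisfies the axioms, and makes `i` and `e` equivariant. -/
instance [IsIdempotentComplete C] : IsIdempotentComplete (Equivariantization A) where
  idempotents_split M p hp := by
    obtain ⟨X, i, e, hi, he⟩ := IsIdempotentComplete.idempotents_split M.X p.hom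
      (congrArg Hom.hom hp)
    have hpi : i ≫ p.hom = i := by rw [← he, reassoc_of% hi]
    have hpe : p.hom ≫ e = e := by rw [← he, Category.assoc, hi, Category.comp_id]
    have hs : ∀ g, (A.ρ g).map e ≫ (A.ρ g).map i = (A.ρ g).map p.hom := fun g => by
      rw [← Functor.map_comp, he]
    have hs' : ∀ g, (A.ρ g).map i ≫ (A.ρ g).map e = 𝟙 _ := fun g => by
      rw [← Functor.map_comp, hi, CategoryTheory.Functor.map_id]
    have hc : ∀ g, (M.act g).inv ≫ (A.ρ g).map p.hom = p.hom ≫ (M.act g).inv := fun g => by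
      rw [Iso.inv_comp_eq, ← Category.assoc, Iso.eq_comp_inv, p.comm]
    let N : Equivariantization A :=
      { X := X
        act := fun g =>
          { hom := (A.ρ g).map i ≫ (M.act g).hom ≫ e
            inv := i ≫ (M.act g).inv ≫ (A.ρ g).map e
            hom_inv_id := by
              rw [Category.assoc, Category.assoc, reassoc_of% he, ← reassoc_of% hc,
                Iso.hom_inv_id_assoc, ← Functor.map_comp, hpe, hs']
            inv_hom_id := by
              rw [Category.assoc, Category.assoc, reassoc_of% hs, reassoc_of% hc,
                Iso.inv_hom_id_assoc, hpe, hi] }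
        mul := fun g h => by
          have hn : (A.ρ g).map ((A.ρ h).map i) ≫ (A.ρ₂ g h).hom.app M.X =
            (A.ρ₂ g h).hom.app X ≫ (A.ρ (g * h)).map i := (A.ρ₂ g h).hom.naturality i
          change (A.ρ g).map ((A.ρ h).map i ≫ (M.act h).hom ≫ e) ≫ (A.ρ g).map i ≫
            (M.act g).hom ≫ e = (A.ρ₂ g h).hom.app X ≫ (A.ρ (g * h)).map i ≫
              (M.act (g * h)).hom ≫ e
          rw [Functor.map_comp, Functor.map_comp, Category.assoc, Category.assoc,
            reassoc_of% hs, ← Hom.comm_assoc, hpe, ← Category.assoc ((A.ρ g).map (M.act h).hom),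
            M.mul, Category.assoc, reassoc_of% hn]
        unit := by
          have hn : i ≫ A.ρ₀.hom.app M.X = A.ρ₀.hom.app X ≫ (A.ρ 1).map i :=
            A.ρ₀.hom.naturality i
          rw [← reassoc_of% hn, reassoc_of% M.unit, hi] }
    refine ⟨N, ⟨i, fun g => ?_⟩, ⟨e, fun g => ?_⟩, hom_ext hi, hom_ext he⟩
    · change ((A.ρ g).map i ≫ (M.act g).hom ≫ e) ≫ i = _
      rw [Category.assoc, Category.assoc, he, p.comm, ← Functor.map_comp_assoc, hpi]
    · change _ = (A.ρ g).map e ≫ (A.ρ g).map i ≫ (M.act g).hom ≫ e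
      rw [reassoc_of% hs, ← Hom.comm_assoc, hpe]

end Equivariantization

/-- A fully faithful functor from an idempotent complete category has an essential image closed
under retracts. -/
lemma mem_essImage_of_retract {D D' : Type*} [Category* D] [Category* D'] [IsIdempotentComplete D]
    (F : D ⥤ D') [F.Full] [F.Faithful] (M : D) (N : D') (i : N ⟶ F.obj M) (r : F.obj M ⟶ N)
    (hir : i ≫ r = 𝟙 N) : F.essImage N := by
  -- The idempotent `r ≫ i` of `F.obj M` lifts to `M` by fullness, and the lift is idempotent by
  -- faithfulness. The image under `F` of its splitting and `N` both split `r ≫ i`, hence are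
  -- isomorphic.
  obtain ⟨p, hp⟩ := F.map_surjective (r ≫ i)
  obtain ⟨L, s, t, hst, hts⟩ := IsIdempotentComplete.idempotents_split M p (F.map_injective (by
    rw [F.map_comp, hp, Category.assoc, reassoc_of% hir]))
  refine ⟨L, ⟨⟨F.map s ≫ r, i ≫ F.map t, ?_, ?_⟩⟩⟩
  · rw [Category.assoc, ← reassoc_of% hp, ← F.map_comp, ← F.map_comp, ← hts, Category.assoc,
      hst, Category.comp_id, hst, F.map_id]
  · rw [Category.assoc, ← F.map_comp_assoc, hts, hp, Category.assoc, hir, Category.comp_id, hir]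

/-! ### Induced equivariant objects -/

section Induction

variable {k : Type u} [Field k] {G : Type w} [Group G] [Fintype G] {C : Type uC}
  [Category.{v} C] [Preadditive C] [HasFiniteBiproducts C] [Linear k C] [MonoidalCategory C]
  (A : TensorAction k G C)

/-- An additive functor preserves the expression of the identity of a biproduct as a sum over its
summands. Used for `ρ^h` and `ρ^a ρ^b` applied to `⨁ ρ^g X`. -/
lemma map_biproduct_hom_ext {J : Type*} [Fintype J] {D : Type*} [Category* D] [Preadditive D]
    (F : C ⥤ D) [F.Additive] (X : J → C) {Z : D} {f g : F.obj (⨁ X) ⟶ Z}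
    (h : ∀ j, F.map (biproduct.ι X j) ≫ f = F.map (biproduct.ι X j) ≫ g) : f = g := by
  have ht : ∑ j, biproduct.π X j ≫ biproduct.ι X j = 𝟙 (⨁ X) :=
    IsBilimit.total (biproduct.isBilimit X)
  rw [← Category.id_comp f, ← Category.id_comp g, ← F.map_id, ← ht, F.map_sum,
    Preadditive.sum_comp, Preadditive.sum_comp]
  simp only [Functor.map_comp, Category.assoc, h]

/-- The morphism `ρ^h (⨁ ρ^g X) ⟶ ⨁ ρ^g X` permuting the summands. -/
def indActHom (X : C) (h : G) :
    (A.ρ h).obj (⨁ fun g : G => (A.ρ g).obj X) ⟶ ⨁ fun g : G => (A.ρ g).obj X :=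
  ∑ g, (A.ρ h).map (biproduct.π (fun g : G => (A.ρ g).obj X) g) ≫
    (A.ρ₂ h g).hom.app X ≫ biproduct.ι (fun g : G => (A.ρ g).obj X) (h * g)

/-- The inverse of `indActHom`. -/
def indActInv (X : C) (h : G) :
    (⨁ fun g : G => (A.ρ g).obj X) ⟶ (A.ρ h).obj (⨁ fun g : G => (A.ρ g).obj X) :=
  ∑ g, biproduct.π (fun g : G => (A.ρ g).obj X) (h * g) ≫
    (A.ρ₂ h g).inv.app X ≫ (A.ρ h).map (biproduct.ι (fun g : G => (A.ρ g).obj X) g)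

lemma ι_indActHom (X : C) (h g : G) :
    (A.ρ h).map (biproduct.ι (fun g : G => (A.ρ g).obj X) g) ≫ indActHom A X h =
      (A.ρ₂ h g).hom.app X ≫ biproduct.ι (fun g : G => (A.ρ g).obj X) (h * g) := by
  rw [indActHom, Preadditive.comp_sum, Finset.sum_eq_single g]
  · rw [← Functor.map_comp_assoc, biproduct.ι_π_self, CategoryTheory.Functor.map_id]
    exact Category.id_comp _
  · intro g' _ hg
    rw [← Functor.map_comp_assoc, biproduct.ι_π_ne _ hg.symm, Functor.map_zero, zero_comp]
  · simp

lemma ι_indActInv (X : C) (h g : G) :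
    biproduct.ι (fun g : G => (A.ρ g).obj X) (h * g) ≫ indActInv A X h =
      (A.ρ₂ h g).inv.app X ≫ (A.ρ h).map (biproduct.ι (fun g : G => (A.ρ g).obj X) g) := by
  rw [indActInv, Preadditive.comp_sum, Finset.sum_eq_single g]
  · rw [biproduct.ι_π_self_assoc]
  · intro g' _ hg
    rw [biproduct.ι_π_ne_assoc _ (fun e => hg (mul_left_cancel e).symm), zero_comp]
  · simp

lemma indActHom_π (X : C) (h g : G) :
    indActHom A X h ≫ biproduct.π (fun g : G => (A.ρ g).obj X) (h * g) =
      (A.ρ h).map (biproduct.π (fun g : G => (A.ρ g).obj X) g) ≫ (A.ρ₂ h g).hom.app X := by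
  rw [indActHom, Preadditive.sum_comp, Finset.sum_eq_single g]
  · rw [Category.assoc, Category.assoc, biproduct.ι_π_self, Category.comp_id]
  · intro g' _ hg
    rw [Category.assoc, Category.assoc, biproduct.ι_π_ne _ (fun e => hg (mul_left_cancel e)),
      comp_zero, comp_zero]
  · simp

/-- The equivariant object `⨁ ρ^g X` induced from an object `X`. -/
def ind (X : C) : Equivariantization A where
  X := ⨁ fun g : G => (A.ρ g).obj X
  act h :=
    { hom := indActHom A X h
      inv := indActInv A X h
      hom_inv_id := map_biproduct_hom_ext (A.ρ h) _ fun g => by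
        rw [← Category.assoc, ι_indActHom, Category.assoc, ι_indActInv]
        erw [Iso.hom_inv_id_app_assoc]
        rw [Category.comp_id]
      inv_hom_id := biproduct.hom_ext' _ _ fun g => by
        -- Translation by `h` is bijective on indices, so every summand is of the form covered by
        -- `ι_indActInv`.
        obtain ⟨g, rfl⟩ : ∃ g', g = h * g' := ⟨h⁻¹ * g, by simp⟩
        rw [← Category.assoc, ι_indActInv, Category.assoc, ι_indActHom]
        erw [Iso.inv_hom_id_app_assoc]
        rw [Category.comp_id] }
  mul a b := map_biproduct_hom_ext (A.ρ b ⋙ A.ρ a) _ fun g => by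
    have hn := (A.ρ₂ a b).hom.naturality (biproduct.ι (fun g : G => (A.ρ g).obj X) g)
    rw [← Category.assoc ((A.ρ b ⋙ A.ρ a).map _) ((A.ρ₂ a b).hom.app _)]
    erw [hn]
    rw [Category.assoc, ι_indActHom]
    rw [Functor.comp_map, ← Functor.map_comp_assoc, ι_indActHom, Functor.map_comp, Category.assoc,
      ι_indActHom, ← Category.assoc ((A.ρ₂ a b).hom.app _), A.assoc, Category.assoc,
      Category.assoc]
    -- The associativity axiom of the action leaves an `eqToHom` between the summands indexed by `(a
    -- * b) * g` and `a * (b * g)`; the biproduct inclusions absorb it.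
    congr 2
    exact (biproduct.eqToHom_comp_ι (fun g : G => (A.ρ g).obj X) (mul_assoc a b g).symm).symm
  unit := biproduct.hom_ext' _ _ fun g => by
    have hn : biproduct.ι (fun g : G => (A.ρ g).obj X) g ≫ A.ρ₀.hom.app _ =
      A.ρ₀.hom.app _ ≫ (A.ρ 1).map (biproduct.ι (fun g : G => (A.ρ g).obj X) g) :=
      A.ρ₀.hom.naturality _
    rw [reassoc_of% hn, ι_indActHom, ← Category.assoc, A.unit_mul, Category.comp_id]
    exact biproduct.eqToHom_comp_ι (fun g : G => (A.ρ g).obj X) (one_mul g).symm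

end Induction

/-! ### The multiplicity functors are jointly an equivalence -/

section Equivalence

open ProjRep

variable {k : Type u} [Field k] [IsAlgClosed k] {G : Type w} [Group G] {C : Type uC}
  [Category.{v} C] [Abelian C] [Linear k C] [MonoidalCategory C] [MonoidalPreadditive C]
  [MonoidalLinear k C] [RigidCategory C] [FusionCategory k C] {A : TensorAction k G C}

/-! ### One simple object: conjugates of morphisms and their effect on `Hom(Y, -)`. -/

section Single

variable (Y : C) [Simple Y] (c : ∀ g : A.inertia Y, (A.ρ g).obj Y ≅ Y)

lemma comp_hom_eq_of_homRepMap_eq {M N : Equivariantization A} {f g : M ⟶ N}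
    (h : homRepMap Y c f = homRepMap Y c g) (y : Y ⟶ M.X) : y ≫ f.hom = y ≫ g.hom := by
  have h1 := congrArg (fun t => lin t ((homEquiv Y c M).symm y)) h
  simp only [lin_homRepMap] at h1
  exact (homEquiv Y c N).symm.injective h1

/-- The linear map `Hom(Y, X) → Hom(Y, X')` underlying a morphism of multiplicity
representations. -/
def homLin {M N : Equivariantization A} (φ : homRep Y c M ⟶ homRep Y c N) :
    (Y ⟶ M.X) →ₗ[k] (Y ⟶ N.X) :=
  (homEquiv Y c N).toLinearMap ∘ₗ lin φ ∘ₗ (homEquiv Y c M).symm.toLinearMap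

lemma lin_symm {M N : Equivariantization A} (φ : homRep Y c M ⟶ homRep Y c N) (y : Y ⟶ M.X) :
    lin φ ((homEquiv Y c M).symm y) = (homEquiv Y c N).symm (homLin Y c φ y) := by
  rw [LinearEquiv.eq_symm_apply]
  rfl

lemma homLin_opHom {M N : Equivariantization A} (φ : homRep Y c M ⟶ homRep Y c N)
    (g : A.inertia Y) (y : Y ⟶ M.X) :
    homLin Y c φ (opHom Y c M g y) = opHom Y c N g (homLin Y c φ y) := by
  apply (homEquiv Y c N).symm.injective
  rw [← lin_symm, ← op_homEquiv_symm, lin_op, lin_symm, op_homEquiv_symm]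

/-- If `f` induces `φ` on `Hom(Y, -)`, then so does each conjugate of `f` by `g ∈ G_Y`. -/
lemma comp_conj_of_mem {M N : Equivariantization A} (φ : homRep Y c M ⟶ homRep Y c N)
    {r : k} {f : M.X ⟶ N.X} (hf : ∀ y : Y ⟶ M.X, y ≫ f = r • homLin Y c φ y) (y : Y ⟶ M.X) {g : G}
    (hg : g ∈ A.inertia Y) :
    y ≫ (M.act g).inv ≫ (A.ρ g).map f ≫ (N.act g).hom = r • homLin Y c φ y := by
  -- The operator of `g` is bijective, so `y` may be written as the image of some `x`. The conjugate
  -- of `f` then sends `y` to the operator of `g` applied to `x ≫ f`, and `φ` commutes with that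
  -- operator.
  obtain ⟨x, rfl⟩ : ∃ x, opHom Y c M ⟨g, hg⟩ x = y :=
    ⟨homEquiv Y c M ((homRep Y c M).opInv ⟨g, hg⟩ ((homEquiv Y c M).symm y)), by
      rw [← homEquiv_op, op_opInv, LinearEquiv.apply_symm_apply]⟩
  rw [homLin_opHom, ← map_smul, ← hf, opHom_apply, opHom_apply]
  simp

/-- If `f` vanishes on a simple object isomorphic to `ρ^{g⁻¹} Y`, then the conjugate of `f` by `g`
vanishes on `Y`. -/
lemma comp_conj_eq_zero {M N : Equivariantization A} {f : M.X ⟶ N.X} {g : G}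
    (hf : ∀ t : (A.ρ g⁻¹).obj Y ⟶ M.X, t ≫ f = 0) (y : Y ⟶ M.X) :
    y ≫ (M.act g).inv ≫ (A.ρ g).map f ≫ (N.act g).hom = 0 := by
  let e : (A.ρ g).obj ((A.ρ g⁻¹).obj Y) ≅ Y := (A.equivalence g).counitIso.app Y
  -- After identifying `Y` with `ρ^g ρ^{g⁻¹} Y`, the morphism `Y ⟶ ρ^g X` is `ρ^g` of some `t :
  -- ρ^{g⁻¹} Y ⟶ X`, because `ρ^g` is full; and `f` kills `t`.
  obtain ⟨t, ht⟩ := (A.ρ g).map_surjective (e.hom ≫ y ≫ (M.act g).inv)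
  rw [← cancel_epi e.hom, comp_zero]
  have h1 : (e.hom ≫ y ≫ (M.act g).inv) ≫ (A.ρ g).map f = 0 := by
    rw [← ht, ← Functor.map_comp, hf, Functor.map_zero]
  simp only [Category.assoc] at h1 ⊢
  rw [reassoc_of% h1, zero_comp]

/-! ### Projective representations as retracts of multiplicity spaces of induced objects. -/

section Retract

variable [Fintype G] (V : ProjRep k (factorSet A Y c)) (X : C)

/-- The map `V → Hom(Y, ⨁ ρ^g X)` given by a map `V → Hom(Y, X)` and the summand of `1`. -/
def indIn (j : V.V →ₗ[k] (Y ⟶ X)) : V.V →ₗ[k] (homRep Y c (ind A X)).V :=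
  (homEquiv Y c (ind A X)).symm.toLinearMap ∘ₗ
    Linear.rightComp k Y (A.ρ₀.hom.app X ≫ biproduct.ι (fun g : G => (A.ρ g).obj X) 1) ∘ₗ j

/-- The map `Hom(Y, ⨁ ρ^g X) → V` given by a map `Hom(Y, X) → V` and the summand of `1`. -/
def indOut (q : (Y ⟶ X) →ₗ[k] V.V) : (homRep Y c (ind A X)).V →ₗ[k] V.V :=
  q ∘ₗ Linear.rightComp k Y (biproduct.π (fun g : G => (A.ρ g).obj X) 1 ≫ A.ρ₀.inv.app X) ∘ₗ
    (homEquiv Y c (ind A X)).toLinearMap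

lemma homEquiv_indIn (j : V.V →ₗ[k] (Y ⟶ X)) (x : V.V) :
    homEquiv Y c (ind A X) (indIn Y c V X j x) =
      (j x ≫ A.ρ₀.hom.app X ≫ biproduct.ι (fun g : G => (A.ρ g).obj X) 1 :
        Y ⟶ ⨁ fun g : G => (A.ρ g).obj X) :=
  (homEquiv Y c (ind A X)).apply_symm_apply _

lemma indOut_apply (q : (Y ⟶ X) →ₗ[k] V.V) (x : (homRep Y c (ind A X)).V) :
    indOut Y c V X q x = q (homEquiv Y c (ind A X) x ≫
      biproduct.π (fun g : G => (A.ρ g).obj X) 1 ≫ A.ρ₀.inv.app X) := rfl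

lemma indOut_indIn (j : V.V →ₗ[k] (Y ⟶ X)) (q : (Y ⟶ X) →ₗ[k] V.V) (hq : ∀ x, q (j x) = x)
    (x : V.V) : indOut Y c V X q (indIn Y c V X j x) = x := by
  rw [indOut_apply, homEquiv_indIn]
  have : (j x ≫ A.ρ₀.hom.app X ≫ biproduct.ι (fun g : G => (A.ρ g).obj X) 1) ≫
      biproduct.π (fun g : G => (A.ρ g).obj X) 1 ≫ A.ρ₀.inv.app X = j x := by
    rw [Category.assoc, Category.assoc, biproduct.ι_π_self_assoc]
    erw [Iso.hom_inv_id_app]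
    exact Category.comp_id _
  exact (congrArg q this).trans (hq x)

/-- The operator of `g` moves the summand of `1` to that of `g`. If `π(g) z` is supported on the
summand of `1` and `g ≠ 1`, its component at `g` is zero; up to isomorphisms that component is `ρ^g`
of the component of `z` at `1`, so the latter vanishes, and `indOut` sees nothing else. Together
with `indOut_indIn` this verifies the hypotheses of `avg_comp_avg`. -/
lemma indOut_opInv_indIn (j : V.V →ₗ[k] (Y ⟶ X)) (q : (Y ⟶ X) →ₗ[k] V.V) (g : A.inertia Y)
    (hg : g ≠ 1) (x : V.V) :
    indOut Y c V X q ((homRep Y c (ind A X)).opInv g (indIn Y c V X j x)) = 0 := by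
  set z := (homRep Y c (ind A X)).opInv g (indIn Y c V X j x) with hz
  have h1 : opHom Y c (ind A X) g (homEquiv Y c (ind A X) z) =
      (j x ≫ A.ρ₀.hom.app X ≫ biproduct.ι (fun g : G => (A.ρ g).obj X) 1 :
        Y ⟶ ⨁ fun g : G => (A.ρ g).obj X) := by
    rw [← homEquiv_op, hz, op_opInv, homEquiv_indIn]
  let f : Y ⟶ ⨁ fun g : G => (A.ρ g).obj X := homEquiv Y c (ind A X) z
  have h2 : (c g).inv ≫ (A.ρ g).map f ≫ indActHom A X g =
    j x ≫ A.ρ₀.hom.app X ≫ biproduct.ι (fun g : G => (A.ρ g).obj X) 1 := h1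
  -- The target summand is indexed by `g * 1`, the form produced by `indActHom_π`.
  have hne : (1 : G) ≠ (g : G) * 1 := by
    rw [mul_one]
    exact fun h => hg (Subtype.ext h.symm)
  have h3 := congrArg (· ≫ biproduct.π (fun g : G => (A.ρ g).obj X) ((g : G) * 1)) h2
  simp only [Category.assoc, indActHom_π, biproduct.ι_π_ne _ hne, comp_zero] at h3
  replace h3 := (cancel_epi (c g).inv).mp (h3.trans comp_zero.symm)
  rw [← Functor.map_comp_assoc] at h3
  have h4 : (A.ρ g).map (f ≫ biproduct.π (fun g : G => (A.ρ g).obj X) 1) = 0 := by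
    rw [← cancel_mono ((A.ρ₂ g 1).hom.app X), zero_comp]
    exact h3
  have h5 : f ≫ biproduct.π (fun g : G => (A.ρ g).obj X) 1 = 0 :=
    (A.ρ g).map_injective (by rw [h4, Functor.map_zero])
  rw [indOut_apply]
  have h6 : f ≫ biproduct.π (fun g : G => (A.ρ g).obj X) 1 ≫ A.ρ₀.inv.app X = 0 := by
    rw [reassoc_of% h5, zero_comp]
  exact (congrArg q h6).trans (map_zero q)

/-- A projective representation whose space embeds into `Hom(Y, X)` is a retract of the
multiplicity representation of the equivariant object induced from `X`. -/
lemma exists_retract [CharZero k] (j : V.V →ₗ[k] (Y ⟶ X)) (hj : Function.Injective j) :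
    ∃ (i : V ⟶ homRep Y c (ind A X)) (r : homRep Y c (ind A X) ⟶ V), i ≫ r = 𝟙 V := by
  have := Fintype.ofFinite (A.inertia Y)
  obtain ⟨q, hq⟩ := j.exists_leftInverse_of_injective (LinearMap.ker_eq_bot.mpr hj)
  -- The composite of the two averages is `|G_Y|` times the identity, and `|G_Y|` is invertible in
  -- characteristic zero.
  refine ⟨avg (indIn Y c V X j),
    (Fintype.card (A.inertia Y) : k)⁻¹ • avg (indOut Y c V X q), ?_⟩
  rw [Linear.comp_smul, avg_comp_avg _ _
    (indOut_indIn Y c V X j q fun x => LinearMap.congr_fun hq x)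
    fun g hg x => indOut_opInv_indIn Y c V X j q g hg x, smul_smul, inv_mul_cancel₀, one_smul]
  exact Nat.cast_ne_zero.mpr Fintype.card_ne_zero

end Retract

end Single

/-! ### All orbits together: faithful, full and essentially surjective. -/

variable (Y : A.Orbits → SimpleObj C)
  (c : ∀ (o : A.Orbits) (g : A.inertia (Y o).1), (A.ρ g).obj (Y o).1 ≅ (Y o).1)

/-- The functor `C^G ⥤ ∏ rep_{α_Y} G_Y`, `(X, μ) ↦ (Hom(Y, X))_Y`. -/
def multiplicityFunctor :
    Equivariantization A ⥤ ∀ o : A.Orbits, ProjRep k (factorSet A (Y o).1 (c o)) :=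
  Functor.pi' fun o => homFunctor (Y o).1 (c o)

/-- Needed to form a direct sum over all orbits in the proof of essential surjectivity. -/
lemma finite_orbits : Finite A.Orbits :=
  have := finite_irr k C
  inferInstanceAs (Finite (_root_.Quotient (@MulAction.orbitRel G (Irr C) _ A.irrAction)))

variable (hY : ∀ o : A.Orbits, A.orbit (Y o) = o)

include hY

lemma eq_of_iso {o o' : A.Orbits} {g : G} (e : (A.ρ g).obj (Y o').1 ≅ (Y o).1) : o = o' := by
  rw [← hY o, ← hY o']
  exact (orbit_eq_iff A _ _).mpr ⟨g, ⟨e⟩⟩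

/-- Every simple `S` is isomorphic to `ρ^g Y` for the representative `Y` of its orbit, and any `t :
S ⟶ X` then arises from some `y : Y ⟶ X` by applying `ρ^g` and `μ^g`. An equivariant morphism is
therefore determined on `t` by its value on `y`. -/
lemma multiplicityFunctor_faithful : (multiplicityFunctor Y c).Faithful where
  map_injective {M N f f'} h := Equivariantization.hom_ext <| hom_ext_simple k fun S _ t => by
    obtain ⟨g, ⟨e⟩⟩ := (orbit_eq_iff A ⟨S, ‹_›⟩ (Y (A.orbit ⟨S, ‹_›⟩))).mp (hY _).symm
    obtain ⟨y, hy⟩ := (A.ρ g).map_surjective (e.hom ≫ t ≫ (M.act g).inv)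
    have ht : t = e.inv ≫ (A.ρ g).map y ≫ (M.act g).hom := by
      rw [hy]; simp
    have hyf := comp_hom_eq_of_homRepMap_eq _ _ (congrFun h (A.orbit ⟨S, ‹_›⟩)) y
    rw [ht, Category.assoc, Category.assoc, Category.assoc, Category.assoc, f.comm, f'.comm,
      ← Functor.map_comp_assoc, ← Functor.map_comp_assoc, hyf]

/-- A morphism of `C` inducing `|G_Y|⁻¹ φ` on each `Hom(Y, -)` is averaged over `G`. Each `g ∈ G_Y`
contributes `|G_Y|⁻¹ φ` on `Hom(Y, -)` since `φ` commutes with the operators, and each `g ∉ G_Y`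
contributes zero. -/
lemma multiplicityFunctor_full [CharZero k] [Finite G] : (multiplicityFunctor Y c).Full where
  map_surjective {M N} φ := by
    classical
    have := Fintype.ofFinite G
    let r (o : A.Orbits) : k := (Fintype.card (A.inertia (Y o).1) : k)⁻¹
    obtain ⟨f, hf, hf'⟩ := exists_hom_of_family (fun o => (Y o).1)
      (fun o o' ⟨e⟩ => eq_of_iso Y hY ((A.ρ₀.app _).symm ≪≫ e.symm)) M.X N.X
      fun o => r o • homLin (Y o).1 (c o) (φ o)
    refine ⟨Equivariantization.avgHom f, funext fun o => homRep_ext _ _ fun y => ?_⟩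
    refine (lin_homRepMap _ _ _ _).trans ?_
    refine Eq.trans ?_ (lin_symm (Y o).1 (c o) (φ o) y).symm
    congr 1
    change y ≫ ∑ g, _ = _
    have key : ∀ g : G, y ≫ (M.act g).inv ≫ (A.ρ g).map f ≫ (N.act g).hom =
        if g ∈ A.inertia (Y o).1 then r o • homLin (Y o).1 (c o) (φ o) y else 0 := fun g => by
      split_ifs with hg
      · exact comp_conj_of_mem _ _ _ (fun y => hf o y) y hg
      · refine comp_conj_eq_zero _ (fun t => ?_) y
        have := (A.simpleMap g⁻¹ (Y o)).2
        -- The simple object `ρ^{g⁻¹} Y` is isomorphic to no representative: the only candidate in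
        -- its orbit is `Y` itself, which would put `g⁻¹`, hence `g`, in `G_Y`.
        refine hf' (A.simpleMap g⁻¹ (Y o)).1 (fun o' => ⟨fun e => hg ?_⟩) t
        obtain rfl := eq_of_iso Y hY e
        exact inv_mem_iff.mp ⟨e⟩
    rw [Preadditive.comp_sum, Finset.sum_congr rfl fun g _ => key g, ← Finset.sum_filter,
      Finset.sum_const, ← Nat.cast_smul_eq_nsmul k, smul_smul, ← Fintype.card_subtype]
    have hr : (Fintype.card (A.inertia (Y o).1) : k) * r o = 1 :=
      mul_inv_cancel₀ (Nat.cast_ne_zero.mpr Fintype.card_ne_zero)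
    convert one_smul k _ using 2

/-- One object serves all orbits: with `X` the direct sum of the `V_Y ⊗ Y`, each `V_Y` embeds in
`Hom(Y, X)`, so the whole family is a retract of the image of the object induced from `X`. -/
lemma multiplicityFunctor_essSurj [CharZero k] [Finite G] : (multiplicityFunctor Y c).EssSurj where
  mem_essImage V := by
    have := Fintype.ofFinite G
    have := finite_orbits (k := k) (A := A)
    have := multiplicityFunctor_faithful Y c hY
    have := multiplicityFunctor_full Y c hY
    let X : A.Orbits → C := fun o => tensorVec k (V o).V (Y o).1
    have h (o : A.Orbits) := exists_retract (Y o).1 (c o) (V o) (⨁ X)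
      (Linear.rightComp k (Y o).1 (biproduct.ι X o) ∘ₗ (tensorVecCopower k (V o).V (Y o).1).ins)
      fun v v' hv => by
        have hv' : (tensorVecCopower k (V o).V (Y o).1).ins v ≫ biproduct.ι X o =
          (tensorVecCopower k (V o).V (Y o).1).ins v' ≫ biproduct.ι X o := hv
        rw [cancel_mono] at hv'
        -- Injectivity of `v ↦ v ⊗ -`: the projections recover the coordinates of `v` as multiples
        -- of `𝟙 Y`, which is nonzero.
        refine (Module.finBasis k (V o).V).ext_elem fun i => ?_
        have h1 := congrArg (· ≫ (tensorVecCopower k (V o).V (Y o).1).proj i) hv'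
        simp only [Copower.ins_proj'] at h1
        exact smul_left_injective k (id_nonzero (Y o).1) h1
    choose i r hir using h
    exact mem_essImage_of_retract _ (ind A (⨁ X)) V i r (funext hir)

lemma multiplicityFunctor_isEquivalence [CharZero k] [Finite G] :
    (multiplicityFunctor Y c).IsEquivalence where
  faithful := multiplicityFunctor_faithful Y c hY
  full := multiplicityFunctor_full Y c hY
  essSurj := multiplicityFunctor_essSurj Y c hY

-- The inclusion of `Y` as the summand of `1` is a nonzero element of the multiplicity space of the
-- object induced from `Y`. This supplies the nonvanishing part of indecomposability.
omit hY in
lemma exists_homRep_not_isZero [Finite G] (Y : C) [Simple Y]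
    (c : ∀ g : A.inertia Y, (A.ρ g).obj Y ≅ Y) : ∃ M : ProjRep k (factorSet A Y c), ¬ IsZero M := by
  have := Fintype.ofFinite G
  refine ⟨homRep Y c (ind A Y), fun h => ?_⟩
  let y : Y ⟶ ⨁ fun g : G => (A.ρ g).obj Y :=
    A.ρ₀.hom.app Y ≫ biproduct.ι (fun g : G => (A.ρ g).obj Y) 1
  have hy : y = 0 :=
    (homEquiv Y c (ind A Y)).symm.injective
      (((ProjRep.isZero_iff _).mp h _).trans (map_zero _).symm)
  have h1 : y ≫ biproduct.π (fun g : G => (A.ρ g).obj Y) 1 ≫ A.ρ₀.inv.app Y = 𝟙 Y := by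
    rw [Category.assoc, biproduct.ι_π_self_assoc]
    exact Iso.hom_inv_id_app _ _
  rw [hy, zero_comp] at h1
  exact id_nonzero Y h1.symm

end Equivalence

/-! ### Indecomposability -/

namespace ProjRep

variable {k : Type u} [Field k] {G : Type w} [Group G] {H : Subgroup G} {α : H → H → kˣ}

variable (k) in
/-- The regular representation of a finite group, on a model of its space in the universe of the
ground field. -/
def regularRep {n : ℕ} (e : G ≃ Fin n) : Representation k G (Fin n → k) where
  toFun g := LinearMap.funLeft k k fun i => e (g⁻¹ * e.symm i)
  map_one' := LinearMap.ext fun x => funext fun i => by simp [LinearMap.funLeft_apply]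
  map_mul' g h := LinearMap.ext fun x => funext fun i => by
    simp [LinearMap.funLeft_apply, mul_assoc]

/-- The inverse operators on a tensor product. -/
lemma opInv_tmulLeft {V : FDRep k G} {M : ProjRep k α} (g : H) (v : V) (m : M.V) :
    (tensorLeft V M).opInv g (tmulLeft v m) = tmulLeft (V.ρ (g : G)⁻¹ v) (M.opInv g m) := by
  rw [opInv_eq_iff, op_tmulLeft, op_opInv, ← Module.End.mul_apply, ← map_mul, mul_inv_cancel,
    map_one]
  rfl

/-- Any two nonzero projective representations are linked by a nonzero morphism after tensoring
one of them with the regular representation. -/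
lemma exists_tensorLeft_hom_ne_zero [Finite G] {M N : ProjRep k α} (hM : ¬ IsZero M)
    (hN : ¬ IsZero N) : ∃ (V : FDRep k G) (f : tensorLeft V M ⟶ N), f ≠ 0 := by
  classical
  have := Fintype.ofFinite H
  obtain ⟨n, ⟨e⟩⟩ := Finite.exists_equiv_fin G
  rw [isZero_iff, not_forall] at hM hN
  obtain ⟨m, hm⟩ := hM
  obtain ⟨x, hx⟩ := hN
  obtain ⟨ξ, hξ⟩ : ∃ ξ : Module.Dual k M.V, ξ m ≠ 0 := by
    by_contra! h
    exact hm ((Module.forall_dual_apply_eq_zero_iff k m).mp h)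
  let V : FDRep k G := FDRep.of (regularRep k e)
  -- With `ev` evaluation at the identity and `ξ m ≠ 0`, the map `v ⊗ y ↦ ev(v) ξ(y) x` is averaged
  -- over `H` and evaluated at `δ ⊗ m`, where `δ` is the delta function at the identity. Translates
  -- of `δ` by `h ≠ 1` vanish at the identity, so only one summand survives and no cancellation can
  -- occur.
  let ev : V →ₗ[k] k := (LinearMap.proj (e 1) : (Fin n → k) →ₗ[k] k)
  let φ : (tensorLeft V M).V →ₗ[k] N.V :=
    liftLeft (LinearMap.mk₂ k (fun (v : V) (y : M.V) => ev v • ξ y • x)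
      (fun v v' y => by rw [map_add, add_smul]) (fun r v y => by rw [map_smul, smul_assoc])
      (fun v y y' => by rw [map_add, add_smul, smul_add])
      (fun r v y => by rw [map_smul, smul_assoc, smul_comm]))
  have hφ : ∀ (v : V) (y : M.V), φ (tmulLeft v y) = ev v • ξ y • x := fun v y =>
    liftLeft_tmul _ v y
  let δ : V := (Pi.single (e 1) 1 : Fin n → k)
  refine ⟨V, avg φ, fun h => ?_⟩
  have h0 : lin (avg φ) (tmulLeft δ m) = 0 := by rw [h, lin_zero]
  have hev : ∀ g : G, ev (V.ρ g⁻¹ δ) = if g = 1 then 1 else 0 := fun g => by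
    change (Pi.single (e 1) 1 : Fin n → k) (e (g⁻¹⁻¹ * e.symm (e 1))) = _
    rw [Pi.single_apply]
    simp
  rw [lin_avg, Finset.sum_eq_single 1] at h0
  · rw [opInv_tmulLeft, hφ, hev, OneMemClass.coe_one, if_pos rfl, one_smul] at h0
    have h1 := N.op_injective 1 (h0.trans (map_zero _).symm)
    have h2 := (smul_eq_zero.mp h1).resolve_right hx
    -- The surviving summand involves `ξ (π(1)⁻¹ m)`, not `ξ m`; as `π(1)` is a scalar, vanishing of
    -- the first forces vanishing of the second.
    have h3 : M.op 1 (M.opInv 1 m) = m := M.op_opInv 1 m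
    rw [op_one] at h3
    rw [← h3, map_smul, h2, smul_zero] at hξ
    exact hξ rfl
  · intro g _ hg
    rw [opInv_tmulLeft, hφ, hev, if_neg (fun h => hg (Subtype.ext (by simpa using h))), zero_smul, map_zero]
  · simp

/-- In the proof of indecomposability the two summands are arbitrary and not assumed to contain zero
objects. The image of `Z` under the equivalence provides one in each. -/
lemma exists_isZero : ∃ Z : ProjRep k α, IsZero Z :=
  ⟨ofOp PUnit (fun _ => 0) (fun _ _ _ => rfl) (fun _ _ _ => rfl), (isZero_iff _).mpr fun _ => rfl⟩

/-- The bimodule category of projective representations of a subgroup is indecomposable as soon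
as it is nonzero. -/
lemma isIndecomposable [Finite G] (hne : ∃ M : ProjRep k α, ¬ IsZero M) :
    IsIndecomposable k (FDRep k G) (ProjRep k α) := by
  refine ⟨hne, fun N _ _ _ _ _ _ ⟨E⟩ => ?_⟩
  by_contra! hN
  choose n hn using hN
  let F := E.functor
  have : F.IsEquivalence := E.isEquivalence
  have : F.Additive := E.additive
  let _ : F.LeftLinear (FDRep k G) := E.leftLinear
  obtain ⟨Z, hZ⟩ := exists_isZero (k := k) (α := α)
  have hZ' : ∀ i, 𝟙 (F.obj Z i) = 0 := fun i => congrFun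
    ((F.map_id Z).symm.trans ((congrArg F.map ((IsZero.iff_id_eq_zero _).mp hZ)).trans
      (F.map_zero _ _))) i
  have hne (a : ∀ i, N i) (i : Bool) (ha : a i = n i) : ¬ IsZero (F.objPreimage a) := fun h => by
    have h1 := (IsZero.iff_id_eq_zero _).mp
      ((F.map_isZero h).of_iso (F.objObjPreimageIso a).symm)
    refine hn i ?_
    rw [← ha, IsZero.iff_id_eq_zero]
    exact congrFun h1 i
  -- The objects `a` and `b` are nonzero and supported on different summands. Hence every morphism
  -- `V ⊙ a ⟶ b` is zero: in the component `false` its target is zero, and in the component `true`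
  -- its source is zero, as the action is linear.
  let a : ∀ i, N i := fun | false => n false | true => F.obj Z true
  let b : ∀ i, N i := fun | false => F.obj Z false | true => n true
  obtain ⟨V, f, hf⟩ := exists_tensorLeft_hom_ne_zero (hne a false rfl) (hne b true rfl)
  refine hf (F.map_injective ?_)
  have hg : ∀ g : V ⊙ₗ a ⟶ b, g = 0 := fun g => funext fun i => by
    match i with
    | false =>
      refine (Category.comp_id _).symm.trans ?_
      exact (congrArg (g false ≫ ·) (hZ' false)).trans comp_zero
    | true =>
      have h1 : 𝟙 (V ⊙ₗ F.obj Z true) = 0 := by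
        rw [← MonoidalLeftAction.actionHomRight_id, hZ', ← zero_smul k (0 : F.obj Z true ⟶ _),
          BimoduleCategory.left_smul, zero_smul]
      refine (Category.id_comp _).symm.trans ?_
      exact (congrArg (· ≫ g true) h1).trans zero_comp
  let ea := F.objObjPreimageIso a
  let eb := F.objObjPreimageIso b
  -- The image of `f`, transported through the module structure of `F` and the preimage
  -- isomorphisms, is a morphism `V ⊙ a ⟶ b`. Everything composed with `F.map f` is invertible, so
  -- `F.map f` vanishes.
  have h2 := hg (V ⊴ₗ ea.inv ≫ Functor.LaxLeftLinear.μₗ F V _ ≫ F.map f ≫ eb.hom)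
  rw [← cancel_mono eb.hom, ← cancel_epi (Functor.LaxLeftLinear.μₗ F V (F.objPreimage a)),
    ← cancel_epi (V ⊴ₗ ea.inv), F.map_zero, zero_comp, comp_zero, comp_zero]
  exact h2

end ProjRep

/-! ### The decomposition of the equivariantization -/

section Main

variable {k : Type u} [Field k] [IsAlgClosed k] {G : Type w} [Group G] {C : Type uC}
  [Category.{v} C] [Abelian C] [Linear k C] [MonoidalCategory C] [MonoidalPreadditive C]
  [MonoidalLinear k C] [RigidCategory C] [FusionCategory k C] {A : TensorAction k G C}

/-- The equivalence of bimodule categories `C^G ≃ ⨁ rep_{α_Y} G_Y`. -/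
def multiplicityBimoduleEquivalence [CharZero k] [Finite G] (Y : A.Orbits → SimpleObj C)
    (hY : ∀ o : A.Orbits, A.orbit (Y o) = o)
    (c : ∀ (o : A.Orbits) (g : A.inertia (Y o).1), (A.ρ g).obj (Y o).1 ≅ (Y o).1) :
    BimoduleEquivalence k (FDRep k G) (Equivariantization A)
      (∀ o : A.Orbits, ProjRep k (factorSet A (Y o).1 (c o))) where
  functor := multiplicityFunctor Y c
  isEquivalence := multiplicityFunctor_isEquivalence Y c hY
  additive := ⟨funext fun o => (homFunctor (Y o).1 (c o)).map_add⟩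
  linear := ⟨fun f r => funext fun o => Functor.Linear.map_smul (F := homFunctor (Y o).1 (c o)) f r⟩
  leftLinear := piLeftLinear fun o => homFunctor (Y o).1 (c o)
  rightLinear := piRightLinear fun o => homFunctor (Y o).1 (c o)
  middle_compat V M W := funext fun o => homFunctor_middle (Y o).1 (c o) V M W

end Main

end EquivFusion

end

theorem theorem3p14 (k : Type u) [Field k] [IsAlgClosed k] [CharZero k]
    (G : Type w) [Group G] [Finite G]
    (C : Type uC) [Category.{v} C] [Abelian C] [Linear k C] [MonoidalCategory C]
    [MonoidalPreadditive C] [MonoidalLinear k C] [RigidCategory C]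
    [EquivFusion.FusionCategory k C]
    (A : EquivFusion.TensorAction k G C)
    (Y : A.Orbits → EquivFusion.SimpleObj C) (hY : ∀ o : A.Orbits, A.orbit (Y o) = o)
    (c : ∀ (o : A.Orbits) (g : A.inertia (Y o).1), (A.ρ g).obj (Y o).1 ≅ (Y o).1) :
    Nonempty (EquivFusion.BimoduleEquivalence k (FDRep k G) (EquivFusion.Equivariantization A)
      (∀ o : A.Orbits, EquivFusion.ProjRep k (EquivFusion.factorSet A (Y o).1 (c o)))) ∧
    ∀ o : A.Orbits, EquivFusion.IsIndecomposable k (FDRep k G)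
      (EquivFusion.ProjRep k (EquivFusion.factorSet A (Y o).1 (c o))) :=
  ⟨⟨EquivFusion.multiplicityBimoduleEquivalence Y hY c⟩, fun o =>
    EquivFusion.ProjRep.isIndecomposable (EquivFusion.exists_homRep_not_isZero (Y o).1 (c o))⟩
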